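/- Let $\mathbb D$ be the open unit disk, $\mathbb T$ the unit circle, $dA$ the normalized area measure on $\mathbb D$ (so $A(\mathbb D)=1$), and $H^2$, $H^\infty$ the Hardy spaces, identified with spaces of boundary functions on $\mathbb T$ (normalized arc length). For $\zeta\in\overline{\mathbb D}$ and $f$ holomorphic on $\mathbb D$, let $\mathcal D_\zeta(f):=\int_{\mathbb D}|f'(z)|^2\,\omega_\zeta(z)\,dA(z)\in[0,\infty]$, where $$\omega_\zeta(z):=\frac{2}{1-|\zeta|^2}\log\Bigl|\frac{1-\overline\zeta z}{\zeta-z}\Bigr|\quad(\zeta\in\mathbb D),\qquad \omega_\zeta(z):=\frac{1-|z|^2}{|\zeta-z|^2}\quad(\zeta\in\mathbb T).$$ Let $\mathcal D_\zeta$ be the space of all $f$ holomorphic on $\mathbb D$ with $\mathcal D_\zeta(f)<\infty$, with the norm given by $\|f\|_{\mathcal D_\zeta}^2:=\|f\|_{H^2}^2+\mathcal D_\zeta(f)$. For $\psi\in L^\infty(\mathbb T)$ let $T_\psi f:=P_+(\psi f)$ be the Toeplitz operator on $H^2$, where $P_+:L^2(\mathbb T)\to H^2$ is the orthogonal projection.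 For $b\in H^\infty$ with $\|b\|_\infty\le1$ let $\mathcal H(b):=(I-T_bT_{\overline b})^{1/2}H^2$, with the norm that makes $(I-T_bT_{\overline b})^{1/2}$ a partial isometry of $H^2$ onto $\mathcal H(b)$; that is, $\|(I-T_bT_{\overline b})^{1/2}g\|_{\mathcal H(b)}:=\|g\|_{H^2}$ for $g\perp\ker(I-T_bT_{\overline b})^{1/2}$. Call $(b,a)$ a pair if $b\in H^\infty$ with $\|b\|_\infty\le1$, $a\in H^\infty$ is outer with $a(0)>0$, and $|a|^2+|b|^2=1$ a.e. on $\mathbb T$ (in particular, $b$ is then a non-extreme point of the unit ball of $H^\infty$). **Theorem.** Let $\zeta\in\overline{\mathbb D}$. There is a pair $(b,a)$ with $b(z)/a(z)=z/(1-\overline\zeta z)$ for $z\in\mathbb D$; and for every such pair, $\mathcal D_\zeta=\mathcal H(b)$ as spaces of functions on $\mathbb D$, and $\|f\|_{\mathcal D_\zeta}=\|f\|_{\mathcal H(b)}$ for all $f$ in this space. -/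

import Mathlib

open MeasureTheory Metric
open scoped ENNReal ComplexConjugate

/-- The unit circle `𝕋`, parametrized by `t ↦ e^{2πit}` with `t ∈ ℝ/ℤ`. -/
abbrev Torus : Type := AddCircle (1 : ℝ)

/-- Normalized arc-length measure on the circle. -/
noncomputable abbrev arcMeasure : Measure Torus := AddCircle.haarAddCircle

/-! ### Hardy spaces -/

/-- The value at `z` of the function on the disk with boundary function `f`, that is,
`∑_{n ≥ 0} f̂(n) zⁿ`. -/
noncomputable def diskValue (f : Torus → ℂ) (z : ℂ) : ℂ :=
  ∑' n : ℕ, fourierCoeff f n * z ^ n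

/-- The Hardy space `H²`, as the subspace of `L²(𝕋)` of the functions whose Fourier coefficients
of negative index vanish; it carries the norm and inner product of `L²(𝕋)`. -/
noncomputable def hardyTwo : Submodule ℂ (Lp ℂ 2 arcMeasure) where
  carrier := {f | ∀ n : ℤ, n < 0 → fourierCoeff f n = 0}
  zero_mem' := fun n _ => by rw [← fourierBasis_repr, map_zero]; rfl
  add_mem' := fun {f g} hf hg n hn => by
    have h1 := hf n hn
    have h2 := hg n hn
    rw [← fourierBasis_repr] at h1 h2 ⊢
    rw [map_add, lp.coeFn_add, Pi.add_apply, h1, h2, add_zero]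
  smul_mem' := fun c f hf n hn => by
    have h1 := hf n hn
    rw [← fourierBasis_repr] at h1 ⊢
    rw [map_smul, lp.coeFn_smul, Pi.smul_apply, h1, smul_zero]

theorem isClosed_hardyTwo : IsClosed (hardyTwo : Set (Lp ℂ 2 arcMeasure)) := by
  have h : (hardyTwo : Set (Lp ℂ 2 arcMeasure)) =
      ⋂ (n : ℤ) (_ : n < 0), {f | inner ℂ (fourierLp (T := (1 : ℝ)) 2 n) f = 0} := by
    ext f
    simp only [Set.mem_iInter, Set.mem_ofPred_eq, SetLike.mem_coe]
    refine forall_congr' fun n => forall_congr' fun _ => ?_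
    rw [← fourierBasis_repr, HilbertBasis.repr_apply_apply, coe_fourierBasis]
  rw [h]
  exact isClosed_iInter fun n => isClosed_iInter fun _ =>
    isClosed_eq (by fun_prop) continuous_const

instance : CompleteSpace hardyTwo := isClosed_hardyTwo.completeSpace_coe

/-- Membership in `H^∞`: an element of `L^∞(𝕋)` whose Fourier coefficients of negative index
vanish. -/
def IsHardyInfty (f : Lp ℂ ∞ arcMeasure) : Prop :=
  ∀ n : ℤ, n < 0 → fourierCoeff f n = 0

/-- Outer functions in `H^∞`: `log |f|` is integrable on the circle and, for some constant `c` of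
modulus one, `f(z) = c · exp (∫ (λ + z)/(λ - z) · log |f(λ)| |dλ|/2π)` on the disk. -/
def IsOuter (f : Lp ℂ ∞ arcMeasure) : Prop :=
  IsHardyInfty f ∧
  Integrable (fun t => Real.log ‖f t‖) arcMeasure ∧
  ∃ c : ℂ, ‖c‖ = 1 ∧ ∀ z ∈ ball (0 : ℂ) 1,
    diskValue f z = c * Complex.exp
      (∫ t, ((AddCircle.toCircle t : ℂ) + z) / ((AddCircle.toCircle t : ℂ) - z) *
        (Real.log ‖f t‖ : ℂ) ∂arcMeasure)

/-! ### Toeplitz operators and de Branges–Rovnyak spaces -/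

/-- Multiplication by `ψ ∈ L^∞(𝕋)` on `L²(𝕋)`. -/
noncomputable def mulLp (ψ : Lp ℂ ∞ arcMeasure) : Lp ℂ 2 arcMeasure →L[ℂ] Lp ℂ 2 arcMeasure :=
  (ContinuousLinearMap.mul ℂ ℂ).holderL arcMeasure ∞ 2 2 ψ

/-- The Toeplitz operator `T_ψ f = P₊(ψ f)` on `H²`. -/
noncomputable def toeplitz (ψ : Lp ℂ ∞ arcMeasure) : hardyTwo →L[ℂ] hardyTwo :=
  hardyTwo.orthogonalProjectionOnto ∘L mulLp ψ ∘L hardyTwo.subtypeL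

/-- The positive square root of a positive operator on a Hilbert space. -/
noncomputable def opSqrt {H : Type*} [NormedAddCommGroup H] [InnerProductSpace ℂ H]
    [CompleteSpace H] (A : H →L[ℂ] H) : H →L[ℂ] H :=
  CFC.sqrt A

/-- The operator `(I - T_b T_{b̄})^{1/2}`. -/
noncomputable def dbrRoot (b : Lp ℂ ∞ arcMeasure) : hardyTwo →L[ℂ] hardyTwo :=
  opSqrt (1 - toeplitz b * toeplitz (star b))

/-- The de Branges–Rovnyak space `ℋ(b)`, the range of `(I - T_b T_{b̄})^{1/2}` in `H²`. -/
noncomputable def dbrSpace (b : Lp ℂ ∞ arcMeasure) : Submodule ℂ hardyTwo :=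
  LinearMap.range (dbrRoot b : hardyTwo →ₗ[ℂ] hardyTwo)

/-- The norm of `ℋ(b)`: for `f ∈ ℋ(b)` it is `‖g‖_{H²}`, where `g` is the unique preimage of `f`
under `(I - T_b T_{b̄})^{1/2}` that is orthogonal to the kernel of this operator (the infimum is
over a one-point set, see `dbrNorm_dbrRoot`). -/
noncomputable def dbrNorm (b : Lp ℂ ∞ arcMeasure) (f : hardyTwo) : ℝ :=
  sInf {s | ∃ g ∈ (LinearMap.ker (dbrRoot b : hardyTwo →ₗ[ℂ] hardyTwo))ᗮ,
    dbrRoot b g = f ∧ ‖g‖ = s}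

theorem dbrNorm_dbrRoot (b : Lp ℂ ∞ arcMeasure) (g : hardyTwo)
    (hg : g ∈ (LinearMap.ker (dbrRoot b : hardyTwo →ₗ[ℂ] hardyTwo))ᗮ) :
    dbrNorm b (dbrRoot b g) = ‖g‖ := by
  have h : {s | ∃ g' ∈ (LinearMap.ker (dbrRoot b : hardyTwo →ₗ[ℂ] hardyTwo))ᗮ,
      dbrRoot b g' = dbrRoot b g ∧ ‖g'‖ = s} = {‖g‖} := by
    ext s
    constructor
    · rintro ⟨g', hg', h, rfl⟩
      have h0 : g' - g = 0 := by
        have hk : g' - g ∈ LinearMap.ker (dbrRoot b : hardyTwo →ₗ[ℂ] hardyTwo) := by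
          simp [LinearMap.mem_ker, h]
        exact inner_self_eq_zero.1 (Submodule.inner_right_of_mem_orthogonal hk
          (Submodule.sub_mem _ hg' hg))
      rw [sub_eq_zero.1 h0]; rfl
    · rintro rfl
      exact ⟨g, hg, rfl, rfl⟩
  rw [dbrNorm, h, csInf_singleton]

/-- `(b, a)` is a pair: `b` is in the closed unit ball of `H^∞`, `a` is an outer function with
`a(0) > 0`, and `|a|² + |b|² = 1` a.e. on the circle. (Then `log (1 - |b|²) = 2 log |a|` is
integrable, so `b` is non-extreme.) -/
structure IsPair (b a : Lp ℂ ∞ arcMeasure) : Prop where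
  hardy_b : IsHardyInfty b
  norm_b : ‖b‖ ≤ 1
  outer_a : IsOuter a
  a_zero : ∃ x : ℝ, 0 < x ∧ diskValue a 0 = x
  sq_add_sq : ∀ᵐ t ∂arcMeasure, ‖a t‖ ^ 2 + ‖b t‖ ^ 2 = 1

/-! ### Weighted Dirichlet spaces -/

/-- The superharmonic weight `ω_ζ`: a normalized Green potential for `|ζ| < 1`, the Poisson kernel
for `|ζ| = 1`. -/
noncomputable def dirichletWeight (ζ z : ℂ) : ℝ :=
  if ‖ζ‖ < 1 then Real.log ‖(1 - conj ζ * z) / (ζ - z)‖ * (2 / (1 - ‖ζ‖ ^ 2))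
  else (1 - ‖z‖ ^ 2) / ‖ζ - z‖ ^ 2

/-- The weighted Dirichlet integral `𝒟_ζ(f) = ∫_𝔻 |f'|² ω_ζ dA ∈ [0, ∞]`, where `dA` is area measure
on the disk divided by `π`. -/
noncomputable def dirichletIntegral (ζ : ℂ) (f : ℂ → ℂ) : ℝ≥0∞ :=
  ENNReal.ofReal (1 / Real.pi) *
    ∫⁻ z in ball (0 : ℂ) 1, ENNReal.ofReal (‖deriv f z‖ ^ 2 * dirichletWeight ζ z)

/-- The weighted Dirichlet space `𝒟_ζ`: holomorphic functions on the disk with finite weighted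
Dirichlet integral. (Values of `f` off the disk play no role.) -/
def dirichletSpace (ζ : ℂ) : Set (ℂ → ℂ) :=
  {f | DifferentiableOn ℂ f (ball 0 1) ∧ dirichletIntegral ζ f < ∞}

/-- `‖f‖_{H²}² = ∑ |aₙ|² ∈ [0, ∞]` for `f(z) = ∑ aₙ zⁿ` holomorphic on the disk. -/
noncomputable def hardyNormSq (f : ℂ → ℂ) : ℝ≥0∞ :=
  ∑' n : ℕ, ‖iteratedDeriv n f 0 / (n.factorial : ℂ)‖ₑ ^ 2

/-- The norm of `𝒟_ζ`: `‖f‖² = ‖f‖_{H²}² + 𝒟_ζ(f)`. -/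
noncomputable def dirichletNorm (ζ : ℂ) (f : ℂ → ℂ) : ℝ :=
  Real.sqrt (hardyNormSq f + dirichletIntegral ζ f).toReal

/-! Both spaces consist of the functions F = c + (z - ζ)G with c constant and G in H², and both
squared norms equal ‖F‖² + ‖G‖². The theorem is the comparison of these two descriptions.

The space ℋ(b). Put T = T_b and A = T_ā. The symbols are analytic and |a|² + |b|² = 1, so T*T + AA*
= 1 (`IsPair.star_mul_add`), that is, W : m ↦ (Tm, A*m) is an isometry of H² into H² ⊕ H². Let R(p,
q) be the first coordinate of the projection of (p, q) to ker W*. Then RR* = 1 - TT*, so R and (1 -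
TT*)^{1/2} have the same range and the same range norm, by Douglas' argument
(`exists_preimage_of_comp_adjoint_eq`). Hence F ∈ ℋ(b) exactly when T_b̄ F = T_ā G for some G, and,
as T_ā is injective here, the squared norm is ‖F‖² + ‖G‖². The explicit pair is b = √r z/(1 - rζ̄z),
a = √r(1 - ζ̄z)/(1 - rζ̄z), with r chosen so that |a|² + |b|² = 1. On the circle b̄(z - ζ) = ā, and
ker T_b̄ is the constants, so the equation says F = c + (z - ζ)G (`star_toeplitz_pair_eq_iff`). Any
pair with the given quotient has this b: the quotient determines |a| on the circle, hence the outer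
function a (`pair_unique`).

The space 𝒟_ζ. What is needed is 𝒟_ζ(c + (z - ζ)G) = ‖G‖², and that finiteness of 𝒟_ζ(f) produces
such a G. For |ζ| < 1, the involution φ of the disk exchanging 0 and ζ turns ω_ζ into a multiple of
-2 log|w|, and G into a weighted composition with φ of the same norm; the claim becomes the
Littlewood–Paley formula. For |ζ| = 1, |f'|²ω_ζ = |f'/(ζ - z)|²(1 - |z|²) has a radial weight, so
the integral is a weighted sum of squared Taylor coefficients. With γ_n = ζ^{n+1}G_n these
coefficients have the moduli of D_n = ∑_{k≤n} (k+1)(γ_k - γ_{k+1}), and ∑|D_n|²/((n+1)(n+2))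
telescopes to ∑|γ_n|² (`hasSum_hardyDiff`). Conversely, if the weighted sum is finite, the Cesàro
means of γ converge fast enough that γ minus their limit is square summable
(`exists_summable_sub_const`). -/

/-! ### Power series on the unit disk -/

/-- `f(z) = ∑ uₙ zⁿ` on the unit disk. -/
def HasTaylor (f : ℂ → ℂ) (u : ℕ → ℂ) : Prop :=
  ∀ z ∈ ball (0 : ℂ) 1, HasSum (fun n => u n * z ^ n) (f z)

namespace HasTaylor

variable {f g : ℂ → ℂ} {u v : ℕ → ℂ}

/-- Convergence at a real point r < 1 makes the terms there tend to 0, which bounds the radius of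
convergence below by r. -/
theorem hasFPowerSeriesOnBall (h : HasTaylor f u) :
    HasFPowerSeriesOnBall f (FormalMultilinearSeries.ofScalars ℂ u) 0 1 := by
  refine ⟨?_, one_pos, ?_⟩
  · refine ENNReal.le_of_forall_nnreal_lt fun r hr => ?_
    have hr' : r < 1 := by exact_mod_cast hr
    refine FormalMultilinearSeries.le_radius_of_tendsto (l := 0) _ ?_
    have h1 := (h (r : ℂ) (by simpa using hr')).summable.tendsto_atTop_zero.norm
    simpa [FormalMultilinearSeries.ofScalars_norm] using h1
  · intro y hy
    have hy' : y ∈ ball (0 : ℂ) 1 := by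
      rw [mem_ball_zero_iff]
      simpa [enorm_eq_nnnorm, ← NNReal.coe_lt_coe] using hy
    simpa [FormalMultilinearSeries.ofScalars_apply_eq, mul_comm] using h y hy'

theorem differentiableOn (h : HasTaylor f u) : DifferentiableOn ℂ f (ball 0 1) := by
  have := h.hasFPowerSeriesOnBall.differentiableOn
  rwa [show (1 : ℝ≥0∞) = ENNReal.ofReal 1 by simp, Metric.eball_ofReal] at this

theorem iteratedDeriv_div (h : HasTaylor f u) (n : ℕ) :
    iteratedDeriv n f 0 / (n.factorial : ℂ) = u n := by
  have h1 := h.hasFPowerSeriesOnBall.factorial_smul 1 n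
  rw [iteratedDeriv_eq_iteratedFDeriv, ← h1]
  simp [mul_div_assoc]
  field_simp [Nat.factorial_ne_zero]

theorem of_differentiableOn (h : DifferentiableOn ℂ f (ball 0 1)) :
    HasTaylor f fun n => iteratedDeriv n f 0 / (n.factorial : ℂ) := by
  intro z hz
  have := Complex.hasSum_taylorSeries_on_ball h hz
  refine this.congr_fun ?_
  intro n
  simp [div_eq_inv_mul]
  ring

theorem congr (h : HasTaylor f u) (hfg : Set.EqOn g f (ball 0 1)) : HasTaylor g u :=
  fun z hz => by rw [hfg hz]; exact h z hz

theorem unique (h : HasTaylor f u) (h' : HasTaylor g v) (hfg : Set.EqOn f g (ball 0 1)) : u = v := by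
  funext n
  rw [← h.iteratedDeriv_div, ← (h'.congr hfg).iteratedDeriv_div]

theorem eqOn (h : HasTaylor f u) (h' : HasTaylor g u) : Set.EqOn f g (ball 0 1) :=
  fun z hz => (h z hz).unique (h' z hz)

theorem hardyNormSq_eq (h : HasTaylor f u) : hardyNormSq f = ∑' n, ‖u n‖ₑ ^ 2 := by
  simp_rw [hardyNormSq, h.iteratedDeriv_div]

theorem summable_norm (h : HasTaylor f u) {z : ℂ} (hz : z ∈ ball (0 : ℂ) 1) :
    Summable fun n => ‖u n * z ^ n‖ :=
  (h z hz).summable.norm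

theorem add (h : HasTaylor f u) (h' : HasTaylor g v) : HasTaylor (f + g) (u + v) := fun z hz => by
  simpa [add_mul] using (h z hz).add (h' z hz)

theorem const_mul (h : HasTaylor f u) (c : ℂ) :
    HasTaylor (fun z => c * f z) (fun n => c * u n) := fun z hz => by
  simpa [mul_assoc] using (h z hz).mul_left c

theorem id_mul (h : HasTaylor f u) :
    HasTaylor (fun z => z * f z) (fun n => n.casesOn 0 u) := fun z hz => by
  rw [← hasSum_nat_add_iff' 1]
  simpa [pow_succ, mul_assoc, mul_comm, mul_left_comm] using (h z hz).mul_left z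

theorem const (c : ℂ) : HasTaylor (fun _ => c) (fun n => n.casesOn c 0) := fun z hz => by
  have := hasSum_single (f := fun n : ℕ => (n.casesOn c 0 : ℂ) * z ^ n) 0
    (by intro n hn; cases n <;> simp_all)
  simpa using this

theorem mul (h : HasTaylor f u) (h' : HasTaylor g v) :
    HasTaylor (fun z => f z * g z)
      (fun n => ∑ k ∈ Finset.range (n + 1), u k * v (n - k)) := fun z hz => by
  have := hasSum_sum_range_mul_of_summable_norm (h.summable_norm hz) (h'.summable_norm hz)
  rw [(h z hz).tsum_eq, (h' z hz).tsum_eq] at this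
  refine this.congr_fun fun n => ?_
  rw [Finset.sum_mul]
  refine Finset.sum_congr rfl fun k hk => ?_
  have hk : k ≤ n := by simpa [Nat.lt_succ_iff] using hk
  rw [mul_mul_mul_comm, ← pow_add, Nat.add_sub_cancel' hk]

theorem deriv (h : HasTaylor f u) :
    HasTaylor (deriv f) (fun n => (n + 1) * u (n + 1)) := by
  have hd : DifferentiableOn ℂ (_root_.deriv f) (ball 0 1) :=
    h.differentiableOn.deriv isOpen_ball
  have h1 := of_differentiableOn hd
  convert h1 using 2 with n
  rw [← iteratedDeriv_succ', ← h.iteratedDeriv_div (n + 1), Nat.factorial_succ]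
  push_cast
  have : ((n : ℂ) + 1) ≠ 0 := by exact_mod_cast n.succ_ne_zero
  have : (n.factorial : ℂ) ≠ 0 := by exact_mod_cast n.factorial_ne_zero
  field_simp

/-- The case |w| = 1 is included because it is needed when ζ is on the circle. -/
theorem geom {w : ℂ} (hw : ‖w‖ ≤ 1) : HasTaylor (fun z => (1 - w * z)⁻¹) (fun n => w ^ n) :=
  fun z hz => by
    have hz' : ‖z‖ < 1 := by simpa using hz
    have : ‖w * z‖ < 1 := by
      rw [norm_mul]; nlinarith [norm_nonneg w, norm_nonneg z]
    simpa [mul_pow] using hasSum_geometric_of_norm_lt_one this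

end HasTaylor

/-! ### The monomial basis of `H²` -/

theorem fourierCoeff_eq_inner (f : Lp ℂ 2 arcMeasure) (n : ℤ) :
    fourierCoeff f n = inner ℂ (fourierLp (T := (1 : ℝ)) 2 n) f := by
  rw [← fourierBasis_repr, HilbertBasis.repr_apply_apply, coe_fourierBasis]

theorem fourierLp_mem_hardyTwo (n : ℕ) : fourierLp (T := (1 : ℝ)) 2 (n : ℤ) ∈ hardyTwo := by
  intro m hm
  rw [fourierCoeff_eq_inner, orthonormal_iff_ite.1 orthonormal_fourier, if_neg (by omega)]

theorem eq_of_fourierCoeff_eq {f g : Lp ℂ 2 arcMeasure}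
    (h : ∀ n, fourierCoeff f n = fourierCoeff g n) : f = g := by
  refine (fourierBasis (T := (1 : ℝ))).repr.injective (lp.ext (funext fun n => ?_))
  rw [fourierBasis_repr, fourierBasis_repr, h]

/-- The orthonormal basis `1, z, z², …` of `H²`. -/
noncomputable def hardyBasis : HilbertBasis ℕ ℂ hardyTwo :=
  HilbertBasis.mkOfOrthogonalEqBot
    (v := fun n : ℕ => (⟨fourierLp 2 (n : ℤ), fourierLp_mem_hardyTwo n⟩ : hardyTwo))
    (by
      rw [orthonormal_iff_ite]
      intro i j
      have := orthonormal_iff_ite.1 (orthonormal_fourier (T := (1 : ℝ))) i j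
      simpa using this)
    (by
      rw [Submodule.eq_bot_iff]
      intro F hF
      refine Subtype.ext (eq_of_fourierCoeff_eq fun n => ?_)
      rw [Submodule.coe_zero, fourierCoeff_eq_inner, fourierCoeff_eq_inner, inner_zero_right]
      rcases lt_or_ge n 0 with hn | hn
      · rw [← fourierCoeff_eq_inner]; exact F.2 n hn
      · obtain ⟨m, rfl⟩ := Int.eq_ofNat_of_zero_le hn
        exact (Submodule.mem_orthogonal _ _).1 hF
          (⟨fourierLp 2 (m : ℤ), fourierLp_mem_hardyTwo m⟩ : hardyTwo)
          (Submodule.subset_span ⟨m, rfl⟩))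

theorem coe_hardyBasis (n : ℕ) :
    ((hardyBasis n : hardyTwo) : Lp ℂ 2 arcMeasure) = fourierLp 2 (n : ℤ) := by
  rw [hardyBasis, HilbertBasis.coe_mkOfOrthogonalEqBot]

theorem hardyBasis_repr (F : hardyTwo) (n : ℕ) :
    hardyBasis.repr F n = fourierCoeff (F : Lp ℂ 2 arcMeasure) n := by
  rw [HilbertBasis.repr_apply_apply, fourierCoeff_eq_inner, Submodule.coe_inner, coe_hardyBasis]

theorem hardyTwo_ext {F G : hardyTwo}
    (h : ∀ n : ℕ, fourierCoeff (F : Lp ℂ 2 arcMeasure) n =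
      fourierCoeff (G : Lp ℂ 2 arcMeasure) n) : F = G :=
  hardyBasis.repr.injective (lp.ext (funext fun n => by
    rw [hardyBasis_repr, hardyBasis_repr, h]))

theorem hasSum_norm_sq_coeff (F : hardyTwo) :
    HasSum (fun n : ℕ => ‖fourierCoeff (F : Lp ℂ 2 arcMeasure) n‖ ^ 2) (‖F‖ ^ 2) := by
  have h := lp.hasSum_norm (p := 2) (by norm_num) (hardyBasis.repr F)
  simpa [hardyBasis_repr] using h

theorem exists_hardyTwo_of_summable {u : ℕ → ℂ} (hu : Summable fun n => ‖u n‖ ^ 2) :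
    ∃ F : hardyTwo, ∀ n : ℕ, fourierCoeff (F : Lp ℂ 2 arcMeasure) n = u n := by
  have hm : Memℓp u 2 := by
    refine memℓp_gen ?_
    simpa using hu
  refine ⟨hardyBasis.repr.symm ⟨u, hm⟩, fun n => ?_⟩
  rw [← hardyBasis_repr, LinearIsometryEquiv.apply_symm_apply]

/-! ### Point evaluations -/

theorem norm_fourierCoeff_le_of_ae_bound {f : Torus → ℂ} {C : ℝ}
    (h : ∀ᵐ t ∂arcMeasure, ‖f t‖ ≤ C) (n : ℤ) : ‖fourierCoeff f n‖ ≤ C := by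
  have := norm_integral_le_of_norm_le_const (μ := arcMeasure)
    (f := fun t : Torus => fourier (-n) t • f t) (C := C)
    (h.mono fun t ht => by rwa [norm_smul, fourier_apply, Circle.norm_coe, one_mul])
  simpa [fourierCoeff] using this

theorem summable_mul_pow_of_bounded {u : ℕ → ℂ} {C : ℝ} (hu : ∀ n, ‖u n‖ ≤ C) {z : ℂ}
    (hz : ‖z‖ < 1) : Summable fun n => u n * z ^ n := by
  refine Summable.of_norm_bounded (g := fun n => C * ‖z‖ ^ n)
    ((summable_geometric_of_lt_one (norm_nonneg z) hz).mul_left C) fun n => ?_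
  rw [norm_mul, norm_pow]
  gcongr
  exact hu n

theorem hasTaylor_diskValue_of_bounded {f : Torus → ℂ} {C : ℝ}
    (h : ∀ n : ℕ, ‖fourierCoeff f n‖ ≤ C) :
    HasTaylor (diskValue f) fun n => fourierCoeff f n := fun z hz =>
  (summable_mul_pow_of_bounded h (by simpa using hz)).hasSum

theorem hasTaylor_diskValue_hardyTwo (F : hardyTwo) :
    HasTaylor (diskValue (F : Lp ℂ 2 arcMeasure))
      fun n => fourierCoeff (F : Lp ℂ 2 arcMeasure) n := by
  refine hasTaylor_diskValue_of_bounded (C := ‖F‖) fun n => ?_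
  refine abs_le_of_sq_le_sq' ?_ (norm_nonneg _) |>.2
  exact le_hasSum (hasSum_norm_sq_coeff F) n fun _ _ => by positivity

theorem ae_norm_le_norm_Lp_top (ψ : Lp ℂ ∞ arcMeasure) : ∀ᵐ t ∂arcMeasure, ‖ψ t‖ ≤ ‖ψ‖ := by
  have h := ae_le_eLpNormEssSup (f := (ψ : Torus → ℂ)) (μ := arcMeasure)
  filter_upwards [h] with t ht
  rw [Lp.norm_def, eLpNorm_exponent_top]
  have hfin : eLpNormEssSup (ψ : Torus → ℂ) arcMeasure ≠ ∞ := by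
    rw [← eLpNorm_exponent_top]; exact Lp.eLpNorm_ne_top ψ
  simpa using ENNReal.toReal_mono hfin ht

theorem hasTaylor_diskValue_top (ψ : Lp ℂ ∞ arcMeasure) :
    HasTaylor (diskValue ψ) fun n => fourierCoeff ψ n :=
  hasTaylor_diskValue_of_bounded fun n =>
    norm_fourierCoeff_le_of_ae_bound (ae_norm_le_norm_Lp_top ψ) n

theorem hardyNormSq_diskValue (F : hardyTwo) :
    hardyNormSq (diskValue (F : Lp ℂ 2 arcMeasure)) = ENNReal.ofReal (‖F‖ ^ 2) := by
  have h := hasSum_norm_sq_coeff F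
  rw [(hasTaylor_diskValue_hardyTwo F).hardyNormSq_eq, ← h.tsum_eq,
    ENNReal.ofReal_tsum_of_nonneg (fun _ => by positivity) h.summable]
  refine tsum_congr fun n => ?_
  rw [ENNReal.ofReal_pow (norm_nonneg _), ofReal_norm]

theorem exists_hardyTwo_of_hardyNormSq_lt_top {f : ℂ → ℂ}
    (hf : DifferentiableOn ℂ f (ball 0 1)) (h : hardyNormSq f < ∞) :
    ∃ F : hardyTwo, Set.EqOn (diskValue (F : Lp ℂ 2 arcMeasure)) f (ball 0 1) := by
  have hT := HasTaylor.of_differentiableOn hf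
  have hs : Summable fun n => ‖iteratedDeriv n f 0 / (n.factorial : ℂ)‖ ^ 2 := by
    have := ENNReal.summable_toReal h.ne
    simpa using this
  obtain ⟨F, hF⟩ := exists_hardyTwo_of_summable hs
  refine ⟨F, HasTaylor.eqOn ?_ hT⟩
  simpa only [hF] using hasTaylor_diskValue_hardyTwo F

/-- The Szegő kernel at a point of the disk: it represents evaluation there. -/
theorem exists_szegoKernel {w : ℂ} (hw : w ∈ ball (0 : ℂ) 1) :
    ∃ K : hardyTwo, (∀ n : ℕ, fourierCoeff (K : Lp ℂ 2 arcMeasure) n = conj w ^ n) ∧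
      ∀ F : hardyTwo, inner ℂ K F = diskValue (F : Lp ℂ 2 arcMeasure) w := by
  have hw' : ‖w‖ < 1 := by simpa using hw
  obtain ⟨K, hK⟩ := exists_hardyTwo_of_summable (u := fun n => conj w ^ n) (by
    have : ‖w‖ ^ 2 < 1 := by nlinarith [norm_nonneg w]
    refine (summable_geometric_of_lt_one (by positivity) this).congr fun n => ?_
    rw [norm_pow, RCLike.norm_conj, ← pow_mul, ← pow_mul, mul_comm])
  refine ⟨K, hK, fun F => ?_⟩
  rw [← (hardyBasis.repr).inner_map_map, lp.inner_eq_tsum, diskValue]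
  refine tsum_congr fun n => ?_
  rw [hardyBasis_repr, hardyBasis_repr, hK]
  simp

/-! ### Toeplitz operators with analytic symbols -/

theorem coeFn_mulLp (ψ : Lp ℂ ∞ arcMeasure) (f : Lp ℂ 2 arcMeasure) :
    mulLp ψ f =ᵐ[arcMeasure] fun t => ψ t * f t :=
  (ContinuousLinearMap.mul ℂ ℂ).coeFn_holder (r := 2) ψ f

theorem fourierCoeff_mul_fourier (f : Torus → ℂ) (k n : ℤ) :
    fourierCoeff (fun t => f t * fourier k t) n = fourierCoeff f (n - k) := by
  refine integral_congr_ae (Filter.Eventually.of_forall fun t => ?_)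
  have : (fourier (-(n - k)) t : ℂ) = fourier (-n) t * fourier k t := by
    rw [← fourier_add]; congr 1; ring_nf
  simp only [smul_eq_mul, this]
  ring

theorem fourierCoeff_mulLp_fourierLp (ψ : Lp ℂ ∞ arcMeasure) (k n : ℤ) :
    fourierCoeff (mulLp ψ (fourierLp 2 k)) n = fourierCoeff ψ (n - k) := by
  rw [← fourierCoeff_mul_fourier]
  refine congrFun (fourierCoeff_congr_ae ?_) n
  filter_upwards [coeFn_mulLp ψ (fourierLp 2 k), coeFn_fourierLp (T := (1 : ℝ)) 2 k] with t h1 h2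
  rw [h1, h2]

theorem hasSum_mulLp (ψ : Lp ℂ ∞ arcMeasure) (F : hardyTwo) :
    HasSum (fun n : ℕ => fourierCoeff (F : Lp ℂ 2 arcMeasure) n • mulLp ψ (fourierLp 2 (n : ℤ)))
      (mulLp ψ F) := by
  have h := (mulLp ψ ∘L hardyTwo.subtypeL).hasSum (hardyBasis.hasSum_repr F)
  simpa only [ContinuousLinearMap.comp_apply, map_smul, hardyBasis_repr, Submodule.subtypeL_apply,
    coe_hardyBasis] using h

/-- H² is closed, so it is enough to treat the monomials, where multiplication only shifts the
coefficients of ψ to the right. -/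
theorem mulLp_mem_hardyTwo {ψ : Lp ℂ ∞ arcMeasure} (hψ : IsHardyInfty ψ) (F : hardyTwo) :
    mulLp ψ F ∈ hardyTwo := by
  refine isClosed_hardyTwo.mem_of_tendsto (hasSum_mulLp ψ F)
    (Filter.Eventually.of_forall fun s => ?_)
  refine Submodule.sum_mem _ fun k _ => Submodule.smul_mem _ _ fun n hn => ?_
  rw [fourierCoeff_mulLp_fourierLp]
  exact hψ _ (by omega)

theorem coe_toeplitz {ψ : Lp ℂ ∞ arcMeasure} (hψ : IsHardyInfty ψ) (F : hardyTwo) :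
    (toeplitz ψ F : Lp ℂ 2 arcMeasure) = mulLp ψ F :=
  Submodule.orthogonalProjectionOnto_mem_subspace_eq_self
    (⟨mulLp ψ F, mulLp_mem_hardyTwo hψ F⟩ : hardyTwo) |> congrArg Subtype.val

theorem coeFn_toeplitz {ψ : Lp ℂ ∞ arcMeasure} (hψ : IsHardyInfty ψ) (F : hardyTwo) :
    (toeplitz ψ F : Lp ℂ 2 arcMeasure) =ᵐ[arcMeasure] fun t => ψ t * (F : Lp ℂ 2 arcMeasure) t := by
  rw [coe_toeplitz hψ]; exact coeFn_mulLp ψ F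

/-- For a monomial F the Taylor coefficients of ψ are shifted. The general case follows because
evaluation at w is continuous, being the inner product with the Szegő kernel. -/
theorem diskValue_toeplitz {ψ : Lp ℂ ∞ arcMeasure} (hψ : IsHardyInfty ψ) (F : hardyTwo)
    {w : ℂ} (hw : w ∈ ball (0 : ℂ) 1) :
    diskValue (toeplitz ψ F : Lp ℂ 2 arcMeasure) w =
      diskValue ψ w * diskValue (F : Lp ℂ 2 arcMeasure) w := by
  obtain ⟨K, -, hK⟩ := exists_szegoKernel hw
  have hbasis (k : ℕ) : diskValue (toeplitz ψ (hardyBasis k) : Lp ℂ 2 arcMeasure) w =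
      diskValue ψ w * w ^ k := by
    have h1 := hasTaylor_diskValue_hardyTwo (toeplitz ψ (hardyBasis k)) w hw
    simp only [coe_toeplitz hψ, coe_hardyBasis, fourierCoeff_mulLp_fourierLp] at h1
    rw [coe_toeplitz hψ, coe_hardyBasis]
    refine h1.unique ?_
    rw [← hasSum_nat_add_iff' k, Finset.sum_eq_zero, sub_zero]
    · refine ((hasTaylor_diskValue_top ψ w hw).mul_right (w ^ k)).congr_fun fun n => ?_
      simp [pow_add, mul_assoc]
    · intro i hi
      rw [hψ _ (by simpa using hi), zero_mul]
  have h := (innerSL ℂ K ∘L toeplitz ψ).hasSum (hardyBasis.hasSum_repr F)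
  simp only [ContinuousLinearMap.comp_apply, map_smul, hardyBasis_repr, innerSL_apply_apply, hK,
    hbasis, smul_eq_mul] at h
  refine h.unique ?_
  refine ((hasTaylor_diskValue_hardyTwo F w hw).mul_left (diskValue ψ w)).congr_fun fun n => ?_
  ring

theorem coeFn_star_top (ψ : Lp ℂ ∞ arcMeasure) :
    (star ψ : Lp ℂ ∞ arcMeasure) =ᵐ[arcMeasure] fun t => conj (ψ t) :=
  Lp.coeFn_star ψ

theorem inner_mulLp_star (ψ : Lp ℂ ∞ arcMeasure) (f g : Lp ℂ 2 arcMeasure) :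
    inner ℂ (mulLp (star ψ) f) g = inner ℂ f (mulLp ψ g) := by
  rw [L2.inner_def, L2.inner_def]
  refine integral_congr_ae ?_
  filter_upwards [coeFn_mulLp (star ψ) f, coeFn_mulLp ψ g, coeFn_star_top ψ] with t h1 h2 h3
  rw [h1, h2, h3]
  simp
  ring

theorem toeplitz_star (ψ : Lp ℂ ∞ arcMeasure) :
    toeplitz (star ψ) = ContinuousLinearMap.adjoint (toeplitz ψ) := by
  rw [ContinuousLinearMap.eq_adjoint_iff]
  intro F G
  simp only [toeplitz, ContinuousLinearMap.comp_apply, Submodule.subtypeL_apply]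
  rw [Submodule.inner_orthogonalProjectionOnto_eq_of_mem_right, inner_mulLp_star,
    Submodule.inner_orthogonalProjectionOnto_eq_of_mem_left]

theorem norm_sq_eq_integral (f : Lp ℂ 2 arcMeasure) :
    ‖f‖ ^ 2 = ∫ t, ‖f t‖ ^ 2 ∂arcMeasure := by
  have h := congrArg Complex.re (L2.inner_def (𝕜 := ℂ) f f)
  rw [inner_self_eq_norm_sq_to_K] at h
  have h2 : ∀ t, inner ℂ (f t) (f t) = ((‖f t‖ ^ 2 : ℝ) : ℂ) := fun t => by
    rw [inner_self_eq_norm_sq_to_K]; simp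
  simp only [h2] at h
  exact_mod_cast h

theorem integrable_norm_sq (f : Lp ℂ 2 arcMeasure) :
    Integrable (fun t => ‖f t‖ ^ 2) arcMeasure :=
  (Lp.memLp f).integrable_norm_pow (by norm_num)

/-! ### Rational symbols -/

theorem norm_toCircle (t : Torus) : ‖(AddCircle.toCircle t : ℂ)‖ = 1 := Circle.norm_coe _

theorem continuous_toCircle_coe : Continuous fun t : Torus => (AddCircle.toCircle t : ℂ) :=
  continuous_subtype_val.comp AddCircle.continuous_toCircle

theorem one_sub_norm_le {w x : ℂ} (hx : ‖x‖ ≤ 1) : 1 - ‖w‖ ≤ ‖1 - w * x‖ := by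
  have h1 : ‖w * x‖ ≤ ‖w‖ := by
    rw [norm_mul]; exact mul_le_of_le_one_right (norm_nonneg w) hx
  have h2 := norm_sub_norm_le (1 : ℂ) (w * x)
  rw [norm_one] at h2
  linarith

theorem one_sub_mul_ne_zero {w x : ℂ} (hw : ‖w‖ < 1) (hx : ‖x‖ ≤ 1) : 1 - w * x ≠ 0 := by
  rw [← norm_pos_iff]
  exact (sub_pos.2 hw).trans_le (one_sub_norm_le hx)

theorem memLp_geomSymbol {w : ℂ} (hw : ‖w‖ < 1) :
    MemLp (fun t : Torus => (AddCircle.toCircle t : ℂ) / (1 - w * AddCircle.toCircle t)) ∞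
      arcMeasure := by
  have hc := continuous_toCircle_coe
  have : Continuous fun t : Torus =>
      (AddCircle.toCircle t : ℂ) / (1 - w * AddCircle.toCircle t) :=
    hc.div (continuous_const.sub (continuous_const.mul hc))
      fun t => one_sub_mul_ne_zero hw (norm_toCircle t).le
  refine memLp_top_of_bound this.aestronglyMeasurable (1 - ‖w‖)⁻¹
    (Filter.Eventually.of_forall fun t => ?_)
  rw [norm_div, norm_toCircle, one_div]
  exact inv_anti₀ (sub_pos.2 hw) (one_sub_norm_le (norm_toCircle t).le)

/-- The symbol `λ / (1 - w λ)`, for `|w| < 1`. -/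
noncomputable def geomSymbol (w : ℂ) (hw : ‖w‖ < 1) : Lp ℂ ∞ arcMeasure :=
  (memLp_geomSymbol hw).toLp

theorem coeFn_geomSymbol {w : ℂ} (hw : ‖w‖ < 1) :
    geomSymbol w hw =ᵐ[arcMeasure]
      fun t => (AddCircle.toCircle t : ℂ) / (1 - w * AddCircle.toCircle t) :=
  (memLp_geomSymbol hw).coeFn_toLp

/-- The geometric series for the symbol is integrated term by term. The index m ranges over all
integers, so that this one sum gives both the vanishing for m < 0 and the Taylor coefficients. -/
theorem hasSum_fourierCoeff_geomSymbol {w : ℂ} (hw : ‖w‖ < 1) (m : ℤ) :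
    HasSum (fun n : ℕ => w ^ n * (if m = n + 1 then 1 else 0)) (fourierCoeff (geomSymbol w hw) m) := by
  have key : HasSum (fun n : ℕ => ∫ t : Torus, w ^ n * (fourier (-m) t * fourier (n + 1) t) ∂arcMeasure)
      (∫ t : Torus, ∑' n : ℕ, w ^ n * (fourier (-m) t * fourier (n + 1) t) ∂arcMeasure) := by
    refine hasSum_integral_of_summable_integral_norm (fun n => ?_) ?_
    · exact Continuous.integrable_of_hasCompactSupport (by fun_prop)
        (HasCompactSupport.of_compactSpace _)
    · have : ∀ (n : ℕ) (t : Torus), ‖w ^ n * (fourier (-m) t * fourier (n + 1) t)‖ = ‖w‖ ^ n :=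
        fun n t => by simp only [norm_mul, norm_pow, fourier_apply, Circle.norm_coe, mul_one]
      simp only [this]
      simpa using summable_geometric_of_lt_one (norm_nonneg w) hw
  convert key using 1
  · funext n
    rw [integral_const_mul]
    have h := congrFun (fourierCoeff_fourier (T := (1 : ℝ)) (n + 1)) m
    simp only [fourierCoeff, smul_eq_mul] at h
    rw [h, Pi.single_apply]
  · refine integral_congr_ae ?_
    filter_upwards [coeFn_geomSymbol hw] with t ht
    have hs := hasSum_geometric_of_norm_lt_one (ξ := w * AddCircle.toCircle t)
      (by rwa [norm_mul, norm_toCircle, mul_one])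
    rw [ht, smul_eq_mul, div_eq_mul_inv, ← hs.tsum_eq, ← tsum_mul_left, ← tsum_mul_left]
    refine tsum_congr fun n => ?_
    have : (fourier ((n : ℤ) + 1) t : ℂ) = (AddCircle.toCircle t : ℂ) ^ (n + 1) := by
      rw [fourier_apply, show ((n : ℤ) + 1) = ((n + 1 : ℕ) : ℤ) by push_cast; rfl, natCast_zsmul,
        AddCircle.toCircle_nsmul, Circle.coe_pow]
    rw [this, mul_pow]
    ring

theorem isHardyInfty_geomSymbol {w : ℂ} (hw : ‖w‖ < 1) : IsHardyInfty (geomSymbol w hw) := by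
  intro m hm
  refine (hasSum_fourierCoeff_geomSymbol hw m).unique ?_
  have : (fun n : ℕ => w ^ n * (if m = n + 1 then 1 else 0 : ℂ)) = fun _ => 0 := by
    funext n
    rw [if_neg (by omega), mul_zero]
  rw [this]
  exact hasSum_zero

theorem fourierCoeff_geomSymbol {w : ℂ} (hw : ‖w‖ < 1) (m : ℕ) :
    fourierCoeff (geomSymbol w hw) m = Nat.casesOn m 0 fun n => w ^ n := by
  refine (hasSum_fourierCoeff_geomSymbol hw m).unique ?_
  cases m with
  | zero =>
    have : (fun n : ℕ => w ^ n * (if ((0 : ℕ) : ℤ) = n + 1 then 1 else 0 : ℂ)) = fun _ => 0 := by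
      funext n
      rw [if_neg (by omega), mul_zero]
    rw [this]
    exact hasSum_zero
  | succ k =>
    convert hasSum_ite_eq k (w ^ k) using 2 with n
    by_cases h : n = k
    · subst h; simp
    · rw [if_neg (by push_cast; omega), if_neg h, mul_zero]

theorem diskValue_geomSymbol {w z : ℂ} (hw : ‖w‖ < 1) (hz : z ∈ ball (0 : ℂ) 1) :
    diskValue (geomSymbol w hw) z = z / (1 - w * z) := by
  have h1 := hasTaylor_diskValue_top (geomSymbol w hw)
  simp only [fourierCoeff_geomSymbol] at h1
  rw [h1.eqOn (HasTaylor.geom hw.le).id_mul hz, div_eq_mul_inv]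

/-- The constant symbols. -/
noncomputable def constSymbol (c : ℂ) : Lp ℂ ∞ arcMeasure := Lp.const ∞ arcMeasure c

theorem coeFn_constSymbol (c : ℂ) : constSymbol c =ᵐ[arcMeasure] fun _ => c :=
  Lp.coeFn_const ..

theorem fourierCoeff_constSymbol (c : ℂ) (n : ℤ) :
    fourierCoeff (constSymbol c) n = if n = 0 then c else 0 := by
  have h1 : fourierCoeff (constSymbol c) n = fourierCoeff (fun t : Torus => c * fourier 0 t) n :=
    congrFun (fourierCoeff_congr_ae ((coeFn_constSymbol c).trans (by simp))) n
  rw [h1, fourierCoeff.const_mul, fourierCoeff_fourier, Pi.single_apply]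
  simp

theorem integrable_top (ψ : Lp ℂ ∞ arcMeasure) : Integrable ψ arcMeasure :=
  (Lp.memLp ψ).integrable le_top

theorem fourierCoeff_add_smul (φ ψ : Lp ℂ ∞ arcMeasure) (c : ℂ) (n : ℤ) :
    fourierCoeff (φ + c • ψ : Lp ℂ ∞ arcMeasure) n = fourierCoeff φ n + c * fourierCoeff ψ n := by
  have h : (φ + c • ψ : Lp ℂ ∞ arcMeasure) =ᵐ[arcMeasure] (φ : Torus → ℂ) + c • (ψ : Torus → ℂ) :=
    (Lp.coeFn_add _ _).trans ((Filter.EventuallyEq.refl _ _).add (Lp.coeFn_smul c ψ))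
  rw [fourierCoeff_congr_ae h, fourierCoeff.add (integrable_top φ) ((integrable_top ψ).smul c),
    Pi.add_apply]
  congr 1
  exact fourierCoeff.const_smul (ψ : Torus → ℂ) c n

theorem IsHardyInfty.add_smul {φ ψ : Lp ℂ ∞ arcMeasure} (hφ : IsHardyInfty φ)
    (hψ : IsHardyInfty ψ) (c : ℂ) : IsHardyInfty (φ + c • ψ) := fun n hn => by
  rw [fourierCoeff_add_smul, hφ n hn, hψ n hn, mul_zero, add_zero]

theorem isHardyInfty_constSymbol (c : ℂ) : IsHardyInfty (constSymbol c) := fun n hn => by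
  rw [fourierCoeff_constSymbol, if_neg hn.ne]

theorem coeFn_const_add_smul_geomSymbol (a c : ℂ) {w : ℂ} (hw : ‖w‖ < 1) :
    (constSymbol a + c • geomSymbol w hw : Lp ℂ ∞ arcMeasure) =ᵐ[arcMeasure]
      fun t => a + c * ((AddCircle.toCircle t : ℂ) / (1 - w * AddCircle.toCircle t)) := by
  filter_upwards [Lp.coeFn_add (constSymbol a) (c • geomSymbol w hw), coeFn_constSymbol a,
    Lp.coeFn_smul c (geomSymbol w hw), coeFn_geomSymbol hw] with t h1 h2 h3 h4
  rw [h1, Pi.add_apply, h2, h3, Pi.smul_apply, h4, smul_eq_mul]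

theorem isHardyInfty_const_add_smul_geomSymbol (a c : ℂ) {w : ℂ} (hw : ‖w‖ < 1) :
    IsHardyInfty (constSymbol a + c • geomSymbol w hw) :=
  (isHardyInfty_constSymbol a).add_smul (isHardyInfty_geomSymbol hw) c

theorem diskValue_const_add_smul_geomSymbol (a c : ℂ) {w z : ℂ} (hw : ‖w‖ < 1)
    (hz : z ∈ ball (0 : ℂ) 1) :
    diskValue (constSymbol a + c • geomSymbol w hw : Lp ℂ ∞ arcMeasure) z =
      a + c * (z / (1 - w * z)) := by
  have h1 := hasTaylor_diskValue_top (constSymbol a + c • geomSymbol w hw)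
  have h2 := (HasTaylor.const a).add ((HasTaylor.geom hw.le).id_mul.const_mul c)
  have h3 : (fun n : ℕ => fourierCoeff (constSymbol a + c • geomSymbol w hw : Lp ℂ ∞ arcMeasure) n) =
      (fun n : ℕ => (Nat.casesOn n a 0 : ℂ)) +
        fun n => c * (Nat.casesOn n 0 fun n => w ^ n : ℂ) := by
    funext n
    rw [fourierCoeff_add_smul, fourierCoeff_constSymbol, fourierCoeff_geomSymbol]
    cases n <;> simp
    intro h; omega
  rw [h3] at h1
  rw [h1.eqOn h2 hz, Pi.add_apply, div_eq_mul_inv]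

/-! ### Ranges of square roots of defect operators -/

section Douglas

variable {K E H : Type*} [NormedAddCommGroup K] [InnerProductSpace ℂ K] [CompleteSpace K]
  [NormedAddCommGroup E] [InnerProductSpace ℂ E] [CompleteSpace E]
  [NormedAddCommGroup H] [InnerProductSpace ℂ H] [CompleteSpace H]

open ContinuousLinearMap Filter Topology

/-- This makes P* u ↦ D* u a well-defined isometry between the ranges of the adjoints. -/
theorem norm_adjoint_eq_of_comp_adjoint_eq {P : K →L[ℂ] H} {D : E →L[ℂ] H}
    (h : P ∘L adjoint P = D ∘L adjoint D) (u : H) : ‖adjoint P u‖ = ‖adjoint D u‖ := by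
  have h1 : inner ℂ (adjoint P u) (adjoint P u) = inner ℂ (adjoint D u) (adjoint D u) := by
    rw [adjoint_inner_left, adjoint_inner_left]
    exact congrArg (inner ℂ u) (DFunLike.congr_fun h u)
  rw [inner_self_eq_norm_sq_to_K, inner_self_eq_norm_sq_to_K] at h1
  have h2 : ‖adjoint P u‖ ^ 2 = ‖adjoint D u‖ ^ 2 := by exact_mod_cast h1
  exact (sq_eq_sq₀ (norm_nonneg _) (norm_nonneg _)).1 h2

/-- If `P P* = D D*`, every vector in the range of `P` is in the range of `D`, with a preimage that
is orthogonal to the kernel and no longer. -/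
theorem exists_preimage_of_comp_adjoint_eq {P : K →L[ℂ] H} {D : E →L[ℂ] H}
    (h : P ∘L adjoint P = D ∘L adjoint D) (k : K) :
    ∃ x ∈ (LinearMap.ker (D : E →ₗ[ℂ] H))ᗮ, D x = P k ∧ ‖x‖ ≤ ‖k‖ := by
  -- P vanishes on the orthogonal complement of the range of P*, so k may be replaced by its
  -- projection k', which is a limit of vectors P* u_n.
  set M : Submodule ℂ K := (LinearMap.range (adjoint P : H →ₗ[ℂ] K)).topologicalClosure with hM
  have hMc : IsClosed (M : Set K) := Submodule.isClosed_topologicalClosure _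
  have : CompleteSpace M := hMc.completeSpace_coe
  set k' : K := M.starProjection k with hk'
  have hk'M : k' ∈ M := Submodule.starProjection_apply_mem M k
  have hPk : P k' = P k := by
    have h1 : k - k' ∈ Mᗮ := Submodule.sub_starProjection_mem_orthogonal k
    have h2 : P (k - k') = 0 := by
      refine ext_inner_left ℂ fun v => ?_
      rw [inner_zero_right, ← adjoint_inner_left]
      exact (Submodule.mem_orthogonal _ _).1 h1 _
        (Submodule.le_topologicalClosure _ ⟨v, rfl⟩)
    rw [map_sub, sub_eq_zero] at h2
    exact h2.symm
  have hk'k : ‖k'‖ ≤ ‖k‖ := Submodule.norm_starProjection_apply_le M k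
  obtain ⟨y, hy, hyk⟩ := mem_closure_iff_seq_limit.1 (show k' ∈ closure
    (LinearMap.range (adjoint P : H →ₗ[ℂ] K) : Set K) from hk'M)
  choose u hu using hy
  have hu' : ∀ n, adjoint P (u n) = y n := hu
  -- The isometry P* u ↦ D* u carries the Cauchy sequence P* u_n to D* u_n. The limit x of the
  -- latter is orthogonal to ker D, and D D* = P P* gives D x = P k'.
  have hcauchy : CauchySeq fun n => adjoint D (u n) := by
    have hc := hyk.cauchySeq
    rw [Metric.cauchySeq_iff] at hc ⊢
    intro ε hε
    obtain ⟨N, hN⟩ := hc ε hε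
    refine ⟨N, fun m hm n hn => ?_⟩
    have := hN m hm n hn
    rwa [← hu', ← hu', dist_eq_norm, ← map_sub, norm_adjoint_eq_of_comp_adjoint_eq h, map_sub,
      ← dist_eq_norm] at this
  obtain ⟨x, hx⟩ := cauchySeq_tendsto_of_complete hcauchy
  refine ⟨x, ?_, ?_, ?_⟩
  · rw [Submodule.mem_orthogonal]
    intro v hv
    have hlim : Tendsto (fun n => inner ℂ v (adjoint D (u n))) atTop (𝓝 (inner ℂ v x)) :=
      tendsto_const_nhds.inner hx
    refine tendsto_nhds_unique hlim ?_
    have : ∀ n, inner ℂ v (adjoint D (u n)) = 0 := fun n => by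
      rw [adjoint_inner_right, show D v = 0 from hv, inner_zero_left]
    simp [this]
  · rw [← hPk]
    have h1 : Tendsto (fun n => D (adjoint D (u n))) atTop (𝓝 (D x)) :=
      (D.continuous.tendsto x).comp hx
    have h2 : Tendsto (fun n => P (y n)) atTop (𝓝 (P k')) := (P.continuous.tendsto k').comp hyk
    refine tendsto_nhds_unique h1 (h2.congr fun n => ?_)
    rw [← hu']
    exact DFunLike.congr_fun h (u n)
  · refine le_trans (le_of_eq (tendsto_nhds_unique hx.norm ?_)) hk'k
    refine hyk.norm.congr fun n => ?_
    rw [← hu', norm_adjoint_eq_of_comp_adjoint_eq h]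

/-- The row operator `(x, y) ↦ P x + Q y` on the Hilbert sum. -/
noncomputable def rowOperator (P Q : H →L[ℂ] H) : WithLp 2 (H × H) →L[ℂ] H :=
  (P.coprod Q) ∘L (WithLp.prodContinuousLinearEquiv 2 ℂ H H : WithLp 2 (H × H) →L[ℂ] H × H)

theorem rowOperator_apply (P Q : H →L[ℂ] H) (v : WithLp 2 (H × H)) :
    rowOperator P Q v = P v.fst + Q v.snd := rfl

theorem adjoint_rowOperator_apply (P Q : H →L[ℂ] H) (u : H) :
    adjoint (rowOperator P Q) u = WithLp.toLp 2 (adjoint P u, adjoint Q u) := by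
  refine ext_inner_left ℂ fun v => ?_
  rw [adjoint_inner_right, WithLp.prod_inner_apply, rowOperator_apply, inner_add_left]
  simp [adjoint_inner_right]

variable {T A : H →L[ℂ] H}

/-- Over ℂ an operator is determined by its quadratic form. The double star is there because the
results below are applied with `star A` in the role of A. -/
theorem star_mul_self_add_eq_one (h : ∀ x, ‖T x‖ ^ 2 + ‖A x‖ ^ 2 = ‖x‖ ^ 2) :
    star T * T + star A * star (star A) = 1 := by
  rw [star_star, ← ContinuousLinearMap.coe_inj, ← ext_inner_map]
  intro x
  have h2 (B : H →L[ℂ] H) : inner ℂ (star B (B x)) x = ((‖B x‖ ^ 2 : ℝ) : ℂ) := by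
    rw [star_eq_adjoint, adjoint_inner_left, inner_self_eq_norm_sq_to_K]
    norm_cast
  simp only [coe_coe, add_apply, mul_apply_eq_comp, one_apply_eq_self, inner_add_left]
  rw [h2, h2, inner_self_eq_norm_sq_to_K, ← Complex.ofReal_add, h x]
  push_cast
  rfl

/-- Expand 1 - TT* = (1 - TT*)² + T(1 - T*T)T* and replace 1 - T*T by AA*. The result exhibits the
defect operator as RR* for a row operator R. -/
theorem defect_eq_row (hTA : star T * T + A * star A = 1) :
    1 - T * star T = (1 - T * star T) * star (1 - T * star T) + (T * A) * star (T * A) := by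
  have h : A * star A = 1 - star T * T := by rw [← hTA]; abel
  calc 1 - T * star T = (1 - T * star T) * (1 - T * star T) + T * (1 - star T * T) * star T := by
        noncomm_ring
    _ = _ := by
        rw [← h]
        simp only [star_sub, star_one, star_mul, star_star, mul_assoc]

theorem defect_nonneg (hTA : star T * T + A * star A = 1) : 0 ≤ 1 - T * star T := by
  rw [defect_eq_row hTA]
  exact add_nonneg (mul_star_self_nonneg _) (mul_star_self_nonneg _)

/-- The row sends (p, q) to p - T(T*p + Aq), the first coordinate of the projection of (p, q) to the
kernel of (p, q) ↦ T*p + Aq; this explains the minus sign on TA. -/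
theorem rowOperator_comp_adjoint (hTA : star T * T + A * star A = 1) :
    rowOperator (1 - T * star T) (-(T * A)) ∘L adjoint (rowOperator (1 - T * star T) (-(T * A))) =
      opSqrt (1 - T * star T) ∘L adjoint (opSqrt (1 - T * star T)) := by
  have h1 : opSqrt (1 - T * star T) ∘L adjoint (opSqrt (1 - T * star T)) = 1 - T * star T := by
    have hs : adjoint (opSqrt (1 - T * star T)) = opSqrt (1 - T * star T) :=
      (IsSelfAdjoint.of_nonneg (CFC.sqrt_nonneg (1 - T * star T)))
    rw [hs]
    exact CFC.sqrt_mul_sqrt_self _ (defect_nonneg hTA)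
  rw [h1]
  ext u
  rw [comp_apply, adjoint_rowOperator_apply, rowOperator_apply]
  conv_rhs => rw [defect_eq_row hTA]
  simp only [WithLp.toLp_fst, WithLp.toLp_snd, ← star_eq_adjoint, add_apply,
    mul_apply_eq_comp, neg_apply, neg_neg, map_neg]

/-- With `T* T + A A* = 1`, a vector `f` such that `T* f = A g` lies in the range of
`(1 - T T*)^{1/2}`. -/
theorem exists_preimage_opSqrt (hTA : star T * T + A * star A = 1) {f g : H}
    (hfg : star T f = A g) :
    ∃ x ∈ (LinearMap.ker (opSqrt (1 - T * star T) : H →ₗ[ℂ] H))ᗮ,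
      opSqrt (1 - T * star T) x = f ∧ ‖x‖ ^ 2 ≤ ‖f‖ ^ 2 + ‖g‖ ^ 2 := by
  -- The equation T*f = Ag says that (f, -g) lies in the kernel of (p, q) ↦ T*p + Aq, so the row
  -- operator sends it to f.
  obtain ⟨x, hx, hxk, hn⟩ := exists_preimage_of_comp_adjoint_eq (rowOperator_comp_adjoint hTA)
    (WithLp.toLp 2 (f, -g))
  refine ⟨x, hx, ?_, ?_⟩
  · rw [hxk, rowOperator_apply]
    simp only [sub_apply, one_apply_eq_self, mul_apply_eq_comp, neg_apply, map_neg, neg_neg,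
      WithLp.toLp_fst, WithLp.toLp_snd, hfg]
    abel
  · have h2 := pow_le_pow_left₀ (norm_nonneg x) hn 2
    rw [WithLp.prod_norm_sq_eq_of_L2] at h2
    simpa using h2

/-- Conversely every vector in the range of `(1 - T T*)^{1/2}` is of this form. -/
theorem exists_of_opSqrt (hTA : star T * T + A * star A = 1) (x : H) :
    ∃ g, star T (opSqrt (1 - T * star T) x) = A g ∧
      ‖opSqrt (1 - T * star T) x‖ ^ 2 + ‖g‖ ^ 2 ≤ ‖x‖ ^ 2 := by
  obtain ⟨v, -, hv, hn⟩ := exists_preimage_of_comp_adjoint_eq (rowOperator_comp_adjoint hTA).symm x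
  have hn2 := pow_le_pow_left₀ (norm_nonneg v) hn 2
  rw [WithLp.prod_norm_sq_eq_of_L2] at hn2
  rw [← hv, rowOperator_apply]
  set p := v.fst with hp
  set q := v.snd with hq
  -- Here m = W*(p, q) for the isometry W m = (Tm, A*m), and (p - Tm, q - A*m) is the projection of
  -- (p, q) to ker W*. Below, `e3` is the isometry property and `e4` is ⟨(p, q), Wm⟩ = ‖m‖²;
  -- together they give the contraction by ‖m‖².
  set m := star T p + A q with hm
  have hf : (1 - T * star T) p + (-(T * A)) q = p - T m := by
    simp only [hm, sub_apply, one_apply_eq_self, mul_apply_eq_comp, neg_apply, map_add]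
    abel
  have hone : star T (T m) + A (star A m) = m := DFunLike.congr_fun hTA m
  rw [hf]
  refine ⟨-(q - star A m), ?_, ?_⟩
  · have h3 : star T (T m) = m - A (star A m) := eq_sub_of_add_eq hone
    rw [map_sub, map_neg, map_sub, h3]
    simp only [hm, map_add]
    abel
  · rw [norm_neg]
    refine le_trans ?_ hn2
    have e1 := @norm_sub_sq ℂ _ _ _ _ p (T m)
    have e2 := @norm_sub_sq ℂ _ _ _ _ q (star A m)
    have e3 : ‖T m‖ ^ 2 + ‖star A m‖ ^ 2 = ‖m‖ ^ 2 := by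
      have h4 : inner ℂ (star T (T m) + A (star A m)) m = inner ℂ m m := by rw [hone]
      have h5 : inner ℂ (star T (T m)) m = inner ℂ (T m) (T m) := adjoint_inner_left T m (T m)
      have h6 : inner ℂ (A (star A m)) m = inner ℂ (star A m) (star A m) :=
        (adjoint_inner_right A _ _).symm
      rw [inner_add_left, h5, h6] at h4
      simp only [inner_self_eq_norm_sq_to_K] at h4
      exact_mod_cast h4
    have e4 : RCLike.re (inner ℂ p (T m)) + RCLike.re (inner ℂ q (star A m)) = ‖m‖ ^ 2 := by
      have h4 : inner ℂ p (T m) + inner ℂ q (star A m) = inner ℂ m m := by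
        conv_rhs => rw [hm, inner_add_left, ← hm]
        rw [star_eq_adjoint, star_eq_adjoint, adjoint_inner_left, adjoint_inner_right]
      rw [← map_add, h4, inner_self_eq_norm_sq_to_K]
      norm_cast
    have := sq_nonneg ‖m‖
    linarith

end Douglas

/-! ### The shift -/

theorem diskValue_add (F G : hardyTwo) {w : ℂ} (hw : w ∈ ball (0 : ℂ) 1) :
    diskValue ((F + G : hardyTwo) : Lp ℂ 2 arcMeasure) w =
      diskValue (F : Lp ℂ 2 arcMeasure) w + diskValue (G : Lp ℂ 2 arcMeasure) w := by
  obtain ⟨K, -, hK⟩ := exists_szegoKernel hw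
  rw [← hK, ← hK, ← hK, inner_add_right]

theorem diskValue_smul (c : ℂ) (F : hardyTwo) {w : ℂ} (hw : w ∈ ball (0 : ℂ) 1) :
    diskValue ((c • F : hardyTwo) : Lp ℂ 2 arcMeasure) w =
      c * diskValue (F : Lp ℂ 2 arcMeasure) w := by
  obtain ⟨K, -, hK⟩ := exists_szegoKernel hw
  rw [← hK, ← hK]
  exact inner_smul_right K F c

theorem hardyTwo_ext_diskValue {F G : hardyTwo}
    (h : Set.EqOn (diskValue (F : Lp ℂ 2 arcMeasure)) (diskValue (G : Lp ℂ 2 arcMeasure))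
      (ball 0 1)) : F = G :=
  hardyTwo_ext fun n => congrFun
    ((hasTaylor_diskValue_hardyTwo F).unique (hasTaylor_diskValue_hardyTwo G) h) n

theorem fourierCoeff_hardyBasis (k n : ℕ) :
    fourierCoeff ((hardyBasis k : hardyTwo) : Lp ℂ 2 arcMeasure) n = if n = k then 1 else 0 := by
  rw [← hardyBasis_repr, HilbertBasis.repr_apply_apply]
  exact orthonormal_iff_ite.1 hardyBasis.orthonormal n k

theorem diskValue_hardyBasis (k : ℕ) {z : ℂ} (hz : z ∈ ball (0 : ℂ) 1) :
    diskValue ((hardyBasis k : hardyTwo) : Lp ℂ 2 arcMeasure) z = z ^ k := by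
  have h := hasTaylor_diskValue_hardyTwo (hardyBasis k) z hz
  simp only [fourierCoeff_hardyBasis] at h
  refine h.unique ?_
  convert hasSum_ite_eq k (z ^ k) using 2 with n
  split_ifs with hn <;> simp [hn]

/-- The unilateral shift `F ↦ z F` on `H²`. -/
noncomputable def hardyShift : hardyTwo →L[ℂ] hardyTwo := toeplitz (geomSymbol 0 (by simp))

theorem diskValue_hardyShift (F : hardyTwo) {z : ℂ} (hz : z ∈ ball (0 : ℂ) 1) :
    diskValue (hardyShift F : Lp ℂ 2 arcMeasure) z =
      z * diskValue (F : Lp ℂ 2 arcMeasure) z := by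
  rw [hardyShift, diskValue_toeplitz (isHardyInfty_geomSymbol _) F hz, diskValue_geomSymbol _ hz]
  simp

theorem coeFn_hardyShift (F : hardyTwo) : (hardyShift F : Lp ℂ 2 arcMeasure) =ᵐ[arcMeasure]
    fun t => AddCircle.toCircle t * (F : Lp ℂ 2 arcMeasure) t := by
  filter_upwards [coeFn_toeplitz (isHardyInfty_geomSymbol (w := 0) (by simp)) F,
    coeFn_geomSymbol (w := 0) (by simp)] with t h1 h2
  rw [hardyShift, h1, h2]
  simp

theorem hardyShift_hardyBasis (n : ℕ) : hardyShift (hardyBasis n) = hardyBasis (n + 1) :=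
  hardyTwo_ext_diskValue fun z hz => by
    rw [diskValue_hardyShift _ hz, diskValue_hardyBasis _ hz, diskValue_hardyBasis _ hz, pow_succ']

theorem inner_hardyBasis (n : ℕ) (F : hardyTwo) :
    inner ℂ (hardyBasis n) F = fourierCoeff (F : Lp ℂ 2 arcMeasure) n := by
  rw [← hardyBasis_repr, HilbertBasis.repr_apply_apply]

theorem coeFn_hardyTwo_combination (F G : hardyTwo) (c : ℂ) :
    ((F + c • G : hardyTwo) : Lp ℂ 2 arcMeasure) =ᵐ[arcMeasure]
      fun t => (F : Lp ℂ 2 arcMeasure) t + c * (G : Lp ℂ 2 arcMeasure) t := by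
  filter_upwards [Lp.coeFn_add (F : Lp ℂ 2 arcMeasure) (c • (G : Lp ℂ 2 arcMeasure)),
    Lp.coeFn_smul c (G : Lp ℂ 2 arcMeasure)] with t h1 h2
  rw [Submodule.coe_add, Submodule.coe_smul, h1, Pi.add_apply, h2, Pi.smul_apply, smul_eq_mul]

/-! ### The operator identity of a pair -/

/-- For analytic symbols the Toeplitz operators are plain multiplications, so ‖T_b F‖² + ‖T_a F‖² =
‖F‖² by integrating |a|² + |b|² = 1 against |F|². -/
theorem IsPair.star_mul_add {b a : Lp ℂ ∞ arcMeasure} (h : IsPair b a) :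
    star (toeplitz b) * toeplitz b + star (toeplitz a) * star (star (toeplitz a)) = 1 := by
  refine star_mul_self_add_eq_one fun F => ?_
  simp only [Submodule.coe_norm, coe_toeplitz h.hardy_b, coe_toeplitz h.outer_a.1]
  rw [norm_sq_eq_integral, norm_sq_eq_integral, norm_sq_eq_integral,
    ← integral_add (integrable_norm_sq _) (integrable_norm_sq _)]
  refine integral_congr_ae ?_
  filter_upwards [coeFn_mulLp b F, coeFn_mulLp a F, h.sq_add_sq] with t h1 h2 h3
  rw [h1, h2, norm_mul, norm_mul, mul_pow, mul_pow, ← add_mul, add_comm, h3, one_mul]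

/-! ### The explicit pair -/

/-- The root in `(0, 1/2]` of `s r² - (2 + s) r + 1`, with `s = |ζ|²`. -/
noncomputable def pairRoot (ζ : ℂ) : ℝ :=
  -- The quadratic formula with its numerator rationalised, which remains valid at ζ = 0, where the
  -- equation is linear.
  2 / (2 + ‖ζ‖ ^ 2 + Real.sqrt (4 + (‖ζ‖ ^ 2) ^ 2))

theorem pairRoot_pos (ζ : ℂ) : 0 < pairRoot ζ := by
  unfold pairRoot; positivity

theorem pairRoot_le (ζ : ℂ) : pairRoot ζ ≤ 1 / 2 := by
  have h : 2 ≤ Real.sqrt (4 + (‖ζ‖ ^ 2) ^ 2) := by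
    apply Real.le_sqrt_of_sq_le
    nlinarith [sq_nonneg (‖ζ‖ ^ 2)]
  unfold pairRoot
  rw [div_le_div_iff₀ (by positivity) (by norm_num)]
  nlinarith [sq_nonneg ‖ζ‖]

/-- For |x| = 1, this compares the constant terms in r(|1 - ζ̄x|² + 1) = |1 - rζ̄x|²; the terms in
Re(ζ̄x) agree for every r. -/
theorem pairRoot_eq (ζ : ℂ) :
    pairRoot ζ * (2 + ‖ζ‖ ^ 2) = 1 + pairRoot ζ ^ 2 * ‖ζ‖ ^ 2 := by
  have hq := Real.sq_sqrt (show (0 : ℝ) ≤ 4 + (‖ζ‖ ^ 2) ^ 2 by positivity)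
  unfold pairRoot
  set q := Real.sqrt (4 + (‖ζ‖ ^ 2) ^ 2)
  have : 2 + ‖ζ‖ ^ 2 + q ≠ 0 := by positivity
  field_simp
  nlinarith

theorem norm_pairRoot_mul_lt {ζ : ℂ} (hζ : ‖ζ‖ ≤ 1) : ‖(pairRoot ζ : ℂ) * conj ζ‖ < 1 := by
  rw [norm_mul, RCLike.norm_conj, Complex.norm_real, Real.norm_of_nonneg (pairRoot_pos ζ).le]
  nlinarith [pairRoot_le ζ, pairRoot_pos ζ, norm_nonneg ζ]

/-- The function `√r z / (1 - r ζ̄ z)`. -/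
noncomputable def pairB (ζ : ℂ) (hζ : ‖ζ‖ ≤ 1) : Lp ℂ ∞ arcMeasure :=
  constSymbol 0 + (Real.sqrt (pairRoot ζ) : ℂ) • geomSymbol _ (norm_pairRoot_mul_lt hζ)

/-- The function `√r (1 - ζ̄ z) / (1 - r ζ̄ z)`. -/
noncomputable def pairA (ζ : ℂ) (hζ : ‖ζ‖ ≤ 1) : Lp ℂ ∞ arcMeasure :=
  -- From 1 - ζ̄z = (1 - rζ̄z) + (r - 1)ζ̄z.
  constSymbol (Real.sqrt (pairRoot ζ)) + (Real.sqrt (pairRoot ζ) * (pairRoot ζ - 1) * conj ζ : ℂ) •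
    geomSymbol _ (norm_pairRoot_mul_lt hζ)

section

variable {ζ : ℂ} (hζ : ‖ζ‖ ≤ 1)

theorem isHardyInfty_pairB : IsHardyInfty (pairB ζ hζ) :=
  isHardyInfty_const_add_smul_geomSymbol _ _ _

theorem isHardyInfty_pairA : IsHardyInfty (pairA ζ hζ) :=
  isHardyInfty_const_add_smul_geomSymbol _ _ _

theorem diskValue_pairB {z : ℂ} (hz : z ∈ ball (0 : ℂ) 1) :
    diskValue (pairB ζ hζ) z = Real.sqrt (pairRoot ζ) * z / (1 - pairRoot ζ * conj ζ * z) := by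
  rw [pairB, diskValue_const_add_smul_geomSymbol _ _ _ hz, zero_add, mul_div_assoc]

theorem diskValue_pairA {z : ℂ} (hz : z ∈ ball (0 : ℂ) 1) :
    diskValue (pairA ζ hζ) z =
      Real.sqrt (pairRoot ζ) * (1 - conj ζ * z) / (1 - pairRoot ζ * conj ζ * z) := by
  have h := one_sub_mul_ne_zero (norm_pairRoot_mul_lt hζ) (mem_ball_zero_iff.1 hz).le
  rw [pairA, diskValue_const_add_smul_geomSymbol _ _ _ hz]
  field_simp
  ring

theorem coeFn_pairB : pairB ζ hζ =ᵐ[arcMeasure] fun t => Real.sqrt (pairRoot ζ) *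
    AddCircle.toCircle t / (1 - pairRoot ζ * conj ζ * AddCircle.toCircle t) := by
  filter_upwards [coeFn_const_add_smul_geomSymbol 0 (Real.sqrt (pairRoot ζ))
    (norm_pairRoot_mul_lt hζ)] with t ht
  rw [pairB, ht, zero_add, mul_div_assoc]

theorem coeFn_pairA : pairA ζ hζ =ᵐ[arcMeasure] fun t => Real.sqrt (pairRoot ζ) *
    (1 - conj ζ * AddCircle.toCircle t) / (1 - pairRoot ζ * conj ζ * AddCircle.toCircle t) := by
  filter_upwards [coeFn_const_add_smul_geomSymbol (Real.sqrt (pairRoot ζ))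
    (Real.sqrt (pairRoot ζ) * (pairRoot ζ - 1) * conj ζ) (norm_pairRoot_mul_lt hζ)] with t ht
  have h := one_sub_mul_ne_zero (norm_pairRoot_mul_lt hζ) (norm_toCircle t).le
  rw [pairA, ht]
  field_simp
  ring

end

/-! ### The space `ℋ(b)` of the explicit pair -/

section

variable {ζ : ℂ} (hζ : ‖ζ‖ ≤ 1)

/-- Test vectors of the form (1 - rζ̄z)F cancel the denominator of b, which turns equations for T_b̄
into equations between neighbouring Taylor coefficients. -/
theorem toeplitz_pairB_sub (F : hardyTwo) :
    toeplitz (pairB ζ hζ) (F + (-(pairRoot ζ * conj ζ) : ℂ) • hardyShift F) =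
      (Real.sqrt (pairRoot ζ) : ℂ) • hardyShift F :=
  hardyTwo_ext_diskValue fun z hz => by
    have h := one_sub_mul_ne_zero (norm_pairRoot_mul_lt hζ) (mem_ball_zero_iff.1 hz).le
    rw [diskValue_toeplitz (isHardyInfty_pairB hζ) _ hz, diskValue_add _ _ hz,
      diskValue_smul _ _ hz, diskValue_smul _ _ hz, diskValue_hardyShift _ hz,
      diskValue_pairB hζ hz, div_mul_eq_mul_div, div_eq_iff h]
    ring

theorem toeplitz_pairA_sub (F : hardyTwo) :
    toeplitz (pairA ζ hζ) (F + (-(pairRoot ζ * conj ζ) : ℂ) • hardyShift F) =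
      (Real.sqrt (pairRoot ζ) : ℂ) • (F + (-conj ζ : ℂ) • hardyShift F) :=
  hardyTwo_ext_diskValue fun z hz => by
    have h := one_sub_mul_ne_zero (norm_pairRoot_mul_lt hζ) (mem_ball_zero_iff.1 hz).le
    rw [diskValue_toeplitz (isHardyInfty_pairA hζ) _ hz, diskValue_add _ _ hz,
      diskValue_smul _ _ hz, diskValue_smul _ _ hz, diskValue_add _ _ hz, diskValue_smul _ _ hz,
      diskValue_hardyShift _ hz, diskValue_pairA hζ hz, div_mul_eq_mul_div, div_eq_iff h]
    ring

theorem sqrt_pairRoot_ne_zero (ζ : ℂ) : (Real.sqrt (pairRoot ζ) : ℂ) ≠ 0 := by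
  exact_mod_cast (Real.sqrt_pos.2 (pairRoot_pos ζ)).ne'

theorem inner_star_toeplitz (ψ : Lp ℂ ∞ arcMeasure) (F G : hardyTwo) :
    inner ℂ F (star (toeplitz ψ) G) = inner ℂ (toeplitz ψ F) G :=
  ContinuousLinearMap.adjoint_inner_right (toeplitz ψ) F G

/-- Pairing T_b̄ F with (1 - rζ̄z)zⁿ gives √r times the coefficient of index n + 1 of F. Hence only
constants can lie in the kernel. -/
theorem fourierCoeff_eq_zero_of_star_toeplitz_pairB {F : hardyTwo}
    (hF : star (toeplitz (pairB ζ hζ)) F = 0) (n : ℕ) :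
    fourierCoeff (F : Lp ℂ 2 arcMeasure) ((n + 1 : ℕ) : ℤ) = 0 := by
  have h := inner_star_toeplitz (pairB ζ hζ)
    (hardyBasis n + (-(pairRoot ζ * conj ζ) : ℂ) • hardyShift (hardyBasis n)) F
  rw [hF, inner_zero_right, toeplitz_pairB_sub, hardyShift_hardyBasis] at h
  rw [← inner_hardyBasis]
  have h2 := (inner_smul_left (hardyBasis (n + 1)) F (Real.sqrt (pairRoot ζ) : ℂ)).symm.trans h.symm
  refine (mul_eq_zero.1 h2).resolve_left ?_
  simpa using sqrt_pairRoot_ne_zero ζ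

/-- Pairing with (1 - rζ̄z)zⁿ yields g_n = ζ g_{n+1}. As |ζ| ≤ 1, the moduli |g_n| do not decrease,
and square summability forces them to be 0. This makes the G attached to F unique. -/
theorem star_toeplitz_pairA_injective {G : hardyTwo}
    (hG : star (toeplitz (pairA ζ hζ)) G = 0) : G = 0 := by
  have hrec (n : ℕ) : fourierCoeff (G : Lp ℂ 2 arcMeasure) n =
      ζ * fourierCoeff (G : Lp ℂ 2 arcMeasure) ((n + 1 : ℕ) : ℤ) := by
    have h := inner_star_toeplitz (pairA ζ hζ)
      (hardyBasis n + (-(pairRoot ζ * conj ζ) : ℂ) • hardyShift (hardyBasis n)) G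
    rw [hG, inner_zero_right, toeplitz_pairA_sub, hardyShift_hardyBasis] at h
    have h2 := (inner_smul_left (hardyBasis n + (-conj ζ : ℂ) • hardyBasis (n + 1)) G
      (Real.sqrt (pairRoot ζ) : ℂ)).symm.trans h.symm
    have h3 := (mul_eq_zero.1 h2).resolve_left (by simpa using sqrt_pairRoot_ne_zero ζ)
    rw [inner_add_left] at h3
    have h4 := inner_smul_left (hardyBasis (n + 1)) G (-conj ζ : ℂ)
    have h5 : inner ℂ ((-conj ζ : ℂ) • (hardyBasis (n + 1) : hardyTwo)) G =
        -ζ * fourierCoeff (G : Lp ℂ 2 arcMeasure) ((n + 1 : ℕ) : ℤ) := by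
      rw [← inner_hardyBasis]
      simpa using h4
    rw [h5, inner_hardyBasis] at h3
    linear_combination h3
  have hmono : Monotone fun n : ℕ => ‖fourierCoeff (G : Lp ℂ 2 arcMeasure) n‖ ^ 2 := by
    refine monotone_nat_of_le_succ fun n => ?_
    rw [hrec n, norm_mul]
    gcongr
    exact mul_le_of_le_one_left (norm_nonneg _) hζ
  have hlim := (hasSum_norm_sq_coeff G).summable.tendsto_atTop_zero
  refine hardyTwo_ext fun n => ?_
  have h1 := hmono.ge_of_tendsto hlim n
  have h2 : ‖fourierCoeff (G : Lp ℂ 2 arcMeasure) n‖ = 0 := by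
    have := sq_nonneg ‖fourierCoeff (G : Lp ℂ 2 arcMeasure) n‖
    exact pow_eq_zero_iff (n := 2) (by norm_num) |>.1 (le_antisymm h1 this)
  rw [norm_eq_zero.1 h2, Submodule.coe_zero, fourierCoeff_eq_inner, inner_zero_right]

/-- T_b F has no constant term because b(0) = 0. -/
theorem star_toeplitz_pairB_basis_zero : star (toeplitz (pairB ζ hζ)) (hardyBasis 0) = 0 := by
  refine ext_inner_left ℂ fun F => ?_
  rw [inner_star_toeplitz, inner_zero_right]
  refine (inner_conj_symm (toeplitz (pairB ζ hζ) F) (hardyBasis 0)).symm.trans ?_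
  rw [inner_hardyBasis]
  have h0 : (0 : ℂ) ∈ ball (0 : ℂ) 1 := by simp
  have h := hasTaylor_diskValue_hardyTwo (toeplitz (pairB ζ hζ) F) 0 h0
  have h1 := h.unique (hasSum_single 0 fun n hn => by simp [hn])
  rw [diskValue_toeplitz (isHardyInfty_pairB hζ) F h0, diskValue_pairB hζ h0] at h1
  have h2 : fourierCoeff (toeplitz (pairB ζ hζ) F : Lp ℂ 2 arcMeasure) ((0 : ℕ) : ℤ) = 0 := by
    simpa using h1.symm
  rw [h2, map_zero]

/-- On the circle z z̄ = 1 gives z̄(z - ζ) = 1 - ζz̄, that is, b̄(z - ζ) = ā. -/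
theorem star_toeplitz_pairB_shift (G : hardyTwo) :
    star (toeplitz (pairB ζ hζ)) (hardyShift G + (-ζ) • G) = star (toeplitz (pairA ζ hζ)) G := by
  refine ext_inner_left ℂ fun F => ?_
  rw [inner_star_toeplitz, inner_star_toeplitz, Submodule.coe_inner, Submodule.coe_inner,
    L2.inner_def, L2.inner_def]
  refine integral_congr_ae ?_
  filter_upwards [coeFn_toeplitz (isHardyInfty_pairB hζ) F,
    coeFn_toeplitz (isHardyInfty_pairA hζ) F, coeFn_pairB hζ, coeFn_pairA hζ, coeFn_hardyShift G,
    coeFn_hardyTwo_combination (hardyShift G) G (-ζ)] with t h1 h2 h3 h4 h5 h6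
  have h := one_sub_mul_ne_zero (norm_pairRoot_mul_lt hζ) (norm_toCircle t).le
  have hn : (AddCircle.toCircle t : ℂ) * conj (AddCircle.toCircle t : ℂ) = 1 := by
    rw [Complex.mul_conj, Complex.normSq_eq_norm_sq, norm_toCircle]; simp
  have hc : (1 - pairRoot ζ * ζ * conj (AddCircle.toCircle t : ℂ)) ≠ 0 := by
    intro h0
    apply h
    have := congrArg conj h0
    simpa using this
  rw [h1, h2, h3, h4, h6, h5]
  simp only [RCLike.inner_apply, map_mul, map_div₀, map_sub, map_one, Complex.conj_conj,
    Complex.conj_ofReal]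
  generalize (1 - pairRoot ζ * ζ * conj (AddCircle.toCircle t : ℂ)) = d at hc ⊢
  field_simp
  linear_combination (Real.sqrt (pairRoot ζ) : ℂ) * ((G : Lp ℂ 2 arcMeasure) t) *
    conj ((F : Lp ℂ 2 arcMeasure) t) * hn

/-- Membership in `ℋ(b)` in terms of the equation `T_{b̄} F = T_{ā} G`. -/
theorem star_toeplitz_pair_eq_iff (F G : hardyTwo) :
    star (toeplitz (pairB ζ hζ)) F = star (toeplitz (pairA ζ hζ)) G ↔
      ∃ c : ℂ, Set.EqOn (diskValue (F : Lp ℂ 2 arcMeasure))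
        (fun z => c + (z - ζ) * diskValue (G : Lp ℂ 2 arcMeasure) z) (ball 0 1) := by
  rw [← star_toeplitz_pairB_shift]
  constructor
  · intro h
    -- The difference F - (z - ζ)G lies in ker T_b̄ and is therefore constant.
    set F' := F + (-1 : ℂ) • (hardyShift G + (-ζ) • G) with hF'
    have h0 : star (toeplitz (pairB ζ hζ)) F' = 0 := by
      rw [hF', map_add, map_smul, h, neg_one_smul, add_neg_cancel]
    refine ⟨fourierCoeff (F' : Lp ℂ 2 arcMeasure) ((0 : ℕ) : ℤ), fun z hz => ?_⟩
    have h1 : diskValue (F' : Lp ℂ 2 arcMeasure) z =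
        fourierCoeff (F' : Lp ℂ 2 arcMeasure) ((0 : ℕ) : ℤ) := by
      refine (hasTaylor_diskValue_hardyTwo F').eqOn (g := fun _ => _) ?_ hz
      convert HasTaylor.const (fourierCoeff (F' : Lp ℂ 2 arcMeasure) ((0 : ℕ) : ℤ)) using 2 with n
      cases n with
      | zero => rfl
      | succ n => simpa using fourierCoeff_eq_zero_of_star_toeplitz_pairB hζ h0 n
    rw [hF', diskValue_add _ _ hz, diskValue_smul _ _ hz, diskValue_add _ _ hz,
      diskValue_smul _ _ hz, diskValue_hardyShift _ hz, ← hF'] at h1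
    simp only
    linear_combination h1
  · rintro ⟨c, hc⟩
    have hF : F = c • hardyBasis 0 + (hardyShift G + (-ζ) • G) :=
      hardyTwo_ext_diskValue fun z hz => by
        rw [hc hz, diskValue_add _ _ hz, diskValue_smul _ _ hz, diskValue_add _ _ hz,
          diskValue_smul _ _ hz, diskValue_hardyShift _ hz, diskValue_hardyBasis _ hz]
        ring
    conv_lhs => rw [hF, map_add, map_smul, star_toeplitz_pairB_basis_zero, smul_zero, zero_add]

theorem dbrRoot_pairB : dbrRoot (pairB ζ hζ) =
    opSqrt (1 - toeplitz (pairB ζ hζ) * star (toeplitz (pairB ζ hζ))) := by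
  rw [dbrRoot, toeplitz_star]; rfl

theorem mem_dbrSpace_pairB_iff (hpair : IsPair (pairB ζ hζ) (pairA ζ hζ)) (F : hardyTwo) :
    F ∈ dbrSpace (pairB ζ hζ) ↔ ∃ (c : ℂ) (G : hardyTwo), Set.EqOn (diskValue (F : Lp ℂ 2 arcMeasure))
        (fun z => c + (z - ζ) * diskValue (G : Lp ℂ 2 arcMeasure) z) (ball 0 1) := by
  rw [dbrSpace, dbrRoot_pairB hζ]
  constructor
  · rintro ⟨x, rfl⟩
    obtain ⟨G, hG, -⟩ := exists_of_opSqrt hpair.star_mul_add x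
    obtain ⟨c, hc⟩ := (star_toeplitz_pair_eq_iff hζ _ G).1 hG
    exact ⟨c, G, hc⟩
  · rintro ⟨c, G, hc⟩
    obtain ⟨x, -, hx, -⟩ := exists_preimage_opSqrt hpair.star_mul_add
      ((star_toeplitz_pair_eq_iff hζ F G).2 ⟨c, hc⟩)
    exact ⟨x, hx⟩

/-- The general theory bounds the norm from above with the given G and from below with some G'
solving the same equation. Injectivity of T_ā identifies G' with G, so the bounds meet. -/
theorem dbrNorm_pairB (hpair : IsPair (pairB ζ hζ) (pairA ζ hζ)) {F G : hardyTwo} {c : ℂ}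
    (hFG : Set.EqOn (diskValue (F : Lp ℂ 2 arcMeasure))
        (fun z => c + (z - ζ) * diskValue (G : Lp ℂ 2 arcMeasure) z) (ball 0 1)) :
    dbrNorm (pairB ζ hζ) F = Real.sqrt (‖F‖ ^ 2 + ‖G‖ ^ 2) := by
  have hFG' := (star_toeplitz_pair_eq_iff hζ F G).2 ⟨c, hFG⟩
  obtain ⟨x, hxk, hx, hle⟩ := exists_preimage_opSqrt hpair.star_mul_add hFG'
  obtain ⟨G', hG', hge⟩ := exists_of_opSqrt hpair.star_mul_add x
  rw [hx] at hG' hge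
  have hGG : G' = G := by
    have h0 : star (toeplitz (pairA ζ hζ)) (G' - G) = 0 := by
      rw [map_sub, ← hG', hFG', sub_self]
    exact sub_eq_zero.1 (star_toeplitz_pairA_injective hζ h0)
  rw [hGG] at hge
  rw [← dbrRoot_pairB hζ] at hxk hx
  rw [← hx, dbrNorm_dbrRoot _ _ hxk, hx, le_antisymm hge hle, Real.sqrt_sq (norm_nonneg x)]

end

/-! ### Integration over the circle -/

theorem volume_torus : (volume : Measure Torus) = arcMeasure := by
  rw [AddCircle.volume_eq_smul_haarAddCircle]; simp

theorem toCircle_coe_eq_circleMap (x : ℝ) :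
    (AddCircle.toCircle (x : Torus) : ℂ) = circleMap 0 1 (2 * Real.pi * x) := by
  rw [AddCircle.toCircle_apply_mk]
  simp [circleMap]

theorem integral_toCircle (f : ℂ → ℂ) :
    ∫ t : Torus, f (AddCircle.toCircle t) ∂arcMeasure = Real.circleAverage f 0 1 := by
  rw [← volume_torus, ← UnitAddCircle.intervalIntegral_preimage 0 (fun t => f (AddCircle.toCircle t))]
  simp only [toCircle_coe_eq_circleMap]
  rw [intervalIntegral.integral_comp_mul_left (fun θ => f (circleMap 0 1 θ)) (by positivity)]
  simp [Real.circleAverage]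

theorem integrable_toCircle {f : ℂ → ℝ} (hf : Measurable f) (h : CircleIntegrable f 0 1) :
    Integrable (fun t : Torus => f (AddCircle.toCircle t)) arcMeasure := by
  rw [← volume_torus, ← (UnitAddCircle.measurePreserving_mk 0).integrable_comp]
  · have h1 := IntervalIntegrable.comp_mul_left (c := 2 * Real.pi) h
    have h2 : (2 * Real.pi) / (2 * Real.pi) = 1 := by field_simp
    rw [zero_div, h2, intervalIntegrable_iff_integrableOn_Ioc_of_le zero_le_one] at h1
    rw [zero_add]
    refine h1.congr (Filter.Eventually.of_forall fun x => ?_)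
    simp [toCircle_coe_eq_circleMap]
  · exact (hf.comp continuous_toCircle_coe.measurable).aestronglyMeasurable

theorem ae_toCircle_ne (w : ℂ) : ∀ᵐ t : Torus ∂arcMeasure, (AddCircle.toCircle t : ℂ) ≠ w := by
  have hs : Set.Subsingleton {t : Torus | (AddCircle.toCircle t : ℂ) = w} := by
    intro t ht u hu
    exact AddCircle.injective_toCircle one_ne_zero (Subtype.ext (ht.trans hu.symm))
  rw [ae_iff]
  simp only [not_not]
  rcases hs.eq_empty_or_singleton with h | ⟨t, h⟩
  · rw [h, measure_empty]
  · rw [h, ← closedBall_zero, ← volume_torus, AddCircle.volume_closedBall]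
    simp

/-! ### The outer function `1 - w z` -/

theorem one_sub_mul_mem_slitPlane {w x : ℂ} (hw : ‖w‖ < 1) (hx : ‖x‖ ≤ 1) :
    1 - w * x ∈ Complex.slitPlane := by
  refine Complex.mem_slitPlane_of_norm_lt_one (z := -(w * x)) ?_ |> fun h => by
    rwa [← sub_eq_add_neg] at h
  rw [norm_neg, norm_mul]
  nlinarith [norm_nonneg w, norm_nonneg x]

theorem diffContOnCl_log {w : ℂ} (hw : ‖w‖ < 1) :
    DiffContOnCl ℂ (fun x => Complex.log (1 - w * x)) (ball 0 |1|) := by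
  refine DifferentiableOn.diffContOnCl fun x hx => ?_
  rw [abs_one, closure_ball _ one_ne_zero, mem_closedBall_zero_iff] at hx
  have hd : DifferentiableAt ℂ (fun x => 1 - w * x) x := by fun_prop
  exact (hd.clog (one_sub_mul_mem_slitPlane hw hx)).differentiableWithinAt

theorem continuous_log_toCircle {w : ℂ} (hw : ‖w‖ < 1) :
    Continuous fun t : Torus => Complex.log (1 - w * AddCircle.toCircle t) :=
  (continuous_const.sub (continuous_const.mul continuous_toCircle_coe)).clog
    fun t => one_sub_mul_mem_slitPlane hw (norm_toCircle t).le

theorem toCircle_sub_ne_zero {z : ℂ} (hz : ‖z‖ < 1) (t : Torus) :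
    (AddCircle.toCircle t : ℂ) - z ≠ 0 := by
  intro h
  have := norm_toCircle t
  rw [sub_eq_zero.1 h] at this
  linarith

theorem continuous_herglotz {z : ℂ} (hz : ‖z‖ < 1) : Continuous fun t : Torus =>
    ((AddCircle.toCircle t : ℂ) + z) / ((AddCircle.toCircle t : ℂ) - z) :=
  (continuous_toCircle_coe.add continuous_const).div
    (continuous_toCircle_coe.sub continuous_const) (toCircle_sub_ne_zero hz)

theorem integrable_of_continuous {f : Torus → ℂ} (hf : Continuous f) : Integrable f arcMeasure :=
  hf.integrable_of_hasCompactSupport (HasCompactSupport.of_compactSpace _)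

/-- The kernel is 2λ/(λ - z) - 1, so Cauchy's formula and the mean value property apply. -/
theorem integral_herglotz_mul {f : ℂ → ℂ} (hf : DiffContOnCl ℂ f (ball 0 |1|)) {z : ℂ}
    (hz : ‖z‖ < 1) (hc : Continuous fun t : Torus => f (AddCircle.toCircle t)) :
    ∫ t : Torus, ((AddCircle.toCircle t : ℂ) + z) / ((AddCircle.toCircle t : ℂ) - z) *
      f (AddCircle.toCircle t) ∂arcMeasure = 2 * f z - f 0 := by
  have h1 : ∫ t : Torus, (AddCircle.toCircle t : ℂ) / ((AddCircle.toCircle t : ℂ) - z) *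
      f (AddCircle.toCircle t) ∂arcMeasure = f z := by
    rw [integral_toCircle fun x => x / (x - z) * f x]
    simpa using hf.circleAverage_smul_div (w := z) (by simpa using hz)
  have h2 : ∫ t : Torus, f (AddCircle.toCircle t) ∂arcMeasure = f 0 := by
    rw [integral_toCircle f]
    exact hf.circleAverage
  rw [← h1, ← h2, ← integral_const_mul, ← integral_sub]
  · refine integral_congr_ae (Filter.Eventually.of_forall fun t => ?_)
    have := toCircle_sub_ne_zero hz t
    field_simp
    ring
  · refine integrable_of_continuous (continuous_const.mul (Continuous.mul ?_ hc))
    exact continuous_toCircle_coe.div (continuous_toCircle_coe.sub continuous_const)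
      (toCircle_sub_ne_zero hz)
  · exact integrable_of_continuous hc

/-- On the circle the conjugate of the kernel is (1 + z̄λ)/(1 - z̄λ), which is holomorphic in λ with
value 1 at 0. The mean value property then gives the conjugate of the integral. -/
theorem integral_conj_herglotz_mul {f : ℂ → ℂ} (hf : DiffContOnCl ℂ f (ball 0 |1|)) {z : ℂ}
    (hz : ‖z‖ < 1) :
    ∫ t : Torus, ((AddCircle.toCircle t : ℂ) + z) / ((AddCircle.toCircle t : ℂ) - z) *
      conj (f (AddCircle.toCircle t)) ∂arcMeasure = conj (f 0) := by
  have hg : DiffContOnCl ℂ (fun x => (1 + conj z * x) / (1 - conj z * x) * f x) (ball 0 |1|) := by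
    have hz' : ‖conj z‖ < 1 := by simpa using hz
    refine DiffContOnCl.smul (c := fun x => (1 + conj z * x) / (1 - conj z * x)) ?_ hf
    refine DifferentiableOn.diffContOnCl fun x hx => ?_
    rw [abs_one, closure_ball _ one_ne_zero, mem_closedBall_zero_iff] at hx
    refine DifferentiableAt.differentiableWithinAt ?_
    exact DifferentiableAt.div (by fun_prop) (by fun_prop) (one_sub_mul_ne_zero hz' hx)
  have h1 := hg.circleAverage
  rw [← integral_toCircle] at h1
  simp only [mul_zero, add_zero, sub_zero, div_one, one_mul] at h1
  rw [← h1, ← integral_conj]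
  refine integral_congr_ae (Filter.Eventually.of_forall fun t => ?_)
  have hn : (AddCircle.toCircle t : ℂ) * conj (AddCircle.toCircle t : ℂ) = 1 := by
    rw [Complex.mul_conj, Complex.normSq_eq_norm_sq, norm_toCircle]; simp
  have h0 : (AddCircle.toCircle t : ℂ) ≠ 0 := fun h => by simp [h] at hn
  have h2 := toCircle_sub_ne_zero hz t
  have hc : conj (AddCircle.toCircle t : ℂ) = (AddCircle.toCircle t : ℂ)⁻¹ :=
    eq_inv_of_mul_eq_one_right hn
  simp only [map_mul, map_div₀, map_add, map_sub, map_one, Complex.conj_conj, hc]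
  congr 1
  have h3 : (1 : ℂ) - z * (AddCircle.toCircle t : ℂ)⁻¹ ≠ 0 := by
    intro h
    apply h2
    field_simp at h
    simpa using h
  rw [div_eq_div_iff h2 h3]
  field_simp

/-- The Herglotz integral of `log |1 - w λ|`, for `|w| < 1`. -/
theorem integral_herglotz_log_of_lt {w z : ℂ} (hw : ‖w‖ < 1) (hz : ‖z‖ < 1) :
    ∫ t : Torus, ((AddCircle.toCircle t : ℂ) + z) / ((AddCircle.toCircle t : ℂ) - z) *
      (Real.log ‖1 - w * AddCircle.toCircle t‖ : ℂ) ∂arcMeasure = Complex.log (1 - w * z) := by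
  have h1 := integral_herglotz_mul (diffContOnCl_log hw) hz (continuous_log_toCircle hw)
  have h2 := integral_conj_herglotz_mul (diffContOnCl_log hw) hz
  have hc := continuous_log_toCircle hw
  have hh := continuous_herglotz hz
  have hcc : Continuous fun t : Torus => conj (Complex.log (1 - w * AddCircle.toCircle t)) :=
    Complex.continuous_conj.comp hc
  have h3 := integral_add (integrable_of_continuous (hh.mul hc))
    (integrable_of_continuous (hh.mul hcc))
  simp only [Pi.mul_apply] at h3
  rw [h1, h2] at h3
  simp only [mul_zero, sub_zero, Complex.log_one, map_zero, add_zero] at h3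
  -- Twice log|1 - wλ| is the sum of the holomorphic logarithm and its conjugate, and this logarithm
  -- vanishes at 0.
  rw [← mul_right_inj' (two_ne_zero (α := ℂ)), ← h3, ← integral_const_mul]
  refine integral_congr_ae (Filter.Eventually.of_forall fun t => ?_)
  beta_reduce
  rw [← mul_add, Complex.add_conj, Complex.log_re]
  push_cast
  ring

theorem integrable_log_norm_one_sub (w : ℂ) :
    Integrable (fun t : Torus => Real.log ‖1 - w * AddCircle.toCircle t‖) arcMeasure := by
  refine integrable_toCircle (f := fun x => Real.log ‖1 - w * x‖) (by fun_prop) ?_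
  exact MeromorphicOn.circleIntegrable_log_norm (f := fun x => 1 - w * x) fun x _ => by fun_prop

/-- The bound does not depend on ρ: it is the integrable majorant for letting ρ → 1. It rests on |1
- wx| ≤ 2|1 - ρwx|, since 1 - wx and 1 - ρwx differ by at most 1 - ρ ≤ |1 - ρwx|. -/
theorem abs_log_norm_one_sub_le {w x : ℂ} (hw : ‖w‖ ≤ 1) (hx : ‖x‖ = 1) (h0 : 1 - w * x ≠ 0)
    {ρ : ℝ} (hρ : 0 ≤ ρ) (hρ1 : ρ < 1) :
    |Real.log ‖1 - ρ * w * x‖| ≤ Real.log 2 + |Real.log ‖1 - w * x‖| := by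
  have hρw : ‖(ρ : ℂ) * w‖ ≤ ρ := by
    rw [norm_mul, Complex.norm_real, Real.norm_of_nonneg hρ]
    exact mul_le_of_le_one_right hρ hw
  have h1 : 1 - ρ ≤ ‖1 - ρ * w * x‖ := (sub_le_sub_left hρw 1).trans (one_sub_norm_le hx.le)
  have hpos : 0 < ‖1 - ρ * w * x‖ := (sub_pos.2 hρ1).trans_le h1
  have hle2 : ‖1 - ρ * w * x‖ ≤ 2 := by
    refine (norm_sub_le _ _).trans ?_
    rw [norm_one, norm_mul, hx, mul_one]
    linarith
  have hlow : ‖1 - w * x‖ ≤ 2 * ‖1 - ρ * w * x‖ := by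
    have h2 : 1 - w * x = (1 - ρ * w * x) - ((1 - ρ : ℝ) : ℂ) * (w * x) := by push_cast; ring
    have h3 : ‖((1 - ρ : ℝ) : ℂ) * (w * x)‖ ≤ 1 - ρ := by
      rw [norm_mul, norm_mul, hx, mul_one, Complex.norm_real, Real.norm_of_nonneg (by linarith)]
      exact mul_le_of_le_one_right (by linarith) hw
    rw [h2]
    exact (norm_sub_le _ _).trans (by linarith)
  have hpos0 : 0 < ‖1 - w * x‖ := norm_pos_iff.2 h0
  have hl1 := Real.log_le_log hpos hle2
  have hl2 := Real.log_le_log hpos0 hlow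
  rw [Real.log_mul two_ne_zero hpos.ne'] at hl2
  have := neg_abs_le (Real.log ‖1 - w * x‖)
  have := abs_nonneg (Real.log ‖1 - w * x‖)
  rw [abs_le]
  constructor <;> linarith

/-- The Herglotz integral of `log |1 - w λ|`, for `|w| ≤ 1`. -/
theorem integral_herglotz_log {w z : ℂ} (hw : ‖w‖ ≤ 1) (hz : ‖z‖ < 1) :
    ∫ t : Torus, ((AddCircle.toCircle t : ℂ) + z) / ((AddCircle.toCircle t : ℂ) - z) *
      (Real.log ‖1 - w * AddCircle.toCircle t‖ : ℂ) ∂arcMeasure = Complex.log (1 - w * z) := by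
  set ρ : ℕ → ℝ := fun n => 1 - 1 / ((n : ℝ) + 1) with hρ
  have hρ0 (n : ℕ) : 0 ≤ ρ n := by
    have : 1 / ((n : ℝ) + 1) ≤ 1 := by rw [div_le_one (by positivity)]; linarith [n.cast_nonneg (α := ℝ)]
    simp only [hρ]; linarith
  have hρ1 (n : ℕ) : ρ n < 1 := by
    have : 0 < 1 / ((n : ℝ) + 1) := by positivity
    simp only [hρ]; linarith
  have hρlim : Filter.Tendsto ρ Filter.atTop (nhds 1) := by
    simpa [hρ] using tendsto_one_div_add_atTop_nhds_zero_nat.const_sub (1 : ℝ)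
  have hρc : Filter.Tendsto (fun n => (ρ n : ℂ)) Filter.atTop (nhds 1) := by
    exact_mod_cast (Complex.continuous_ofReal.tendsto 1).comp hρlim
  have hρw (n : ℕ) : ‖(ρ n : ℂ) * w‖ < 1 := by
    rw [norm_mul, Complex.norm_real, Real.norm_of_nonneg (hρ0 n)]
    exact (mul_le_of_le_one_right (hρ0 n) hw).trans_lt (hρ1 n)
  obtain ⟨C, hC⟩ := (isCompact_univ (X := Torus)).exists_bound_of_continuousOn
    (continuous_herglotz hz).continuousOn
  have hlim : Filter.Tendsto (fun n => ∫ t : Torus, ((AddCircle.toCircle t : ℂ) + z) /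
      ((AddCircle.toCircle t : ℂ) - z) *
      (Real.log ‖1 - ρ n * w * AddCircle.toCircle t‖ : ℂ) ∂arcMeasure) Filter.atTop
      (nhds (∫ t : Torus, ((AddCircle.toCircle t : ℂ) + z) / ((AddCircle.toCircle t : ℂ) - z) *
      (Real.log ‖1 - w * AddCircle.toCircle t‖ : ℂ) ∂arcMeasure)) := by
    refine tendsto_integral_of_dominated_convergence
      (fun t => C * (Real.log 2 + |Real.log ‖1 - w * AddCircle.toCircle t‖|)) ?_ ?_ ?_ ?_
    · intro n
      refine (continuous_herglotz hz).aestronglyMeasurable.mul ?_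
      have : Measurable fun t : Torus =>
          (Real.log ‖1 - ρ n * w * (AddCircle.toCircle t : ℂ)‖ : ℂ) := by
        have := continuous_toCircle_coe.measurable
        fun_prop
      exact this.aestronglyMeasurable
    · exact ((integrable_const _).add (integrable_log_norm_one_sub w).abs).const_mul C
    · intro n
      -- The only possible zero of 1 - wλ is λ = w⁻¹; for w = 0 the excluded value is 0, which is
      -- not on the circle.
      filter_upwards [ae_toCircle_ne w⁻¹] with t ht
      have h0 : 1 - w * (AddCircle.toCircle t : ℂ) ≠ 0 := fun h =>
        ht (eq_inv_of_mul_eq_one_right (sub_eq_zero.1 h).symm)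
      rw [norm_mul, Complex.norm_real, Real.norm_eq_abs]
      gcongr
      · exact (norm_nonneg _).trans (hC t (Set.mem_univ t))
      · exact hC t (Set.mem_univ t)
      · exact abs_log_norm_one_sub_le hw (norm_toCircle t) h0 (hρ0 n) (hρ1 n)
    · filter_upwards [ae_toCircle_ne w⁻¹] with t ht
      have h0 : 1 - w * (AddCircle.toCircle t : ℂ) ≠ 0 := fun h =>
        ht (eq_inv_of_mul_eq_one_right (sub_eq_zero.1 h).symm)
      refine Filter.Tendsto.const_mul _ ?_
      refine (Complex.continuous_ofReal.tendsto _).comp ?_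
      refine Filter.Tendsto.log ?_ (norm_ne_zero_iff.2 h0)
      have : Filter.Tendsto (fun n => 1 - (ρ n : ℂ) * w * AddCircle.toCircle t) Filter.atTop
          (nhds (1 - 1 * w * AddCircle.toCircle t)) := by
        exact ((hρc.mul_const w).mul_const _).const_sub 1
      simpa using this.norm
  simp only [integral_herglotz_log_of_lt (hρw _) hz] at hlim
  refine tendsto_nhds_unique hlim ?_
  have h1 : Filter.Tendsto (fun n => 1 - (ρ n : ℂ) * w * z) Filter.atTop
      (nhds (1 - 1 * w * z)) := ((hρc.mul_const w).mul_const z).const_sub 1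
  rw [one_mul] at h1
  refine h1.clog ?_
  have := one_sub_mul_mem_slitPlane (w := z) (x := w) hz hw
  rwa [mul_comm] at this

theorem integral_herglotz_one {z : ℂ} (hz : ‖z‖ < 1) :
    ∫ t : Torus, ((AddCircle.toCircle t : ℂ) + z) / ((AddCircle.toCircle t : ℂ) - z)
      ∂arcMeasure = 1 := by
  have h := integral_herglotz_mul (f := fun _ => 1) diffContOnCl_const hz continuous_const
  simp only [mul_one] at h
  rw [h]; norm_num

/-! ### Existence and uniqueness of the pair -/

section

variable {ζ : ℂ} (hζ : ‖ζ‖ ≤ 1)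

theorem log_norm_pairA : (fun t => Real.log ‖pairA ζ hζ t‖) =ᵐ[arcMeasure]
    fun t => Real.log (Real.sqrt (pairRoot ζ)) +
      (Real.log ‖1 - conj ζ * AddCircle.toCircle t‖ -
        Real.log ‖1 - pairRoot ζ * conj ζ * AddCircle.toCircle t‖) := by
  filter_upwards [coeFn_pairA hζ, ae_toCircle_ne (conj ζ)⁻¹] with t h1 h2
  have h := one_sub_mul_ne_zero (norm_pairRoot_mul_lt hζ) (norm_toCircle t).le
  have h0 : 1 - conj ζ * (AddCircle.toCircle t : ℂ) ≠ 0 := fun h =>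
    h2 (eq_inv_of_mul_eq_one_right (sub_eq_zero.1 h).symm)
  have hr := Real.sqrt_pos.2 (pairRoot_pos ζ)
  rw [h1, norm_div, norm_mul, Complex.norm_real, Real.norm_of_nonneg hr.le,
    Real.log_div (mul_ne_zero hr.ne' (norm_ne_zero_iff.2 h0)) (norm_ne_zero_iff.2 h),
    Real.log_mul hr.ne' (norm_ne_zero_iff.2 h0)]
  ring

theorem integrable_herglotz_mul {u : Torus → ℝ} (hu : Integrable u arcMeasure) {z : ℂ}
    (hz : ‖z‖ < 1) : Integrable (fun t : Torus =>
      ((AddCircle.toCircle t : ℂ) + z) / ((AddCircle.toCircle t : ℂ) - z) * (u t : ℂ))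
      arcMeasure := by
  obtain ⟨C, hC⟩ := (isCompact_univ (X := Torus)).exists_bound_of_continuousOn
    (continuous_herglotz hz).continuousOn
  exact hu.ofReal.bdd_mul (c := C) (continuous_herglotz hz).aestronglyMeasurable
    (Filter.Eventually.of_forall fun t => hC t (Set.mem_univ t))

/-- The left side depends only on the modulus of a on the circle. The formula therefore gives both
that the explicit a is outer and that any outer function with this modulus is a constant multiple of
it. -/
theorem exp_integral_herglotz_pairA {z : ℂ} (hz : z ∈ ball (0 : ℂ) 1) :
    Complex.exp (∫ t, ((AddCircle.toCircle t : ℂ) + z) / ((AddCircle.toCircle t : ℂ) - z) *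
        (Real.log ‖pairA ζ hζ t‖ : ℂ) ∂arcMeasure) = diskValue (pairA ζ hζ) z := by
  have hz' : ‖z‖ < 1 := by simpa using hz
  have hw : ‖conj ζ‖ ≤ 1 := by simpa using hζ
  have hr := Real.sqrt_pos.2 (pairRoot_pos ζ)
  have h1 : ∫ t, ((AddCircle.toCircle t : ℂ) + z) / ((AddCircle.toCircle t : ℂ) - z) *
        (Real.log ‖pairA ζ hζ t‖ : ℂ) ∂arcMeasure =
      (Real.log (Real.sqrt (pairRoot ζ)) : ℂ) + (Complex.log (1 - conj ζ * z) -
        Complex.log (1 - pairRoot ζ * conj ζ * z)) := by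
    have e0 : ∫ t : Torus, ((AddCircle.toCircle t : ℂ) + z) / ((AddCircle.toCircle t : ℂ) - z) *
        (Real.log (Real.sqrt (pairRoot ζ)) : ℂ) ∂arcMeasure =
        (Real.log (Real.sqrt (pairRoot ζ)) : ℂ) := by
      rw [integral_mul_const, integral_herglotz_one hz', one_mul]
    rw [← integral_herglotz_log hw hz', ← integral_herglotz_log (norm_pairRoot_mul_lt hζ).le hz',
      ← integral_sub (integrable_herglotz_mul (integrable_log_norm_one_sub _) hz')
        (integrable_herglotz_mul (integrable_log_norm_one_sub _) hz'),
      ← e0, ← integral_add]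
    · refine integral_congr_ae ?_
      filter_upwards [log_norm_pairA hζ] with t ht
      rw [ht]
      push_cast
      ring
    · exact (integrable_of_continuous (continuous_herglotz hz')).mul_const _
    · exact (integrable_herglotz_mul (integrable_log_norm_one_sub _) hz').sub
        (integrable_herglotz_mul (integrable_log_norm_one_sub _) hz')
  have h2 : 1 - conj ζ * z ≠ 0 := by
    rw [mul_comm]; exact one_sub_mul_ne_zero hz' hw
  have h3 := one_sub_mul_ne_zero (norm_pairRoot_mul_lt hζ) hz'.le
  rw [h1, Complex.exp_add, Complex.exp_sub, Complex.exp_log h2, Complex.exp_log h3,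
    ← Complex.ofReal_exp, Real.exp_log hr, diskValue_pairA hζ hz, mul_div_assoc]

theorem isOuter_pairA : IsOuter (pairA ζ hζ) := by
  refine ⟨isHardyInfty_pairA hζ, ?_, 1, norm_one, fun z hz => ?_⟩
  · rw [integrable_congr (log_norm_pairA hζ)]
    exact (integrable_const _).add
      ((integrable_log_norm_one_sub _).sub (integrable_log_norm_one_sub _))
  · rw [one_mul, exp_integral_herglotz_pairA hζ hz]

theorem normSq_pair_identity {x : ℂ} (hx : ‖x‖ = 1) :
    pairRoot ζ * (‖1 - conj ζ * x‖ ^ 2 + 1) = ‖1 - pairRoot ζ * conj ζ * x‖ ^ 2 := by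
  have h := pairRoot_eq ζ
  have e (c : ℝ) : ‖1 - c * (conj ζ * x)‖ ^ 2 = 1 - 2 * c * (conj ζ * x).re + c ^ 2 * ‖ζ‖ ^ 2 := by
    have hn : ‖conj ζ * x‖ ^ 2 = ‖ζ‖ ^ 2 := by rw [norm_mul, hx, mul_one, RCLike.norm_conj]
    rw [← hn]
    simp only [← Complex.normSq_eq_norm_sq, Complex.normSq_apply, Complex.sub_re, Complex.sub_im,
      Complex.one_re, Complex.one_im, Complex.re_ofReal_mul, Complex.im_ofReal_mul]
    ring
  have e1 := e 1
  rw [Complex.ofReal_one, one_mul] at e1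
  rw [mul_assoc, e1, e]
  linarith

theorem norm_pairB_sq {x : ℂ} (hx : ‖x‖ = 1) :
    ‖(Real.sqrt (pairRoot ζ) : ℂ) * x / (1 - pairRoot ζ * conj ζ * x)‖ ^ 2 =
      pairRoot ζ / ‖1 - pairRoot ζ * conj ζ * x‖ ^ 2 := by
  rw [norm_div, norm_mul, hx, mul_one, div_pow, Complex.norm_real, Real.norm_eq_abs, sq_abs,
    Real.sq_sqrt (pairRoot_pos ζ).le]

theorem norm_pairA_sq (x : ℂ) :
    ‖(Real.sqrt (pairRoot ζ) : ℂ) * (1 - conj ζ * x) / (1 - pairRoot ζ * conj ζ * x)‖ ^ 2 =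
      pairRoot ζ * ‖1 - conj ζ * x‖ ^ 2 / ‖1 - pairRoot ζ * conj ζ * x‖ ^ 2 := by
  rw [norm_div, norm_mul, div_pow, mul_pow, Complex.norm_real, Real.norm_eq_abs, sq_abs,
    Real.sq_sqrt (pairRoot_pos ζ).le]

theorem pair_sq_add_sq :
    ∀ᵐ t ∂arcMeasure, ‖pairA ζ hζ t‖ ^ 2 + ‖pairB ζ hζ t‖ ^ 2 = 1 := by
  filter_upwards [coeFn_pairA hζ, coeFn_pairB hζ] with t h1 h2
  have h := one_sub_mul_ne_zero (norm_pairRoot_mul_lt hζ) (norm_toCircle t).le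
  have h' : ‖1 - pairRoot ζ * conj ζ * (AddCircle.toCircle t : ℂ)‖ ^ 2 ≠ 0 :=
    pow_ne_zero 2 (norm_ne_zero_iff.2 h)
  rw [h1, h2, norm_pairA_sq, norm_pairB_sq (norm_toCircle t), ← add_div, div_eq_one_iff_eq h',
    ← normSq_pair_identity (norm_toCircle t)]
  ring

theorem isPair_explicit : IsPair (pairB ζ hζ) (pairA ζ hζ) where
  hardy_b := isHardyInfty_pairB hζ
  norm_b := by
    have h := Lp.norm_le_of_ae_bound (f := pairB ζ hζ) zero_le_one
      ((pair_sq_add_sq hζ).mono fun t ht => by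
        refine abs_le_of_sq_le_sq' ?_ zero_le_one |>.2
        nlinarith [sq_nonneg ‖pairA ζ hζ t‖])
    simpa using h
  outer_a := isOuter_pairA hζ
  a_zero := ⟨Real.sqrt (pairRoot ζ), Real.sqrt_pos.2 (pairRoot_pos ζ), by
    rw [diskValue_pairA hζ (by simp)]; simp⟩
  sq_add_sq := pair_sq_add_sq hζ

/-- Both functions are in L², where Fourier coefficients determine them. -/
theorem Lp_top_ext {φ ψ : Lp ℂ ∞ arcMeasure} (hφ : IsHardyInfty φ) (hψ : IsHardyInfty ψ)
    (h : Set.EqOn (diskValue φ) (diskValue ψ) (ball 0 1)) : φ = ψ := by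
  have h1 := (hasTaylor_diskValue_top φ).unique (hasTaylor_diskValue_top ψ) h
  have hφ2 : MemLp φ 2 arcMeasure := (Lp.memLp φ).mono_exponent le_top
  have hψ2 : MemLp ψ 2 arcMeasure := (Lp.memLp ψ).mono_exponent le_top
  have h2 : hφ2.toLp φ = hψ2.toLp ψ := by
    refine eq_of_fourierCoeff_eq fun n => ?_
    rw [fourierCoeff_congr_ae hφ2.coeFn_toLp, fourierCoeff_congr_ae hψ2.coeFn_toLp]
    rcases lt_or_ge n 0 with hn | hn
    · rw [hφ n hn, hψ n hn]
    · obtain ⟨m, rfl⟩ := Int.eq_ofNat_of_zero_le hn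
      exact congrFun h1 m
  exact Lp.ext ((MemLp.toLp_eq_toLp_iff _ _).1 h2)

/-- Taking moduli, |1 - ζ̄λ|²(1 - |a|²) = |a|², so |a|² = |1 - ζ̄λ|²/(|1 - ζ̄λ|² + 1), whatever the
pair. -/
theorem norm_eq_of_pair_equation {b a : Lp ℂ ∞ arcMeasure} (h : IsPair b a)
    (hba : ∀ᵐ t ∂arcMeasure, (1 - conj ζ * AddCircle.toCircle t) * b t = AddCircle.toCircle t * a t) :
    ∀ᵐ t ∂arcMeasure, ‖a t‖ = ‖pairA ζ hζ t‖ := by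
  filter_upwards [hba, h.sq_add_sq, coeFn_pairA hζ] with t h1 h2 h3
  have h4 := one_sub_mul_ne_zero (norm_pairRoot_mul_lt hζ) (norm_toCircle t).le
  have h5 := congrArg (fun x => ‖x‖ ^ 2) h1
  simp only [norm_mul, norm_toCircle, one_mul, mul_pow] at h5
  have h6 := normSq_pair_identity (ζ := ζ) (norm_toCircle t)
  have hr := pairRoot_pos ζ
  refine (sq_eq_sq₀ (norm_nonneg _) (norm_nonneg _)).1 ?_
  rw [h3, norm_pairA_sq, ← h6]
  have : 0 < ‖1 - conj ζ * (AddCircle.toCircle t : ℂ)‖ ^ 2 + 1 := by positivity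
  rw [eq_div_iff (by positivity)]
  linear_combination (-pairRoot ζ) * h5 + pairRoot ζ * ‖1 - conj ζ * (AddCircle.toCircle t : ℂ)‖ ^ 2 * h2

/-- The Toeplitz operators are applied to the constant 1, so that both sides become elements of H²
with the same values on the disk, hence with the same boundary function. -/
theorem ae_eq_of_diskValue_eq {b a : Lp ℂ ∞ arcMeasure} (hb : IsHardyInfty b)
    (ha : IsHardyInfty a)
    (h : ∀ z ∈ ball (0 : ℂ) 1, (1 - conj ζ * z) * diskValue b z = z * diskValue a z) :
    ∀ᵐ t ∂arcMeasure, (1 - conj ζ * AddCircle.toCircle t) * b t = AddCircle.toCircle t * a t := by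
  have h1 : hardyShift (toeplitz a (hardyBasis 0)) =
      toeplitz b (hardyBasis 0) + (-conj ζ) • hardyShift (toeplitz b (hardyBasis 0)) :=
    hardyTwo_ext_diskValue fun z hz => by
      rw [diskValue_add _ _ hz, diskValue_smul _ _ hz, diskValue_hardyShift _ hz,
        diskValue_hardyShift _ hz, diskValue_toeplitz ha _ hz, diskValue_toeplitz hb _ hz,
        diskValue_hardyBasis _ hz]
      linear_combination -h z hz
  filter_upwards [coeFn_hardyShift (toeplitz a (hardyBasis 0)),
    coeFn_hardyTwo_combination (toeplitz b (hardyBasis 0))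
      (hardyShift (toeplitz b (hardyBasis 0))) (-conj ζ),
    coeFn_hardyShift (toeplitz b (hardyBasis 0)), coeFn_toeplitz ha (hardyBasis 0),
    coeFn_toeplitz hb (hardyBasis 0), coeFn_fourierLp (T := (1 : ℝ)) 2 0] with t e1 e2 e3 e4 e5 e6
  have e7 : ((hardyBasis 0 : hardyTwo) : Lp ℂ 2 arcMeasure) t = 1 := by
    rw [coe_hardyBasis]
    exact e6.trans (by simp)
  rw [← h1, e1, e3, e4, e5, e7] at e2
  linear_combination -e2

/-- The quotient fixes |a| on the circle, so the outer function a is a unimodular constant times the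
explicit one. Positivity at 0 makes the constant 1, and b is then given by the quotient. -/
theorem pair_unique {b a : Lp ℂ ∞ arcMeasure} (h : IsPair b a)
    (hba : ∀ z ∈ ball (0 : ℂ) 1, diskValue b z / diskValue a z = z / (1 - conj ζ * z)) :
    b = pairB ζ hζ := by
  obtain ⟨hHa, -, c, hc, hca⟩ := h.outer_a
  have hne (z : ℂ) (hz : z ∈ ball (0 : ℂ) 1) : 1 - conj ζ * z ≠ 0 := by
    rw [mul_comm]
    exact one_sub_mul_ne_zero (by simpa using hz) (by simpa using hζ)
  have ha0 (z : ℂ) (hz : z ∈ ball (0 : ℂ) 1) : diskValue a z ≠ 0 := by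
    rw [hca z hz]
    refine mul_ne_zero (fun h0 => ?_) (Complex.exp_ne_zero _)
    rw [h0, norm_zero] at hc
    exact zero_ne_one hc
  have heq (z : ℂ) (hz : z ∈ ball (0 : ℂ) 1) :
      (1 - conj ζ * z) * diskValue b z = z * diskValue a z := by
    have := hba z hz
    rw [div_eq_div_iff (ha0 z hz) (hne z hz)] at this
    linear_combination this
  have hnorm := norm_eq_of_pair_equation hζ h (ae_eq_of_diskValue_eq h.hardy_b hHa heq)
  have hdisk (z : ℂ) (hz : z ∈ ball (0 : ℂ) 1) :
      diskValue a z = c * diskValue (pairA ζ hζ) z := by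
    rw [hca z hz, ← exp_integral_herglotz_pairA hζ hz]
    congr 2
    refine integral_congr_ae ?_
    filter_upwards [hnorm] with t ht
    rw [ht]
  have hc1 : c = 1 := by
    obtain ⟨x, hx, hx0⟩ := h.a_zero
    have h1 := hdisk 0 (by simp)
    rw [hx0, diskValue_pairA hζ (by simp)] at h1
    simp only [mul_zero, sub_zero, div_one, mul_one] at h1
    have hr := Real.sqrt_pos.2 (pairRoot_pos ζ)
    have h2 : c = ((x / Real.sqrt (pairRoot ζ) : ℝ) : ℂ) := by
      rw [Complex.ofReal_div, h1, mul_div_assoc, div_self (by exact_mod_cast hr.ne'), mul_one]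
    rw [h2, Complex.norm_real, Real.norm_of_nonneg (by positivity)] at hc
    rw [h2, hc, Complex.ofReal_one]
  refine Lp_top_ext h.hardy_b (isHardyInfty_pairB hζ) fun z hz => ?_
  have h1 := heq z hz
  rw [hdisk z hz, hc1, one_mul, diskValue_pairA hζ hz] at h1
  rw [diskValue_pairB hζ hz]
  have h3 := one_sub_mul_ne_zero (norm_pairRoot_mul_lt hζ) (mem_ball_zero_iff.1 hz).le
  refine mul_left_cancel₀ (hne z hz) (h1.trans ?_)
  ring

theorem pair_quotient {z : ℂ} (hz : z ∈ ball (0 : ℂ) 1) :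
    diskValue (pairB ζ hζ) z / diskValue (pairA ζ hζ) z = z / (1 - conj ζ * z) := by
  have h3 := one_sub_mul_ne_zero (norm_pairRoot_mul_lt hζ) (mem_ball_zero_iff.1 hz).le
  rw [diskValue_pairB hζ hz, diskValue_pairA hζ hz, div_div_div_cancel_right₀ h3,
    mul_div_mul_left _ _ (sqrt_pairRoot_ne_zero ζ)]

end

/-! ### Orthogonality of monomials on circles and disks -/

theorem fourier_natCast_apply (n : ℕ) (t : Torus) :
    (fourier (n : ℤ) t : ℂ) = (AddCircle.toCircle t : ℂ) ^ n := by
  rw [fourier_apply, natCast_zsmul, AddCircle.toCircle_nsmul, Circle.coe_pow]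

/-- Parseval for the dilate h(r ·), whose coefficients c_n rⁿ are absolutely summable because r < 1.
-/
theorem hasSum_norm_sq_circle {h : ℂ → ℂ} {c : ℕ → ℂ} (hc : HasTaylor h c) {r : ℝ} (hr : 0 ≤ r)
    (hr1 : r < 1) :
    HasSum (fun n => ‖c n‖ ^ 2 * r ^ (2 * n))
      (∫ t : Torus, ‖h (r * AddCircle.toCircle t)‖ ^ 2 ∂arcMeasure) := by
  have hrb : (r : ℂ) ∈ ball (0 : ℂ) 1 := by simpa [abs_of_nonneg hr] using hr1
  have hs := hc.summable_norm hrb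
  set u : ℕ → ℂ := fun n => c n * (r : ℂ) ^ n with hu
  have hus : Summable fun n => ‖u n‖ ^ 2 := by
    refine Summable.of_norm_bounded_eventually_nat (g := fun n => ‖u n‖) hs ?_
    filter_upwards [hs.tendsto_atTop_zero.eventually_le_const one_pos] with n hn
    rw [Real.norm_of_nonneg (by positivity), sq]
    exact mul_le_of_le_one_right (norm_nonneg _) hn
  obtain ⟨F, hF⟩ := exists_hardyTwo_of_summable hus
  have hsum := hasSum_norm_sq_coeff F
  simp only [hF] at hsum
  -- The series converges uniformly on the circle, to the dilate of h. In L² the same series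
  -- converges to F, so the two agree almost everywhere.
  have hC : Summable fun n : ℕ => u n • (fourier (n : ℤ) : C(Torus, ℂ)) := by
    refine Summable.of_norm ?_
    simpa only [norm_smul, fourier_norm, mul_one] using hs
  have hL1 := hC.hasSum.map (ContinuousMap.toLp (E := ℂ) 2 arcMeasure ℂ)
    (ContinuousMap.toLp (E := ℂ) 2 arcMeasure ℂ).continuous
  have hL2 := hardyTwo.subtypeL.hasSum (hardyBasis.hasSum_repr F)
  have hL3 : HasSum (fun n : ℕ => u n • (fourierLp 2 (n : ℤ) : Lp ℂ 2 arcMeasure))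
      (F : Lp ℂ 2 arcMeasure) := by
    simpa only [map_smul, hardyBasis_repr, Submodule.subtypeL_apply, coe_hardyBasis, hF] using hL2
  have hL4 : HasSum (fun n : ℕ => u n • (fourierLp 2 (n : ℤ) : Lp ℂ 2 arcMeasure))
      (ContinuousMap.toLp (E := ℂ) 2 arcMeasure ℂ
        (∑' n : ℕ, u n • (fourier (n : ℤ) : C(Torus, ℂ)))) := by
    convert hL1 using 2
    simp [fourierLp, map_smul]
  have hEq := hL3.unique hL4
  have hval (t : Torus) : (∑' n : ℕ, u n • (fourier (n : ℤ) : C(Torus, ℂ))) t =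
      h (r * AddCircle.toCircle t) := by
    have h1 : HasSum (fun n => u n * (AddCircle.toCircle t : ℂ) ^ n)
        ((∑' n : ℕ, u n • (fourier (n : ℤ) : C(Torus, ℂ))) t) := by
      have := hC.hasSum.map (ContinuousMap.evalCLM ℂ t) (ContinuousMap.evalCLM ℂ t).continuous
      refine this.congr_fun fun n => ?_
      rw [← fourier_natCast_apply]
      rfl
    refine h1.unique ?_
    refine (hc (r * AddCircle.toCircle t) ?_).congr_fun fun n => ?_
    · rw [mem_ball_zero_iff, norm_mul, norm_toCircle, mul_one]
      simpa using hrb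
    · simp only [hu, mul_pow]; ring
  have hnorm : ‖F‖ ^ 2 = ∫ t : Torus, ‖h (r * AddCircle.toCircle t)‖ ^ 2 ∂arcMeasure := by
    rw [Submodule.coe_norm, norm_sq_eq_integral]
    refine integral_congr_ae ?_
    rw [hEq]
    filter_upwards [ContinuousMap.coeFn_toLp (p := 2) (𝕜 := ℂ) arcMeasure
      (∑' n : ℕ, u n • (fourier (n : ℤ) : C(Torus, ℂ)))] with t ht
    rw [ht, hval]
  rw [← hnorm]
  refine hsum.congr_fun fun n => ?_
  simp only [hu, norm_mul, norm_pow, Complex.norm_real, Real.norm_of_nonneg hr]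
  ring

/-- The angle runs over (-π, π) to match the target of `polarCoord`. -/
theorem integral_toCircle_eq_intervalIntegral (g : ℂ → ℝ) :
    ∫ θ in (-Real.pi)..Real.pi, g (circleMap 0 1 θ) =
      2 * Real.pi * ∫ t : Torus, g (AddCircle.toCircle t) ∂arcMeasure := by
  rw [← volume_torus, ← UnitAddCircle.intervalIntegral_preimage (-(1 / 2))
    (fun t => g (AddCircle.toCircle t))]
  simp only [toCircle_coe_eq_circleMap]
  have := intervalIntegral.mul_integral_comp_mul_left (a := -(1 / 2)) (b := -(1 / 2) + 1)
    (f := fun θ => g (circleMap 0 1 θ)) (2 * Real.pi)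
  rw [this]
  congr 1 <;> ring

theorem lintegral_circle {h : ℂ → ℂ} {c : ℕ → ℂ} (hc : HasTaylor h c) {r : ℝ} (hr : 0 ≤ r)
    (hr1 : r < 1) :
    ∫⁻ θ in Set.Ioo (-Real.pi) Real.pi, ENNReal.ofReal (‖h (r * circleMap 0 1 θ)‖ ^ 2) =
      ENNReal.ofReal (2 * Real.pi) * ∑' n, ‖c n‖ₑ ^ 2 * ENNReal.ofReal (r ^ (2 * n)) := by
  have hs := hasSum_norm_sq_circle hc hr hr1
  have hcont : Continuous fun θ : ℝ => ‖h (r * circleMap 0 1 θ)‖ ^ 2 := by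
    refine (Continuous.norm ?_).pow 2
    refine hc.differentiableOn.continuousOn.comp_continuous (by fun_prop) fun θ => ?_
    simpa [abs_of_nonneg hr] using hr1
  rw [← ofReal_integral_eq_lintegral_ofReal, ← integral_Ioc_eq_integral_Ioo,
    ← intervalIntegral.integral_of_le (by linarith [Real.pi_pos]),
    integral_toCircle_eq_intervalIntegral (fun x => ‖h (r * x)‖ ^ 2), ← hs.tsum_eq,
    ENNReal.ofReal_mul (by positivity),
    ENNReal.ofReal_tsum_of_nonneg (fun n => by positivity) hs.summable]
  · congr 1
    refine tsum_congr fun n => ?_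
    rw [ENNReal.ofReal_mul (by positivity), ENNReal.ofReal_pow (norm_nonneg _), ofReal_norm]
  · exact (hcont.integrableOn_Icc (a := -Real.pi) (b := Real.pi)).mono_set Set.Ioo_subset_Icc_self
  · exact Filter.Eventually.of_forall fun θ => by positivity

/-- Monomials are orthogonal on the disk for every radial weight. -/
theorem lintegral_ball_radial {h : ℂ → ℂ} {c : ℕ → ℂ} (hc : HasTaylor h c) {ρ : ℝ → ℝ}
    (hρ : Measurable ρ) (hρ0 : ∀ r ∈ Set.Ioo (0 : ℝ) 1, 0 ≤ ρ r) :
    ∫⁻ z in ball (0 : ℂ) 1, ENNReal.ofReal (‖h z‖ ^ 2 * ρ ‖z‖) =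
      ∑' n, ‖c n‖ₑ ^ 2 * (ENNReal.ofReal (2 * Real.pi) *
        ∫⁻ r in Set.Ioo (0 : ℝ) 1, ENNReal.ofReal (r ^ (2 * n + 1) * ρ r)) := by
  set g : ℂ → ℝ≥0∞ := (ball (0 : ℂ) 1).indicator
    fun z => ENNReal.ofReal (‖h z‖ ^ 2 * ρ ‖z‖) with hg
  have hgm : Measurable g := by
    classical
    have hm : Measurable ((ball (0 : ℂ) 1).piecewise h 0) :=
      hc.differentiableOn.continuousOn.measurable_piecewise continuousOn_const measurableSet_ball
    -- Nothing is known about h off the disk, so it is replaced by 0 there for measurability.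
    have h1 : g = (ball (0 : ℂ) 1).indicator fun z =>
        ENNReal.ofReal (‖(ball (0 : ℂ) 1).piecewise h 0 z‖ ^ 2 * ρ ‖z‖) := by
      refine Set.indicator_congr fun z hz => ?_
      rw [Set.piecewise_eq_of_mem _ _ _ hz]
    rw [h1]
    exact Measurable.indicator (by fun_prop) measurableSet_ball
  rw [← lintegral_indicator measurableSet_ball, ← hg, ← Complex.lintegral_comp_polarCoord_symm]
  have htarget : polarCoord.target = Set.Ioi (0 : ℝ) ×ˢ Set.Ioo (-Real.pi) Real.pi := rfl
  have hcoord (r θ : ℝ) : Complex.polarCoord.symm (r, θ) = r * circleMap 0 1 θ := by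
    rw [Complex.polarCoord_symm_apply]
    simp [circleMap, Complex.exp_mul_I]
  have hmeas : Measurable fun p : ℝ × ℝ =>
      ENNReal.ofReal p.1 • g (Complex.polarCoord.symm p) := by
    have : Measurable fun p : ℝ × ℝ => Complex.polarCoord.symm p := by
      simp only [Complex.polarCoord_symm_apply]
      fun_prop
    exact (ENNReal.measurable_ofReal.comp measurable_fst).smul (hgm.comp this)
  rw [htarget, Measure.volume_eq_prod, ← Measure.prod_restrict,
    lintegral_prod _ hmeas.aemeasurable]
  have hinner : ∀ r ∈ Set.Ioi (0 : ℝ), ∫⁻ θ in Set.Ioo (-Real.pi) Real.pi,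
      ENNReal.ofReal r • g (Complex.polarCoord.symm (r, θ)) =
      (Set.Ioo (0 : ℝ) 1).indicator (fun r => ∑' n, ‖c n‖ₑ ^ 2 * (ENNReal.ofReal (2 * Real.pi) *
        ENNReal.ofReal (r ^ (2 * n + 1) * ρ r))) r := by
    intro r hr
    have hr : 0 < r := hr
    have hnorm (θ : ℝ) : ‖(r : ℂ) * circleMap 0 1 θ‖ = r := by
      simp [abs_of_pos hr]
    by_cases hr1 : r < 1
    · have hgr (θ : ℝ) : ENNReal.ofReal r • g (Complex.polarCoord.symm (r, θ)) =
          ENNReal.ofReal (r * ρ r) * ENNReal.ofReal (‖h (r * circleMap 0 1 θ)‖ ^ 2) := by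
        rw [hcoord, hg, Set.indicator_of_mem (by rwa [mem_ball_zero_iff, hnorm]), hnorm,
          smul_eq_mul, ← ENNReal.ofReal_mul hr.le,
          ← ENNReal.ofReal_mul (mul_nonneg hr.le (hρ0 r ⟨hr, hr1⟩))]
        congr 1; ring
      simp only [hgr]
      rw [lintegral_const_mul' _ _ ENNReal.ofReal_ne_top, lintegral_circle hc hr.le hr1,
        Set.indicator_of_mem (show r ∈ Set.Ioo (0 : ℝ) 1 from ⟨hr, hr1⟩), ← mul_assoc,
        ← ENNReal.tsum_mul_left]
      refine tsum_congr fun n => ?_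
      have : ENNReal.ofReal (r ^ (2 * n + 1) * ρ r) =
          ENNReal.ofReal (r * ρ r) * ENNReal.ofReal (r ^ (2 * n)) := by
        rw [← ENNReal.ofReal_mul (mul_nonneg hr.le (hρ0 r ⟨hr, hr1⟩))]
        congr 1; ring
      rw [this]
      ring
    · have hgr (θ : ℝ) : g (Complex.polarCoord.symm (r, θ)) = 0 := by
        rw [hcoord, hg, Set.indicator_of_notMem (by rwa [mem_ball_zero_iff, hnorm])]
      rw [Set.indicator_of_notMem (fun h => hr1 h.2)]
      simp only [hgr, smul_zero, lintegral_zero]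
  rw [setLIntegral_congr_fun measurableSet_Ioi hinner, setLIntegral_indicator measurableSet_Ioo,
    Set.inter_eq_left.2 (fun x hx => hx.1), lintegral_tsum fun n => by fun_prop]
  refine tsum_congr fun n => ?_
  rw [lintegral_const_mul' _ _ (by finiteness), lintegral_const_mul' _ _ ENNReal.ofReal_ne_top]

/-! ### Radial moments -/

theorem lintegral_moment_one_sub_sq (n : ℕ) :
    ∫⁻ r in Set.Ioo (0 : ℝ) 1, ENNReal.ofReal (r ^ (2 * n + 1) * (1 - r ^ 2)) =
      ENNReal.ofReal (1 / (2 * ((n + 1) * (n + 2)))) := by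
  have hc : Continuous fun r : ℝ => r ^ (2 * n + 1) * (1 - r ^ 2) := by fun_prop
  rw [← ofReal_integral_eq_lintegral_ofReal, ← integral_Ioc_eq_integral_Ioo,
    ← intervalIntegral.integral_of_le zero_le_one]
  · congr 1
    have : ∀ r : ℝ, r ^ (2 * n + 1) * (1 - r ^ 2) = r ^ (2 * n + 1) - r ^ (2 * n + 3) :=
      fun r => by ring
    simp only [this]
    rw [intervalIntegral.integral_sub (by simp) (by simp), integral_pow, integral_pow]
    have h1 : (n : ℝ) + 1 ≠ 0 := by positivity
    have h2 : (n : ℝ) + 2 ≠ 0 := by positivity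
    have h3 : (2 * n + 1 + 1 : ℝ) ≠ 0 := by positivity
    have h4 : (2 * n + 3 + 1 : ℝ) ≠ 0 := by positivity
    push_cast
    simp
    field_simp
    ring
  · exact (hc.integrableOn_Icc (a := 0) (b := 1)).mono_set Set.Ioo_subset_Icc_self
  · refine (ae_restrict_iff' measurableSet_Ioo).2 (Filter.Eventually.of_forall fun r hr => ?_)
    have h1 : 0 ≤ r := hr.1.le
    have : 0 ≤ 1 - r ^ 2 := by nlinarith [hr.1, hr.2]
    simp only [Pi.zero_apply]
    positivity

theorem lintegral_moment_log (n : ℕ) :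
    ∫⁻ r in Set.Ioo (0 : ℝ) 1, ENNReal.ofReal (r ^ (2 * n + 1) * (-2 * Real.log r)) =
      ENNReal.ofReal (1 / (2 * (n + 1) ^ 2)) := by
  have hc : Continuous fun r : ℝ => r ^ (2 * n + 1) * (-2 * Real.log r) := by
    have h1 : (fun r : ℝ => r ^ (2 * n + 1) * (-2 * Real.log r)) =
        fun r => -2 * r ^ (2 * n) * (r * Real.log r) := by funext r; ring
    rw [h1]
    exact (by fun_prop : Continuous fun r : ℝ => -2 * r ^ (2 * n)).mul Real.continuous_mul_log
  rw [← ofReal_integral_eq_lintegral_ofReal, ← integral_Ioc_eq_integral_Ioo,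
    ← intervalIntegral.integral_of_le zero_le_one]
  · congr 1
    have hn : ((n : ℝ) + 1) ≠ 0 := by positivity
    -- The antiderivative keeps r log r as a factor, since this function is continuous at 0 and no
    -- limit has to be taken there.
    rw [intervalIntegral.integral_eq_sub_of_hasDerivAt_of_le zero_le_one
      (f := fun r => -(r ^ (2 * n + 1) * (r * Real.log r)) / (n + 1) +
        r ^ (2 * n + 2) / (2 * (n + 1) ^ 2))]
    · simp
    · refine ContinuousOn.add ?_ (by fun_prop)
      refine (Continuous.div_const (Continuous.neg ?_) _).continuousOn
      exact (by fun_prop : Continuous fun r : ℝ => r ^ (2 * n + 1)).mul Real.continuous_mul_log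
    · intro r hr
      have hr0 : r ≠ 0 := hr.1.ne'
      have h1 := (((hasDerivAt_pow (2 * n + 1) r).mul (Real.hasDerivAt_mul_log hr0)).neg.div_const
        ((n : ℝ) + 1)).add ((hasDerivAt_pow (2 * n + 2) r).div_const (2 * ((n : ℝ) + 1) ^ 2))
      refine HasDerivAt.congr_deriv h1 ?_
      rw [show 2 * n + 1 - 1 = 2 * n by omega, show 2 * n + 2 - 1 = 2 * n + 1 by omega]
      push_cast
      field_simp
      ring
    · exact hc.intervalIntegrable _ _
  · exact (hc.integrableOn_Icc (a := 0) (b := 1)).mono_set Set.Ioo_subset_Icc_self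
  · refine (ae_restrict_iff' measurableSet_Ioo).2 (Filter.Eventually.of_forall fun r hr => ?_)
    have h1 : 0 ≤ r := hr.1.le
    have := Real.log_nonpos h1 hr.2.le
    have h2 : 0 ≤ -2 * Real.log r := by linarith
    simp only [Pi.zero_apply]
    positivity

/-- The Littlewood–Paley formula. -/
theorem littlewood_paley {F : ℂ → ℂ} {c : ℕ → ℂ} (hF : HasTaylor F c) :
    ENNReal.ofReal (1 / Real.pi) *
      ∫⁻ z in ball (0 : ℂ) 1, ENNReal.ofReal (‖deriv F z‖ ^ 2 * (-2 * Real.log ‖z‖)) =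
      ∑' n, ‖c (n + 1)‖ₑ ^ 2 := by
  rw [lintegral_ball_radial hF.deriv (ρ := fun r => -2 * Real.log r) (by fun_prop)
    (fun r hr => by have := Real.log_nonpos hr.1.le hr.2.le; linarith), ← ENNReal.tsum_mul_left]
  refine tsum_congr fun n => ?_
  rw [lintegral_moment_log, enorm_mul, mul_pow, ← ofReal_norm ((n : ℂ) + 1),
    ← ENNReal.ofReal_pow (norm_nonneg _), ← ENNReal.ofReal_mul (by positivity)]
  have h1 : ‖(n : ℂ) + 1‖ = n + 1 := by
    rw [show (n : ℂ) + 1 = ((n + 1 : ℝ) : ℂ) by push_cast; rfl, Complex.norm_real,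
      Real.norm_of_nonneg (by positivity)]
  rw [h1]
  have h2 : ENNReal.ofReal (1 / Real.pi) * ENNReal.ofReal (((n : ℝ) + 1) ^ 2) *
      ENNReal.ofReal (2 * Real.pi * (1 / (2 * (n + 1) ^ 2))) = 1 := by
    rw [← ENNReal.ofReal_mul (by positivity), ← ENNReal.ofReal_mul (by positivity),
      ← ENNReal.ofReal_one]
    congr 1
    have := Real.pi_ne_zero
    field_simp
  calc _ = (ENNReal.ofReal (1 / Real.pi) * ENNReal.ofReal (((n : ℝ) + 1) ^ 2) *
      ENNReal.ofReal (2 * Real.pi * (1 / (2 * (n + 1) ^ 2)))) * ‖c (n + 1)‖ₑ ^ 2 := by ring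
    _ = _ := by rw [h2, one_mul]

/-- The non-radial factor |ζ - z|⁻² of the Poisson kernel is absorbed into the holomorphic function
f'/(ζ - z), leaving the radial weight 1 - |z|². -/
theorem dirichletIntegral_of_norm_eq_one {ζ : ℂ} (hζ : ‖ζ‖ = 1) {f : ℂ → ℂ} {d : ℕ → ℂ}
    (hd : HasTaylor (fun z => deriv f z / (ζ - z)) d) :
    dirichletIntegral ζ f =
      ∑' n : ℕ, ‖d n‖ₑ ^ 2 * ENNReal.ofReal (1 / ((n + 1) * (n + 2))) := by
  have h1 : ∀ z ∈ ball (0 : ℂ) 1, ENNReal.ofReal (‖deriv f z‖ ^ 2 * dirichletWeight ζ z) =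
      ENNReal.ofReal (‖deriv f z / (ζ - z)‖ ^ 2 * (1 - ‖z‖ ^ 2)) := by
    intro z hz
    rw [dirichletWeight, if_neg (by rw [hζ]; exact lt_irrefl 1), norm_div, div_pow]
    congr 1
    ring
  rw [dirichletIntegral, setLIntegral_congr_fun measurableSet_ball h1,
    lintegral_ball_radial hd (ρ := fun r => 1 - r ^ 2) (by fun_prop)
      (fun r hr => by nlinarith [hr.1, hr.2]), ← ENNReal.tsum_mul_left]
  refine tsum_congr fun n => ?_
  rw [lintegral_moment_one_sub_sq]
  calc _ = ‖d n‖ₑ ^ 2 * (ENNReal.ofReal (1 / Real.pi) * (ENNReal.ofReal (2 * Real.pi) *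
      ENNReal.ofReal (1 / (2 * ((n + 1) * (n + 2)))))) := by ring
    _ = _ := by
      rw [← ENNReal.ofReal_mul (by positivity), ← ENNReal.ofReal_mul (by positivity)]
      congr 2
      have := Real.pi_ne_zero
      field_simp

/-! ### A discrete Hardy identity -/

section Discrete

open Finset Filter Topology

variable {γ : ℕ → ℂ}

/-- The sums `D_n = ∑_{k ≤ n} (k + 1) (γ_k - γ_{k+1})`. -/
noncomputable def hardyDiff (γ : ℕ → ℂ) (n : ℕ) : ℂ :=
  ∑ k ∈ range (n + 1), ((k : ℂ) + 1) * (γ k - γ (k + 1))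

theorem hardyDiff_eq (γ : ℕ → ℂ) (n : ℕ) :
    hardyDiff γ n = ∑ k ∈ range (n + 1), γ k - ((n : ℂ) + 1) * γ (n + 1) := by
  induction n with
  | zero => simp [hardyDiff]
  | succ n ih =>
    rw [hardyDiff, sum_range_succ, ← hardyDiff, ih, sum_range_succ _ (n + 1)]
    push_cast
    ring

/-- With s = γ_0 + … + γ_n, g = γ_{n+1} and m = n + 1, the left side is the n-th term of the
weighted sum of |D_n|², and the first two terms on the right telescope. -/
theorem norm_sub_mul_sq_div (s g : ℂ) {m : ℝ} (hm : 0 < m) :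
    ‖s - m * g‖ ^ 2 / (m * (m + 1)) = ‖s‖ ^ 2 / m - ‖s + g‖ ^ 2 / (m + 1) + ‖g‖ ^ 2 := by
  simp only [← Complex.normSq_eq_norm_sq, Complex.normSq_apply, Complex.sub_re, Complex.sub_im,
    Complex.add_re, Complex.add_im, Complex.re_ofReal_mul, Complex.im_ofReal_mul]
  field_simp
  ring

theorem sum_hardyDiff (γ : ℕ → ℂ) (N : ℕ) :
    ∑ n ∈ range N, ‖hardyDiff γ n‖ ^ 2 * (1 / (((n : ℝ) + 1) * (n + 2))) =
      ∑ n ∈ range (N + 1), ‖γ n‖ ^ 2 - ‖∑ k ∈ range (N + 1), γ k‖ ^ 2 / ((N : ℝ) + 1) := by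
  induction N with
  | zero => simp
  | succ N ih =>
    have h := norm_sub_mul_sq_div (∑ k ∈ range (N + 1), γ k) (γ (N + 1))
      (m := (N : ℝ) + 1) (by positivity)
    rw [sum_range_succ, ih, hardyDiff_eq, sum_range_succ _ (N + 1), sum_range_succ _ (N + 1)]
    push_cast at h ⊢
    rw [show (N : ℝ) + 1 + 1 = N + 2 by ring] at h ⊢
    rw [mul_one_div, h]
    ring

theorem norm_sum_sq_le (s : Finset ℕ) : ‖∑ k ∈ s, γ k‖ ^ 2 ≤ #s * ∑ k ∈ s, ‖γ k‖ ^ 2 := by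
  refine (pow_le_pow_left₀ (norm_nonneg _) (norm_sum_le s γ) 2).trans ?_
  exact sq_sum_le_card_mul_sum_sq

theorem tendsto_norm_sum_sq_div (hγ : Summable fun n => ‖γ n‖ ^ 2) :
    Tendsto (fun N : ℕ => ‖∑ k ∈ range (N + 1), γ k‖ ^ 2 / ((N : ℝ) + 1)) atTop (𝓝 0) := by
  rw [Metric.tendsto_atTop]
  intro ε hε
  -- The sum is split at M. The tail of ∑|γ_k|² beyond M is below ε/4, which Cauchy–Schwarz passes
  -- on to the average; the head is fixed and is killed by the division by N + 1. Each part costs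
  -- ε/2, because |x + y|² ≤ 2|x|² + 2|y|².
  obtain ⟨M, hM⟩ := ((tendsto_sum_nat_add fun n => ‖γ n‖ ^ 2).eventually
    (gt_mem_nhds (show (0 : ℝ) < ε / 4 by positivity))).exists
  have hlim : Tendsto (fun N : ℕ => 2 * ‖∑ k ∈ range M, γ k‖ ^ 2 * (1 / ((N : ℝ) + 1))) atTop
      (𝓝 0) := by
    have := (tendsto_one_div_add_atTop_nhds_zero_nat (𝕜 := ℝ)).const_mul
      (2 * ‖∑ k ∈ range M, γ k‖ ^ 2)
    rwa [mul_zero] at this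
  obtain ⟨N₀, hN₀⟩ := (hlim.eventually
    (gt_mem_nhds (show (0 : ℝ) < ε / 2 by positivity))).exists_forall_of_atTop
  refine ⟨max M N₀, fun N hN => ?_⟩
  have hMN : M ≤ N + 1 := (le_max_left M N₀).trans (hN.trans (Nat.le_succ N))
  have h1 := hN₀ N ((le_max_right M N₀).trans hN)
  have hpos : (0 : ℝ) < (N : ℝ) + 1 := by positivity
  rw [Real.dist_0_eq_abs, abs_of_nonneg (by positivity), div_lt_iff₀ hpos]
  rw [mul_one_div, div_lt_iff₀ hpos] at h1
  have hsplit : ∑ k ∈ range (N + 1), γ k = ∑ k ∈ range M, γ k + ∑ k ∈ Ico M (N + 1), γ k :=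
    (sum_range_add_sum_Ico _ hMN).symm
  have htail : ∑ k ∈ Ico M (N + 1), ‖γ k‖ ^ 2 ≤ ε / 4 := by
    rw [sum_Ico_eq_sum_range]
    refine le_trans ?_ hM.le
    have := ((summable_nat_add_iff M).2 hγ).sum_le_tsum (range (N + 1 - M))
      (fun i _ => by positivity)
    simpa [add_comm] using this
  have h2 : ‖∑ k ∈ Ico M (N + 1), γ k‖ ^ 2 ≤ ((N : ℝ) + 1) * (ε / 4) := by
    refine (norm_sum_sq_le _).trans ?_
    gcongr
    rw [Nat.card_Ico]
    have : ((N + 1 - M : ℕ) : ℝ) ≤ ((N + 1 : ℕ) : ℝ) := Nat.cast_le.2 (Nat.sub_le _ _)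
    exact_mod_cast this
  have h3 : ‖∑ k ∈ range (N + 1), γ k‖ ^ 2 ≤
      2 * ‖∑ k ∈ range M, γ k‖ ^ 2 + 2 * ‖∑ k ∈ Ico M (N + 1), γ k‖ ^ 2 := by
    rw [hsplit]
    have := norm_add_le (∑ k ∈ range M, γ k) (∑ k ∈ Ico M (N + 1), γ k)
    nlinarith [sq_nonneg (‖∑ k ∈ range M, γ k‖ - ‖∑ k ∈ Ico M (N + 1), γ k‖),
      norm_nonneg (∑ k ∈ range M, γ k + ∑ k ∈ Ico M (N + 1), γ k)]
  linarith

theorem hasSum_hardyDiff (hγ : Summable fun n => ‖γ n‖ ^ 2) :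
    HasSum (fun n => ‖hardyDiff γ n‖ ^ 2 * (1 / (((n : ℝ) + 1) * (n + 2))))
      (∑' n, ‖γ n‖ ^ 2) := by
  rw [hasSum_iff_tendsto_nat_of_nonneg (fun n => by positivity)]
  simp only [sum_hardyDiff]
  have h1 := (tendsto_add_atTop_iff_nat 1).2 hγ.hasSum.tendsto_sum_nat
  simpa using h1.sub (tendsto_norm_sum_sq_div hγ)

theorem hasSum_telescope : HasSum (fun n : ℕ => 1 / (((n : ℝ) + 1) * (n + 2))) 1 := by
  rw [hasSum_iff_tendsto_nat_of_nonneg (fun n => by positivity)]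
  have h (N : ℕ) : ∑ n ∈ range N, 1 / (((n : ℝ) + 1) * (n + 2)) = 1 - 1 / ((N : ℝ) + 1) := by
    induction N with
    | zero => simp
    | succ N ih =>
      rw [sum_range_succ, ih]
      push_cast
      field_simp
      ring
  simp only [h]
  simpa using tendsto_one_div_add_atTop_nhds_zero_nat.const_sub (1 : ℝ)

theorem average_sub_average (γ : ℕ → ℂ) (n : ℕ) :
    (∑ k ∈ range (n + 1), γ k) / ((n : ℂ) + 1) - (∑ k ∈ range (n + 2), γ k) / ((n : ℂ) + 2) =
      hardyDiff γ n * ((1 / (((n : ℝ) + 1) * (n + 2)) : ℝ) : ℂ) := by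
  have h1 : (n : ℂ) + 1 ≠ 0 := by exact_mod_cast n.succ_ne_zero
  have h2 : (n : ℂ) + 2 ≠ 0 := by exact_mod_cast (n + 1).succ_ne_zero
  rw [hardyDiff_eq, sum_range_succ _ (n + 1)]
  push_cast
  field_simp
  ring

/-- Consecutive averages differ by D_n q_n with q_n = 1/((n+1)(n+2)). Cauchy–Schwarz with the
weights q_n, whose tail from m is at most 1/(m+1), gives the rate of convergence. -/
theorem norm_average_sub_sq_le
    (hD : Summable fun n => ‖hardyDiff γ n‖ ^ 2 * (1 / (((n : ℝ) + 1) * (n + 2)))) (m j : ℕ) :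
    ‖(∑ k ∈ range (m + 1), γ k) / ((m : ℂ) + 1) -
      (∑ k ∈ range (m + j + 1), γ k) / (((m + j : ℕ) : ℂ) + 1)‖ ^ 2 ≤
      (∑' n, ‖hardyDiff γ n‖ ^ 2 * (1 / (((n : ℝ) + 1) * (n + 2)))) * (1 / ((m : ℝ) + 1)) := by
  set q : ℕ → ℝ := fun n => 1 / (((n : ℝ) + 1) * (n + 2)) with hq
  have hq0 (n : ℕ) : 0 ≤ q n := by simp only [hq]; positivity
  have htel : (∑ k ∈ range (m + 1), γ k) / ((m : ℂ) + 1) -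
      (∑ k ∈ range (m + j + 1), γ k) / (((m + j : ℕ) : ℂ) + 1) =
      ∑ n ∈ Ico m (m + j), hardyDiff γ n * (q n : ℂ) := by
    induction j with
    | zero => simp
    | succ j ih =>
      rw [← add_assoc, sum_Ico_succ_top (Nat.le_add_right m j), ← ih,
        ← average_sub_average γ (m + j)]
      push_cast
      ring
  have hqsum : ∑ n ∈ Ico m (m + j), q n ≤ 1 / ((m : ℝ) + 1) := by
    have h (j : ℕ) : ∑ n ∈ Ico m (m + j), q n = 1 / ((m : ℝ) + 1) - 1 / ((m : ℝ) + j + 1) := by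
      induction j with
      | zero => simp
      | succ j ih =>
        rw [← add_assoc, sum_Ico_succ_top (Nat.le_add_right m j), ih]
        simp only [hq]
        push_cast
        field_simp
        ring
    rw [h]
    have : 0 ≤ 1 / ((m : ℝ) + j + 1) := by positivity
    linarith
  rw [htel]
  have h1 : ‖∑ n ∈ Ico m (m + j), hardyDiff γ n * (q n : ℂ)‖ ≤
      ∑ n ∈ Ico m (m + j), (‖hardyDiff γ n‖ * Real.sqrt (q n)) * Real.sqrt (q n) := by
    refine (norm_sum_le _ _).trans (le_of_eq (sum_congr rfl fun n _ => ?_))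
    rw [norm_mul, Complex.norm_real, Real.norm_of_nonneg (hq0 n), mul_assoc,
      Real.mul_self_sqrt (hq0 n)]
  refine (pow_le_pow_left₀ (norm_nonneg _) h1 2).trans ?_
  refine (sum_mul_sq_le_sq_mul_sq _ _ _).trans ?_
  simp only [mul_pow, Real.sq_sqrt (hq0 _)]
  have h2 := hD.sum_le_tsum (Ico m (m + j)) (fun n _ => mul_nonneg (by positivity) (hq0 n))
  refine mul_le_mul h2 hqsum (sum_nonneg fun n _ => hq0 n) (tsum_nonneg fun n => ?_)
  exact mul_nonneg (by positivity) (hq0 n)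

theorem hardyDiff_sub_const (γ : ℕ → ℂ) (L : ℂ) :
    hardyDiff (fun n => γ n - L) = hardyDiff γ := by
  funext n
  simp [hardyDiff]

/-- If the weighted sum of `|D_n|²` is finite, then `γ` is square summable up to a constant. -/
theorem exists_summable_sub_const
    (hD : Summable fun n => ‖hardyDiff γ n‖ ^ 2 * (1 / (((n : ℝ) + 1) * (n + 2)))) :
    ∃ L : ℂ, Summable fun n => ‖γ n - L‖ ^ 2 := by
  set σ : ℕ → ℂ := fun m => (∑ k ∈ range (m + 1), γ k) / ((m : ℂ) + 1) with hσ
  set E : ℝ := ∑' n, ‖hardyDiff γ n‖ ^ 2 * (1 / (((n : ℝ) + 1) * (n + 2))) with hE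
  have hbound (m j : ℕ) : ‖σ m - σ (m + j)‖ ^ 2 ≤ E * (1 / ((m : ℝ) + 1)) :=
    norm_average_sub_sq_le hD m j
  -- Consecutive differences have norm x q ≤ (x²q + q)/2 with x = |D_n|, and both terms are
  -- summable.
  have hc : CauchySeq σ := by
    refine cauchySeq_of_dist_le_of_summable
      (fun n => (‖hardyDiff γ n‖ ^ 2 * (1 / (((n : ℝ) + 1) * (n + 2))) +
        1 / (((n : ℝ) + 1) * (n + 2))) / 2) (fun n => ?_)
      ((hD.add hasSum_telescope.summable).div_const 2)
    have h1 := average_sub_average γ n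
    have h2 : σ n - σ n.succ =
        hardyDiff γ n * ((1 / (((n : ℝ) + 1) * (n + 2)) : ℝ) : ℂ) := by
      rw [← h1]
      simp only [hσ, Nat.succ_eq_add_one]
      push_cast
      ring_nf
    have hq0 : (0 : ℝ) ≤ 1 / (((n : ℝ) + 1) * (n + 2)) := by positivity
    rw [dist_eq_norm, h2, norm_mul, Complex.norm_real, Real.norm_of_nonneg hq0]
    nlinarith [mul_nonneg hq0 (sq_nonneg (‖hardyDiff γ n‖ - 1))]
  obtain ⟨L, hL⟩ := cauchySeq_tendsto_of_complete hc
  -- By the telescoped identity for γ - L, the partial sums are a partial sum of the D-series, at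
  -- most E, plus (N + 1)|σ_N - L|², at most E by the rate of convergence.
  refine ⟨L, summable_of_sum_range_le (c := 2 * E) (fun n => by positivity) fun N => ?_⟩
  have hlim (m : ℕ) : ‖σ m - L‖ ^ 2 ≤ E * (1 / ((m : ℝ) + 1)) := by
    have h1 : Tendsto (fun j => ‖σ m - σ (m + j)‖ ^ 2) atTop (𝓝 (‖σ m - L‖ ^ 2)) := by
      refine ((tendsto_const_nhds.sub ?_).norm).pow 2
      exact hL.comp (tendsto_atTop_mono (fun j => Nat.le_add_left j m) tendsto_id)
    exact le_of_tendsto' h1 (hbound m)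
  have hsum := sum_hardyDiff (fun n => γ n - L) N
  rw [hardyDiff_sub_const] at hsum
  have h1 : ‖∑ k ∈ range (N + 1), (γ k - L)‖ ^ 2 / ((N : ℝ) + 1) ≤ E := by
    have h2 : ∑ k ∈ range (N + 1), (γ k - L) = ((N : ℂ) + 1) * (σ N - L) := by
      have h3 : (N : ℂ) + 1 ≠ 0 := by exact_mod_cast N.succ_ne_zero
      simp only [hσ, sum_sub_distrib, sum_const, card_range, nsmul_eq_mul]
      push_cast
      field_simp
    have h4 : ‖(N : ℂ) + 1‖ = N + 1 := by
      rw [show (N : ℂ) + 1 = ((N + 1 : ℝ) : ℂ) by push_cast; rfl, Complex.norm_real,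
        Real.norm_of_nonneg (by positivity)]
    rw [h2, norm_mul, h4, mul_pow, div_le_iff₀ (by positivity)]
    have h5 := hlim N
    rw [mul_one_div, le_div_iff₀ (by positivity)] at h5
    nlinarith [h5, (by positivity : (0 : ℝ) < (N : ℝ) + 1)]
  have h6 := hD.sum_le_tsum (range N) (fun n _ => by positivity)
  have h7 : ∑ n ∈ range N, ‖γ n - L‖ ^ 2 ≤ ∑ n ∈ range (N + 1), ‖γ n - L‖ ^ 2 :=
    sum_le_sum_of_subset_of_nonneg (range_mono (Nat.le_succ N)) fun n _ _ => by positivity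
  linarith

end Discrete

/-! ### The Dirichlet integral at a boundary point -/

section Boundary

variable {ζ : ℂ} {f : ℂ → ℂ} {u γ : ℕ → ℂ}

/-- The n-th Taylor coefficient of f'/(ζ - z) is a convolution with powers of ζ̄; multiplied by the
unimodular ζ^{n+2} it becomes D_n. The sequence γ matters only through its differences. -/
theorem dirichletIntegral_eq_tsum_hardyDiff (hζ : ‖ζ‖ = 1) (hf : HasTaylor f u)
    (hγ : ∀ k, ζ ^ (k + 1) * u (k + 1) = γ k - γ (k + 1)) :
    dirichletIntegral ζ f =
      ∑' n : ℕ, ENNReal.ofReal (‖hardyDiff γ n‖ ^ 2 * (1 / (((n : ℝ) + 1) * (n + 2)))) := by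
  have hζζ : ζ * conj ζ = 1 := by
    rw [Complex.mul_conj, Complex.normSq_eq_norm_sq, hζ]; simp
  have hd := hf.deriv.mul ((HasTaylor.geom (w := conj ζ) (by simp [hζ])).const_mul (conj ζ))
  have hd' : HasTaylor (fun z => deriv f z / (ζ - z)) _ := hd.congr fun z hz => by
    have h1 : 1 - conj ζ * z ≠ 0 := by
      rw [mul_comm]
      exact one_sub_mul_ne_zero (by simpa using hz) (by simp [hζ])
    have h2 : ζ - z ≠ 0 := by
      intro h
      apply h1
      rw [← sub_eq_zero.1 h, mul_comm, hζζ, sub_self]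
    rw [div_eq_mul_inv]
    congr 1
    rw [← div_eq_mul_inv, inv_eq_one_div, div_eq_div_iff h2 h1]
    linear_combination -hζζ
  rw [dirichletIntegral_of_norm_eq_one hζ hd']
  refine tsum_congr fun n => ?_
  rw [ENNReal.ofReal_mul (by positivity), ENNReal.ofReal_pow (norm_nonneg _), ofReal_norm]
  congr 2
  have h3 : ζ ^ (n + 2) * (∑ k ∈ Finset.range (n + 1),
      ((k : ℂ) + 1) * u (k + 1) * (conj ζ * conj ζ ^ (n - k))) = hardyDiff γ n := by
    rw [hardyDiff, Finset.mul_sum]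
    refine Finset.sum_congr rfl fun k hk => ?_
    have hk : k ≤ n := by simpa [Nat.lt_succ_iff] using hk
    have h4 : ζ ^ (n + 2) * (conj ζ * conj ζ ^ (n - k)) = ζ ^ (k + 1) := by
      have : n + 2 = (k + 1) + (n - k + 1) := by omega
      rw [← pow_succ', this, pow_add ζ (k + 1), mul_assoc, ← mul_pow, hζζ, one_pow, mul_one]
    rw [← hγ, ← h4]
    ring
  rw [← h3, enorm_mul, enorm_pow, ← ofReal_norm ζ, hζ]
  simp

theorem exists_of_dirichletIntegral_lt_top_of_norm_eq_one (hζ : ‖ζ‖ = 1)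
    (hf : DifferentiableOn ℂ f (ball 0 1)) (hfin : dirichletIntegral ζ f < ∞) :
    ∃ (c : ℂ) (G : hardyTwo),
      Set.EqOn f (fun z => c + (z - ζ) * diskValue (G : Lp ℂ 2 arcMeasure) z) (ball 0 1) := by
  have hT := HasTaylor.of_differentiableOn hf
  set u : ℕ → ℂ := fun n => iteratedDeriv n f 0 / (n.factorial : ℂ)
  have hζ0 : ζ ≠ 0 := fun h => by simp [h] at hζ
  have hζζ : ζ * conj ζ = 1 := by
    rw [Complex.mul_conj, Complex.normSq_eq_norm_sq, hζ]; simp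
  have hζb : ‖conj ζ‖ = 1 := by simpa using hζ
  -- A solution of the difference equation normalised by γ₀ 0 = 0; the correct additive constant is
  -- the L found below.
  set γ₀ : ℕ → ℂ := fun n => -∑ k ∈ Finset.range n, ζ ^ (k + 1) * u (k + 1) with hγ₀
  have hγ₀d (k : ℕ) : ζ ^ (k + 1) * u (k + 1) = γ₀ k - γ₀ (k + 1) := by
    simp only [hγ₀, Finset.sum_range_succ]
    ring
  rw [dirichletIntegral_eq_tsum_hardyDiff hζ hT hγ₀d] at hfin
  have hs := ENNReal.summable_toReal hfin.ne
  obtain ⟨L, hL⟩ := exists_summable_sub_const (γ := γ₀) (by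
    refine hs.congr fun n => ?_
    rw [ENNReal.toReal_ofReal (by positivity)])
  obtain ⟨G, hG⟩ := exists_hardyTwo_of_summable (u := fun n => conj ζ ^ (n + 1) * (γ₀ n - L)) (by
    refine hL.congr fun n => ?_
    rw [norm_mul, norm_pow, hζb, one_pow, one_mul])
  have hGT := hasTaylor_diskValue_hardyTwo G
  simp only [hG] at hGT
  -- The constant is f(0) + ζG(0), as evaluation of c + (z - ζ)G at 0 demands.
  refine ⟨u 0 + ζ * (conj ζ * (γ₀ 0 - L)), G, hT.eqOn ?_⟩
  have h1 := (HasTaylor.const (u 0 + ζ * (conj ζ * (γ₀ 0 - L)))).add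
    (hGT.id_mul.add (hGT.const_mul (-ζ)))
  convert h1 using 1
  · funext z
    simp only [Pi.add_apply]
    ring
  · funext n
    cases n with
    | zero => simp
    | succ n =>
      have h2 : u (n + 1) = conj ζ ^ (n + 1) * (γ₀ n - γ₀ (n + 1)) := by
        rw [← hγ₀d, ← mul_assoc, ← mul_pow, mul_comm (conj ζ), hζζ, one_pow, one_mul]
      simp only [Pi.add_apply, Pi.zero_apply, h2]
      linear_combination (conj ζ ^ (n + 1) * (γ₀ (n + 1) - L)) * hζζ

theorem dirichletIntegral_of_eqOn_of_norm_eq_one (hζ : ‖ζ‖ = 1) {c : ℂ} {G : hardyTwo}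
    (h : Set.EqOn f (fun z => c + (z - ζ) * diskValue (G : Lp ℂ 2 arcMeasure) z) (ball 0 1)) :
    dirichletIntegral ζ f = ENNReal.ofReal (‖G‖ ^ 2) := by
  have hGT := hasTaylor_diskValue_hardyTwo G
  set w : ℕ → ℂ := fun n => fourierCoeff (G : Lp ℂ 2 arcMeasure) n
  have hT := ((HasTaylor.const c).add (hGT.id_mul.add (hGT.const_mul (-ζ)))).congr (g := f)
    fun z hz => by
      rw [h hz]
      simp only [Pi.add_apply]
      ring
  have hsum := hasSum_norm_sq_coeff G
  have hγs : Summable fun n => ‖ζ ^ (n + 1) * w n‖ ^ 2 := by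
    refine hsum.summable.congr fun n => ?_
    rw [norm_mul, norm_pow, hζ, one_pow, one_mul]
  rw [dirichletIntegral_eq_tsum_hardyDiff hζ hT (γ := fun n => ζ ^ (n + 1) * w n) fun k => ?_,
    ← ENNReal.ofReal_tsum_of_nonneg (fun n => by positivity) (hasSum_hardyDiff hγs).summable,
    (hasSum_hardyDiff hγs).tsum_eq, ← hsum.tsum_eq]
  · congr 1
    refine tsum_congr fun n => ?_
    rw [norm_mul, norm_pow, hζ, one_pow, one_mul]
  · simp
    ring

end Boundary

/-! ### The involution of the disk exchanging `0` and `ζ` -/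

/-- The involutive automorphism `w ↦ (ζ - w) / (1 - ζ̄ w)` of the disk. -/
noncomputable def diskInv (ζ w : ℂ) : ℂ := (ζ - w) / (1 - conj ζ * w)

theorem normSq_one_sub_sub_normSq_sub (ζ w : ℂ) :
    ‖1 - conj ζ * w‖ ^ 2 - ‖ζ - w‖ ^ 2 = (1 - ‖ζ‖ ^ 2) * (1 - ‖w‖ ^ 2) := by
  simp only [← Complex.normSq_eq_norm_sq, Complex.normSq_apply, Complex.sub_re, Complex.sub_im,
    Complex.mul_re, Complex.mul_im, Complex.conj_re, Complex.conj_im, Complex.one_re,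
    Complex.one_im]
  ring

section DiskInv

variable {ζ : ℂ}

theorem one_sub_conj_mul_ne_zero (hζ : ‖ζ‖ < 1) {w : ℂ} (hw : ‖w‖ ≤ 1) : 1 - conj ζ * w ≠ 0 :=
  one_sub_mul_ne_zero (by rwa [RCLike.norm_conj]) hw

theorem one_sub_normSq_pos (hζ : ‖ζ‖ < 1) : 0 < 1 - ‖ζ‖ ^ 2 := by
  have := norm_nonneg ζ
  nlinarith

theorem conj_mul_self_eq (ζ : ℂ) : conj ζ * ζ = ((‖ζ‖ ^ 2 : ℝ) : ℂ) := by
  rw [mul_comm, Complex.mul_conj, Complex.normSq_eq_norm_sq]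

theorem one_sub_conj_mul_self_ne_zero (hζ : ‖ζ‖ < 1) : 1 - conj ζ * ζ ≠ 0 :=
  one_sub_conj_mul_ne_zero hζ hζ.le

theorem diskInv_mem_ball (hζ : ‖ζ‖ < 1) {w : ℂ} (hw : w ∈ ball (0 : ℂ) 1) :
    diskInv ζ w ∈ ball (0 : ℂ) 1 := by
  rw [mem_ball_zero_iff] at hw ⊢
  have h0 := norm_pos_iff.2 (one_sub_conj_mul_ne_zero hζ hw.le)
  rw [diskInv, norm_div, div_lt_one h0]
  have h1 := normSq_one_sub_sub_normSq_sub ζ w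
  have h2 := mul_pos (one_sub_normSq_pos hζ) (one_sub_normSq_pos hw)
  exact lt_of_pow_lt_pow_left₀ 2 h0.le (by linarith)

theorem norm_diskInv_of_norm_eq_one (hζ : ‖ζ‖ < 1) {w : ℂ} (hw : ‖w‖ = 1) : ‖diskInv ζ w‖ = 1 := by
  have h0 := norm_pos_iff.2 (one_sub_conj_mul_ne_zero hζ hw.le)
  rw [diskInv, norm_div, div_eq_one_iff_eq h0.ne']
  have h1 := normSq_one_sub_sub_normSq_sub ζ w
  rw [hw, one_pow, sub_self, mul_zero] at h1
  exact ((pow_left_inj₀ (norm_nonneg _) h0.le two_ne_zero).1 (by linarith))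

theorem one_sub_conj_mul_diskInv (hζ : ‖ζ‖ < 1) {w : ℂ} (hw : w ∈ ball (0 : ℂ) 1) :
    1 - conj ζ * diskInv ζ w = (1 - conj ζ * ζ) / (1 - conj ζ * w) := by
  have h0 := one_sub_conj_mul_ne_zero hζ (mem_ball_zero_iff.1 hw).le
  rw [diskInv, eq_div_iff h0, sub_mul, mul_assoc, div_mul_cancel₀ _ h0]
  ring

theorem diskInv_diskInv (hζ : ‖ζ‖ < 1) {w : ℂ} (hw : w ∈ ball (0 : ℂ) 1) :
    diskInv ζ (diskInv ζ w) = w := by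
  have h0 := one_sub_conj_mul_ne_zero hζ (mem_ball_zero_iff.1 hw).le
  have h1 := one_sub_conj_mul_self_ne_zero hζ
  rw [diskInv, one_sub_conj_mul_diskInv hζ hw, div_eq_iff (div_ne_zero h1 h0), diskInv,
    mul_div_assoc', eq_div_iff h0, sub_mul, div_mul_cancel₀ _ h0]
  ring

theorem diskInv_sub_self (hζ : ‖ζ‖ < 1) {w : ℂ} (hw : w ∈ ball (0 : ℂ) 1) :
    diskInv ζ w - ζ = -(1 - conj ζ * ζ) * w / (1 - conj ζ * w) := by
  have h0 := one_sub_conj_mul_ne_zero hζ (mem_ball_zero_iff.1 hw).le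
  rw [diskInv, eq_div_iff h0, sub_mul, div_mul_cancel₀ _ h0]
  ring

theorem hasDerivAt_diskInv (hζ : ‖ζ‖ < 1) {w : ℂ} (hw : w ∈ ball (0 : ℂ) 1) :
    HasDerivAt (diskInv ζ) (-(1 - conj ζ * ζ) / (1 - conj ζ * w) ^ 2) w := by
  have h0 := one_sub_conj_mul_ne_zero hζ (mem_ball_zero_iff.1 hw).le
  refine HasDerivAt.congr_deriv (((hasDerivAt_id w).const_sub ζ).div
    (((hasDerivAt_id w).const_mul (conj ζ)).const_sub 1) h0) ?_
  simp only [id]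
  ring

theorem image_diskInv_ball (hζ : ‖ζ‖ < 1) :
    Set.image (diskInv ζ) (ball (0 : ℂ) 1) = ball (0 : ℂ) 1 := by
  refine Set.Subset.antisymm ?_ fun w hw => ⟨_, diskInv_mem_ball hζ hw, diskInv_diskInv hζ hw⟩
  rintro _ ⟨w, hw, rfl⟩
  exact diskInv_mem_ball hζ hw

theorem injOn_diskInv (hζ : ‖ζ‖ < 1) : Set.InjOn (diskInv ζ) (ball 0 1) := fun w hw v hv h => by
  rw [← diskInv_diskInv hζ hw, h, diskInv_diskInv hζ hv]

theorem lintegral_ball_diskInv (hζ : ‖ζ‖ < 1) (u : ℂ → ℝ≥0∞) :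
    ∫⁻ z in ball (0 : ℂ) 1, u z = ∫⁻ w in ball (0 : ℂ) 1,
      ENNReal.ofReal (‖-(1 - conj ζ * ζ) / (1 - conj ζ * w) ^ 2‖ ^ 2) * u (diskInv ζ w) := by
  have h := lintegral_image_eq_lintegral_abs_det_fderiv_mul (μ := volume) (measurableSet_ball)
    (fun w hw => ((hasDerivAt_diskInv hζ hw).hasFDerivAt.restrictScalars ℝ).hasFDerivWithinAt)
    (injOn_diskInv hζ) u
  rw [image_diskInv_ball hζ] at h
  rw [h]
  refine setLIntegral_congr_fun measurableSet_ball fun w _ => ?_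
  simp [ContinuousLinearMap.det, LinearMap.det_restrictScalars, Algebra.norm_complex_eq,
    Complex.normSq_eq_norm_sq, abs_div, div_pow]

end DiskInv

/-! ### The induced isometry of `H²` -/

/-- A unit vector orthogonal to the range of an isometry is a wandering vector: applying V⁻ⁿ to Vⁿk
and V^{n+m+1}k reduces their inner product to that of k with a vector in the range. -/
theorem orthonormal_pow_apply {H : Type*} [NormedAddCommGroup H] [InnerProductSpace ℂ H]
    {V : H →L[ℂ] H} (hV : ∀ x, ‖V x‖ = ‖x‖) {k : H} (hk : ‖k‖ = 1)
    (hkV : ∀ x, inner ℂ k (V x) = 0) : Orthonormal ℂ fun n : ℕ => (V ^ n) k := by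
  let W : H →ₗᵢ[ℂ] H := ⟨V, hV⟩
  have hin (x y : H) : inner ℂ (V x) (V y) = inner ℂ x y := W.inner_map_map x y
  have hpow (n : ℕ) (x : H) : (V ^ (n + 1)) x = V ((V ^ n) x) := by rw [pow_succ']; rfl
  have hlt (n m : ℕ) : inner ℂ ((V ^ n) k) ((V ^ (n + m + 1)) k) = 0 := by
    induction n with
    | zero => simpa [hpow] using hkV _
    | succ n ih =>
      rw [show n + 1 + m + 1 = n + m + 1 + 1 by ring, hpow, hpow (n + m + 1), hin, ih]
  refine ⟨fun n => ?_, fun n m hnm => ?_⟩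
  · induction n with
    | zero => simpa using hk
    | succ n ih => exact (congrArg _ (hpow n k)).trans ((hV _).trans ih)
  · rcases lt_or_gt_of_ne hnm with h | h
    · obtain ⟨d, rfl⟩ := Nat.exists_eq_add_of_lt h
      exact hlt n d
    · obtain ⟨d, rfl⟩ := Nat.exists_eq_add_of_lt h
      exact inner_eq_zero_symm.1 (hlt m d)

section Isometry

variable {ζ : ℂ}

/-- φ is a constant plus a multiple of z/(1 - ζ̄z) and has modulus 1 on the circle, so
multiplication by it is isometric. -/
theorem exists_toeplitz_diskInv (hζ : ‖ζ‖ < 1) : ∃ V : hardyTwo →L[ℂ] hardyTwo,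
    (∀ F, ‖V F‖ = ‖F‖) ∧ ∀ F, ∀ w ∈ ball (0 : ℂ) 1,
      diskValue (V F : Lp ℂ 2 arcMeasure) w = diskInv ζ w * diskValue (F : Lp ℂ 2 arcMeasure) w := by
  have hζ' : ‖conj ζ‖ < 1 := by rwa [RCLike.norm_conj]
  have hform {w : ℂ} (hw : ‖w‖ ≤ 1) :
      ζ + -(1 - conj ζ * ζ) * (w / (1 - conj ζ * w)) = diskInv ζ w := by
    have h0 := one_sub_conj_mul_ne_zero hζ hw
    rw [diskInv, eq_div_iff h0, add_mul, mul_assoc, div_mul_cancel₀ _ h0]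
    ring
  have hH := isHardyInfty_const_add_smul_geomSymbol ζ (-(1 - conj ζ * ζ)) hζ'
  refine ⟨toeplitz (constSymbol ζ + (-(1 - conj ζ * ζ)) • geomSymbol (conj ζ) hζ'),
    fun F => ?_, fun F w hw => ?_⟩
  · refine (pow_left_inj₀ (norm_nonneg _) (norm_nonneg _) two_ne_zero).1 ?_
    simp only [Submodule.coe_norm, norm_sq_eq_integral]
    refine integral_congr_ae ?_
    filter_upwards [coeFn_toeplitz hH F,
      coeFn_const_add_smul_geomSymbol ζ (-(1 - conj ζ * ζ)) hζ'] with t h1 h2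
    rw [h1, h2, hform (norm_toCircle t).le, norm_mul,
      norm_diskInv_of_norm_eq_one hζ (norm_toCircle t), one_mul]
  · rw [diskValue_toeplitz hH F hw, diskValue_const_add_smul_geomSymbol _ _ _ hw,
      hform (mem_ball_zero_iff.1 hw).le]

/-- The vector is the normalised Szegő kernel at ζ, orthogonal to every function that vanishes at ζ
and so to φH². -/
theorem exists_unit_kernel (hζ : ‖ζ‖ < 1) : ∃ k : hardyTwo, ‖k‖ = 1 ∧
    (∀ F : hardyTwo, diskValue (F : Lp ℂ 2 arcMeasure) ζ = 0 → inner ℂ k F = 0) ∧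
    ∀ w ∈ ball (0 : ℂ) 1, diskValue (k : Lp ℂ 2 arcMeasure) w =
      (√(1 - ‖ζ‖ ^ 2) : ℂ) / (1 - conj ζ * w) := by
  have hs := one_sub_normSq_pos hζ
  obtain ⟨K, hKc, hK⟩ := exists_szegoKernel (mem_ball_zero_iff.2 hζ)
  have hval : ∀ w ∈ ball (0 : ℂ) 1, diskValue (K : Lp ℂ 2 arcMeasure) w =
      (1 - conj ζ * w)⁻¹ := fun w hw => by
    have h1 := hasTaylor_diskValue_hardyTwo K
    simp only [hKc] at h1
    exact h1.eqOn (HasTaylor.geom (by rw [RCLike.norm_conj]; exact hζ.le)) hw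
  have hnorm : ‖K‖ ^ 2 = (1 - ‖ζ‖ ^ 2)⁻¹ := by
    have h1 : ((‖K‖ : ℂ)) ^ 2 = inner ℂ K K := (inner_self_eq_norm_sq_to_K K).symm
    rw [hK, hval ζ (mem_ball_zero_iff.2 hζ), conj_mul_self_eq] at h1
    exact_mod_cast h1
  refine ⟨(√(1 - ‖ζ‖ ^ 2) : ℂ) • K, ?_, fun F hF => ?_, fun w hw => ?_⟩
  · refine (pow_left_inj₀ (norm_nonneg _) zero_le_one two_ne_zero).1 ?_
    have h1 : ‖(√(1 - ‖ζ‖ ^ 2) : ℂ) • K‖ = √(1 - ‖ζ‖ ^ 2) * ‖K‖ := by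
      refine (norm_smul _ K).trans ?_
      rw [Complex.norm_real, Real.norm_of_nonneg (Real.sqrt_nonneg _)]
    rw [h1, mul_pow, hnorm, Real.sq_sqrt hs.le, mul_inv_cancel₀ hs.ne', one_pow]
  · refine (inner_smul_left K F _).trans ?_
    rw [hK, hF, mul_zero]
  · rw [diskValue_smul _ _ hw, hval w hw, div_eq_mul_inv]

/-- The map sends zⁿ to φⁿk, with k the normalised kernel at ζ, and these functions are orthonormal
because k is orthogonal to φH². Surjectivity is not needed. -/
theorem exists_isometry_diskInv (hζ : ‖ζ‖ < 1) (G : hardyTwo) : ∃ G' : hardyTwo, ‖G'‖ = ‖G‖ ∧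
    ∀ w ∈ ball (0 : ℂ) 1, diskValue (G' : Lp ℂ 2 arcMeasure) w =
      (√(1 - ‖ζ‖ ^ 2) : ℂ) / (1 - conj ζ * w) *
        diskValue (G : Lp ℂ 2 arcMeasure) (diskInv ζ w) := by
  obtain ⟨V, hV, hVd⟩ := exists_toeplitz_diskInv hζ
  obtain ⟨k, hk, hk0, hkd⟩ := exists_unit_kernel hζ
  have ho := orthonormal_pow_apply hV hk fun F => hk0 _ (by
    rw [hVd F ζ (mem_ball_zero_iff.2 hζ), diskInv, sub_self, zero_div, zero_mul])
  have hd (n : ℕ) : ∀ w ∈ ball (0 : ℂ) 1, diskValue (((V ^ n) k : hardyTwo) : Lp ℂ 2 arcMeasure) w =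
      diskInv ζ w ^ n * ((√(1 - ‖ζ‖ ^ 2) : ℂ) / (1 - conj ζ * w)) := fun w hw => by
    induction n with
    | zero => rw [pow_zero, pow_zero, one_mul]; exact hkd w hw
    | succ n ih =>
      have : (V ^ (n + 1)) k = V ((V ^ n) k) := by rw [pow_succ']; rfl
      rw [this, hVd _ w hw, ih, pow_succ' (diskInv ζ w), mul_assoc]
  have hsum := ho.orthogonalFamily.hasSum_linearIsometry (hardyBasis.repr G)
  refine ⟨ho.orthogonalFamily.linearIsometry (hardyBasis.repr G),
    (LinearIsometry.norm_map _ _).trans (hardyBasis.repr.norm_map G), fun w hw => ?_⟩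
  obtain ⟨K, -, hK⟩ := exists_szegoKernel hw
  rw [← hK]
  have h1 := (innerSL ℂ K).hasSum hsum
  refine h1.unique ?_
  have h2 := (hasTaylor_diskValue_hardyTwo G _ (diskInv_mem_ball hζ hw)).mul_left
    ((√(1 - ‖ζ‖ ^ 2) : ℂ) / (1 - conj ζ * w))
  refine Eq.mpr (congrArg (HasSum · _) (funext fun n => ?_)) h2
  refine (inner_smul_right K ((V ^ n) k) (hardyBasis.repr G n)).trans ?_
  rw [hK, hd n w hw, hardyBasis_repr]
  ring

end Isometry

/-! ### The weighted Dirichlet integral for a point of the disk -/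

section Interior

variable {ζ : ℂ} {f : ℂ → ℂ}

theorem sqrt_one_sub_normSq_mul_self (hζ : ‖ζ‖ < 1) :
    (√(1 - ‖ζ‖ ^ 2) : ℂ) * (√(1 - ‖ζ‖ ^ 2) : ℂ) = 1 - conj ζ * ζ := by
  rw [conj_mul_self_eq, ← Complex.ofReal_mul, Real.mul_self_sqrt (one_sub_normSq_pos hζ).le]
  push_cast
  rfl

/-- The Green function is conformally invariant. At w = 0 both sides are 0, by the conventions for
division by 0 and log 0. -/
theorem dirichletWeight_diskInv (hζ : ‖ζ‖ < 1) {w : ℂ} (hw : w ∈ ball (0 : ℂ) 1) :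
    dirichletWeight ζ (diskInv ζ w) = (1 - ‖ζ‖ ^ 2)⁻¹ * (-2 * Real.log ‖w‖) := by
  have h1 : (1 - conj ζ * diskInv ζ w) / (ζ - diskInv ζ w) = w⁻¹ := by
    have := diskInv_diskInv hζ hw
    rw [← inv_div, ← diskInv, this]
  rw [dirichletWeight, if_pos hζ, h1, norm_inv, Real.log_inv]
  ring

/-- Under z = φ(w) the Jacobian |φ'|² combines with |f'(φ(w))|² to |(f∘φ)'|², and Littlewood–Paley
applies to f∘φ. -/
theorem dirichletIntegral_eq_tsum_diskInv (hζ : ‖ζ‖ < 1) (hf : DifferentiableOn ℂ f (ball 0 1))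
    {F : ℂ → ℂ} {u : ℕ → ℂ} (hF : HasTaylor F u) (hfF : ∀ w ∈ ball (0 : ℂ) 1, F w = f (diskInv ζ w)) :
    dirichletIntegral ζ f = ENNReal.ofReal (1 - ‖ζ‖ ^ 2)⁻¹ * ∑' n, ‖u (n + 1)‖ₑ ^ 2 := by
  have hs := inv_pos.2 (one_sub_normSq_pos hζ)
  rw [← littlewood_paley hF, dirichletIntegral, lintegral_ball_diskInv hζ,
    mul_left_comm (ENNReal.ofReal (1 - ‖ζ‖ ^ 2)⁻¹)]
  congr 1
  rw [← lintegral_const_mul' (ENNReal.ofReal (1 - ‖ζ‖ ^ 2)⁻¹) _ ENNReal.ofReal_ne_top]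
  refine setLIntegral_congr_fun (measurableSet_ball (x := (0 : ℂ)) (ε := 1)) fun w hw => ?_
  have hfd := hf.differentiableAt (isOpen_ball.mem_nhds (diskInv_mem_ball hζ hw))
  have hd : deriv F w = deriv f (diskInv ζ w) * (-(1 - conj ζ * ζ) / (1 - conj ζ * w) ^ 2) := by
    refine HasDerivAt.deriv ((hfd.hasDerivAt.comp w (hasDerivAt_diskInv hζ hw)).congr_of_eventuallyEq ?_)
    filter_upwards [isOpen_ball.mem_nhds hw] with v hv
    exact hfF v hv
  rw [dirichletWeight_diskInv hζ hw, hd, ← ENNReal.ofReal_mul (by positivity),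
    ← ENNReal.ofReal_mul hs.le, norm_mul]
  congr 1
  ring

/-- Since φ(w) - ζ = -(1 - |ζ|²)w/(1 - ζ̄w), the composition f∘φ is c - √(1 - |ζ|²) w h(w).
Littlewood–Paley ignores c, and the square of the constant cancels the factor (1 - |ζ|²)⁻¹. No
finiteness is assumed, so the identity also serves in the converse direction. -/
theorem dirichletIntegral_eq_hardyNormSq (hζ : ‖ζ‖ < 1) {c : ℂ} {g : ℂ → ℂ}
    (hg : DifferentiableOn ℂ g (ball 0 1))
    (hfg : Set.EqOn f (fun z => c + (z - ζ) * g z) (ball 0 1)) {h : ℂ → ℂ} {v : ℕ → ℂ}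
    (hv : HasTaylor h v) (hh : ∀ w ∈ ball (0 : ℂ) 1,
      h w = (√(1 - ‖ζ‖ ^ 2) : ℂ) / (1 - conj ζ * w) * g (diskInv ζ w)) :
    dirichletIntegral ζ f = ∑' n, ‖v n‖ₑ ^ 2 := by
  have hs := one_sub_normSq_pos hζ
  have hf : DifferentiableOn ℂ f (ball 0 1) :=
    DifferentiableOn.congr ((differentiableOn_const c).add
      ((differentiableOn_id.sub_const ζ).mul hg)) hfg
  rw [dirichletIntegral_eq_tsum_diskInv hζ hf
    ((HasTaylor.const c).add (hv.id_mul.const_mul (-(√(1 - ‖ζ‖ ^ 2) : ℂ)))) fun w hw => ?_,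
    ← ENNReal.tsum_mul_left]
  · refine tsum_congr fun n => ?_
    have h1 : ‖(√(1 - ‖ζ‖ ^ 2) : ℂ)‖ₑ ^ 2 = ENNReal.ofReal (1 - ‖ζ‖ ^ 2) := by
      rw [← ofReal_norm, ← ENNReal.ofReal_pow (norm_nonneg _), Complex.norm_real,
        Real.norm_of_nonneg (Real.sqrt_nonneg _), Real.sq_sqrt hs.le]
    simp only [Pi.add_apply, Pi.zero_apply, zero_add]
    rw [enorm_mul, enorm_neg, mul_pow, h1, ← mul_assoc, ← ENNReal.ofReal_mul (inv_pos.2 hs).le,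
      inv_mul_cancel₀ hs.ne', ENNReal.ofReal_one, one_mul]
  · have h0 := one_sub_conj_mul_ne_zero hζ (mem_ball_zero_iff.1 hw).le
    rw [hfg (diskInv_mem_ball hζ hw)]
    simp only [Pi.add_apply]
    rw [hh w hw, diskInv_sub_self hζ hw, ← sqrt_one_sub_normSq_mul_self hζ]
    ring

theorem dirichletIntegral_of_eqOn_of_norm_lt_one (hζ : ‖ζ‖ < 1) {c : ℂ} {G : hardyTwo}
    (h : Set.EqOn f (fun z => c + (z - ζ) * diskValue (G : Lp ℂ 2 arcMeasure) z) (ball 0 1)) :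
    dirichletIntegral ζ f = ENNReal.ofReal (‖G‖ ^ 2) := by
  obtain ⟨G', hnorm, hG'⟩ := exists_isometry_diskInv hζ G
  rw [dirichletIntegral_eq_hardyNormSq hζ (hasTaylor_diskValue_hardyTwo G).differentiableOn h
    (hasTaylor_diskValue_hardyTwo G') hG', ← hnorm, ← hardyNormSq_diskValue,
    (hasTaylor_diskValue_hardyTwo G').hardyNormSq_eq]

/-- With g the difference quotient of f at ζ, finiteness puts its weighted composition with φ in H².
The weighted composition is an involution, so applying it once more shows that g itself is in H². -/
theorem exists_of_dirichletIntegral_lt_top_of_norm_lt_one (hζ : ‖ζ‖ < 1)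
    (hf : DifferentiableOn ℂ f (ball 0 1)) (hfin : dirichletIntegral ζ f < ∞) :
    ∃ (c : ℂ) (G : hardyTwo),
      Set.EqOn f (fun z => c + (z - ζ) * diskValue (G : Lp ℂ 2 arcMeasure) z) (ball 0 1) := by
  have hζb : ζ ∈ ball (0 : ℂ) 1 := mem_ball_zero_iff.2 hζ
  have hg : DifferentiableOn ℂ (dslope f ζ) (ball 0 1) :=
    (Complex.differentiableOn_dslope (isOpen_ball.mem_nhds hζb)).2 hf
  have hfg : Set.EqOn f (fun z => f ζ + (z - ζ) * dslope f ζ z) (ball 0 1) := fun z _ => by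
    have := sub_smul_dslope f ζ z
    rw [smul_eq_mul] at this
    simp only [this]
    ring
  set h : ℂ → ℂ := fun w => (√(1 - ‖ζ‖ ^ 2) : ℂ) / (1 - conj ζ * w) * dslope f ζ (diskInv ζ w)
    with hh
  have hd : DifferentiableOn ℂ h (ball 0 1) := by
    refine DifferentiableOn.mul (DifferentiableOn.div (differentiableOn_const _) (by fun_prop)
      fun w hw => one_sub_conj_mul_ne_zero hζ (mem_ball_zero_iff.1 hw).le) ?_
    exact hg.comp (fun w hw => (hasDerivAt_diskInv hζ hw).differentiableAt.differentiableWithinAt)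
      fun w hw => diskInv_mem_ball hζ hw
  have hT := HasTaylor.of_differentiableOn hd
  rw [dirichletIntegral_eq_hardyNormSq hζ hg hfg hT fun w _ => rfl, ← hT.hardyNormSq_eq] at hfin
  obtain ⟨H, hH⟩ := exists_hardyTwo_of_hardyNormSq_lt_top hd hfin
  obtain ⟨G, -, hG⟩ := exists_isometry_diskInv hζ H
  refine ⟨f ζ, G, fun z hz => ?_⟩
  have h0 := one_sub_conj_mul_ne_zero hζ (mem_ball_zero_iff.1 hz).le
  have h1 := one_sub_conj_mul_self_ne_zero hζ
  have h2 : diskValue (G : Lp ℂ 2 arcMeasure) z = dslope f ζ z := by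
    rw [hG z hz, hH (diskInv_mem_ball hζ hz), hh]
    beta_reduce
    rw [diskInv_diskInv hζ hz, one_sub_conj_mul_diskInv hζ hz, ← mul_assoc, div_mul_div_comm,
      sqrt_one_sub_normSq_mul_self hζ, mul_div_cancel₀ _ h0, div_self h1, one_mul]
  beta_reduce
  rw [hfg hz, h2]

end Interior

/-! ### The weighted Dirichlet space as a de Branges–Rovnyak space -/

theorem dirichletIntegral_of_eqOn {ζ : ℂ} (hζ : ‖ζ‖ ≤ 1) {f : ℂ → ℂ} {c : ℂ} {G : hardyTwo}
    (h : Set.EqOn f (fun z => c + (z - ζ) * diskValue (G : Lp ℂ 2 arcMeasure) z) (ball 0 1)) :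
    dirichletIntegral ζ f = ENNReal.ofReal (‖G‖ ^ 2) :=
  hζ.lt_or_eq.elim (fun hlt => dirichletIntegral_of_eqOn_of_norm_lt_one hlt h)
    fun heq => dirichletIntegral_of_eqOn_of_norm_eq_one heq h

theorem mem_dirichletSpace_iff {ζ : ℂ} (hζ : ‖ζ‖ ≤ 1) {f : ℂ → ℂ} :
    f ∈ dirichletSpace ζ ↔ ∃ (c : ℂ) (G : hardyTwo),
      Set.EqOn f (fun z => c + (z - ζ) * diskValue (G : Lp ℂ 2 arcMeasure) z) (ball 0 1) := by
  constructor
  · rintro ⟨hf, hfin⟩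
    rcases hζ.lt_or_eq with hlt | heq
    · exact exists_of_dirichletIntegral_lt_top_of_norm_lt_one hlt hf hfin
    · exact exists_of_dirichletIntegral_lt_top_of_norm_eq_one heq hf hfin
  · rintro ⟨c, G, h⟩
    refine ⟨DifferentiableOn.congr ((differentiableOn_const c).add
      ((differentiableOn_id.sub_const ζ).mul (hasTaylor_diskValue_hardyTwo G).differentiableOn)) h,
      ?_⟩
    rw [dirichletIntegral_of_eqOn hζ h]
    exact ENNReal.ofReal_lt_top

theorem exists_hardyTwo_const_add_mul (ζ c : ℂ) (G : hardyTwo) : ∃ F : hardyTwo,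
    Set.EqOn (diskValue (F : Lp ℂ 2 arcMeasure))
      (fun z => c + (z - ζ) * diskValue (G : Lp ℂ 2 arcMeasure) z) (ball 0 1) := by
  refine ⟨c • hardyBasis 0 + (hardyShift G + (-ζ) • G), fun z hz => ?_⟩
  rw [diskValue_add _ _ hz, diskValue_add _ _ hz, diskValue_smul _ _ hz, diskValue_smul _ _ hz,
    diskValue_hardyBasis _ hz, diskValue_hardyShift _ hz]
  ring

theorem theoremT (ζ : ℂ) (hζ : ‖ζ‖ ≤ 1) :
    -- there is a pair `(b, a)` with `b / a = z / (1 - ζ̄ z)`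
    (∃ b a : Lp ℂ ∞ arcMeasure, IsPair b a ∧
      ∀ z ∈ ball (0 : ℂ) 1, diskValue b z / diskValue a z = z / (1 - conj ζ * z)) ∧
    -- and for this pair `𝒟_ζ = ℋ(b)`, as spaces of functions on the disk, with equal norms
    ∀ b a : Lp ℂ ∞ arcMeasure, IsPair b a →
      (∀ z ∈ ball (0 : ℂ) 1, diskValue b z / diskValue a z = z / (1 - conj ζ * z)) →
      (∀ f : ℂ → ℂ, f ∈ dirichletSpace ζ ↔
        ∃ F ∈ dbrSpace b, Set.EqOn f (diskValue (F : Lp ℂ 2 arcMeasure)) (ball 0 1)) ∧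
      (∀ F ∈ dbrSpace b,
        dirichletNorm ζ (diskValue (F : Lp ℂ 2 arcMeasure)) = dbrNorm b F) := by
  have hpair := isPair_explicit hζ
  refine ⟨⟨_, _, hpair, fun z hz => pair_quotient hζ hz⟩, fun b a hba hq => ?_⟩
  -- ℋ(b) depends only on b, so uniqueness reduces the claim to the explicit pair.
  obtain rfl := pair_unique hζ hba hq
  refine ⟨fun f => ?_, fun F hF => ?_⟩
  · rw [mem_dirichletSpace_iff hζ]
    constructor
    · rintro ⟨c, G, h⟩
      obtain ⟨F, hF⟩ := exists_hardyTwo_const_add_mul ζ c G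
      exact ⟨F, (mem_dbrSpace_pairB_iff hζ hpair F).2 ⟨c, G, hF⟩, h.trans hF.symm⟩
    · rintro ⟨F, hF, h⟩
      obtain ⟨c, G, hG⟩ := (mem_dbrSpace_pairB_iff hζ hpair F).1 hF
      exact ⟨c, G, h.trans hG⟩
  · obtain ⟨c, G, hG⟩ := (mem_dbrSpace_pairB_iff hζ hpair F).1 hF
    rw [dbrNorm_pairB hζ hpair hG, dirichletNorm, hardyNormSq_diskValue,
      dirichletIntegral_of_eqOn hζ hG, ← ENNReal.ofReal_add (by positivity) (by positivity),
      ENNReal.toReal_ofReal (by positivity)]
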